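/- **Conventions.** A \emph{phase-free ZX-diagram} with $n$ outputs and no inputs is a finite open multigraph whose vertices (\emph{spiders}) are coloured $Z$ or $X$ and whose $n$ outputs have degree one (self-loops, parallel edges and bare wires between outputs are allowed). It denotes an $n$-qubit vector by tensor contraction, a $Z$-spider being $|0\cdots0\rangle+|1\cdots1\rangle$ and an $X$-spider $|{+}\cdots{+}\rangle+|{-}\cdots{-}\rangle$ on its legs. A \emph{fault} $F$ on $D$ puts a Pauli on every edge; its weight $\mathrm{wt}(F)$ is the number of non-identity Paulis. $D^F$ is the diagram with these Paulis inserted, and $F$ is \emph{undetectable} if $D^F\neq 0$. Diagrams $D_1,D_2$ are \emph{$w$-fault-equivalent} if for every undetectable fault $F_1$ on $D_1$ with $\mathrm{wt}(F_1)<w$ there is a fault $F_2$ on $D_2$ with $\mathrm{wt}(F_2)\le \mathrm{wt}(F_1)$ and $D_1^{F_1}=D_2^{F_2}$ up to a non-zero scalar, and vice versa. $D$ \emph{$t$-fault-tolerantly prepares the $n$-qubit CAT state} $|0\rangle^{\otimes n}+|1\rangle^{\otimes n}$ if it is $(t+1)$-fault-equivalent to a single $Z$-spider with $n$ output legs. A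 \emph{$Z$-graph} is such a diagram all of whose spiders are $Z$-spiders of degree $3$. A \emph{generalised CNOT circuit} (without inputs) consists of preparations of ancillae in $|0\rangle$ and $|+\rangle$, CNOT gates, $Z$- and $X$-basis measurements, and Pauli $X$ and $Z$ corrections conditioned on earlier outcomes, together with a set of allowed outcomes (post-selection) that contains the all-$0$ outcome, such that the all-$0$ outcome triggers no correction and all allowed outcomes yield the same state up to a scalar. Its \emph{associated diagram} is that of the all-$0$ branch: $|0\rangle,\langle0|$ are $1$-ary $X$-spiders, $|+\rangle,\langle+|$ are $1$-ary $Z$-spiders, and a CNOT is a $3$-ary $Z$-spider on the control joined by an edge to a $3$-ary $X$-spider on the target. The circuit $t$-fault-tolerantly prepares the CAT state if its associated diagram does. **Theorem.** There is a polynomial-time algorithm which, given the list of operations of any generalised CNOT circuit $C$ that has $k$ CNOT gates and $t$-fault-tolerantly prepares the $n$-qubit CAT state, where $n>1$ and $t\ge 0$, outputs a $Z$-graph with at most $k-1$ spiders that also $t$-fault-tolerantly prepares the $n$-qubit CAT state. (The algorithm and its polynomial time bound do not depend on $n$, $t$ and $k$.) -/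

import Mathlib

namespace CatPrep

/-! ## Phase-free ZX-diagrams without inputs -/

/-- The two kinds of spiders. -/
inductive Color where
  | Z : Color
  | X : Color

/-- A phase-free ZX-diagram without inputs and with `n` outputs: a finite multigraph (self-loops,
parallel edges and bare wires between two outputs are allowed) on the spiders `V` and the outputs
`Fin n`.  An edge `e` has the two ends `endpt e false` and `endpt e true`, and every output has
degree one. -/
structure ZXDiagram (n : ℕ) where
  V : Type
  E : Type
  [fintypeV : Fintype V]
  [fintypeE : Fintype E]
  color : V → Color
  endpt : E → Bool → V ⊕ Fin n
  output_degree_one : ∀ i : Fin n, ∃! h : E × Bool, endpt h.1 h.2 = Sum.inr i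

attribute [instance] ZXDiagram.fintypeV ZXDiagram.fintypeE

/-- The sign `(-1) ^ b` of a bit. -/
def sgn (b : ZMod 2) : ℂ := if b = 0 then 1 else -1

/-- Paulis modulo phase in symplectic form: `(a, c)` stands for `X ^ a * Z ^ c`, so that `(0, 0)`,
`(1, 0)`, `(0, 1)`, `(1, 1)` are `I`, `X`, `Z`, `Y` up to phase. -/
abbrev Pauli := ZMod 2 × ZMod 2

/-- The matrix entry `⟨i| X ^ a * Z ^ c |j⟩` of the Pauli `(a, c)`. -/
def Pauli.entry (P : Pauli) (i j : ZMod 2) : ℂ := if i = j + P.1 then sgn (P.2 * j) else 0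

/-- The coefficient of a phase-free spider at the basis state with value `x l` on the leg `l`, for
`l` in the finite set `legs`: the `Z`-spider is `|0…0⟩ + |1…1⟩`, the `X`-spider is
`|+…+⟩ + |-…-⟩`. -/
noncomputable def spiderCoeff {L : Type} (legs : Finset L) (x : L → ZMod 2) : Color → ℂ
  | Color.Z => (∏ l ∈ legs, if x l = 0 then 1 else 0) + ∏ l ∈ legs, if x l = 1 then 1 else 0
  | Color.X => (∏ _l ∈ legs, ((Real.sqrt 2 : ℝ) : ℂ)⁻¹) +
      ∏ l ∈ legs, sgn (x l) * ((Real.sqrt 2 : ℝ) : ℂ)⁻¹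

namespace ZXDiagram

variable {n : ℕ}

/-- The edge ends (half-edges) attached to a spider or to an output; a self-loop counts twice. -/
noncomputable def legs (D : ZXDiagram n) (w : D.V ⊕ Fin n) : Finset (D.E × Bool) :=
  open scoped Classical in Finset.univ.filter fun h => D.endpt h.1 h.2 = w

/-- A fault: a Pauli on every edge. -/
abbrev Fault (D : ZXDiagram n) := D.E → Pauli

/-- The weight of a fault: the number of edges that carry a non-identity Pauli. -/
noncomputable def weight (D : ZXDiagram n) (F : D.Fault) : ℕ :=
  open scoped Classical in (Finset.univ.filter fun e => F e ≠ 0).card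

/-- The state (vector of amplitudes in the computational basis) that is denoted by the diagram
with the Pauli `F e` placed on every edge `e`: the contraction of the tensor network of spiders,
where `x (e, s)` is the bit at the end `s` of the edge `e`. -/
noncomputable def faultyState (D : ZXDiagram n) (F : D.Fault) : (Fin n → ZMod 2) → ℂ := fun b =>
  open scoped Classical in
  ∑ x : D.E × Bool → ZMod 2,
    (∏ e : D.E, (F e).entry (x (e, true)) (x (e, false))) *
    (∏ v : D.V, spiderCoeff (D.legs (Sum.inl v)) x (D.color v)) *
    ∏ i : Fin n, ∏ h ∈ D.legs (Sum.inr i), if x h = b i then 1 else 0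

/-- A fault is undetectable if the diagram carrying it is not zero. -/
def Undetectable (D : ZXDiagram n) (F : D.Fault) : Prop := D.faultyState F ≠ 0

end ZXDiagram

/-- Equality up to a non-zero scalar. -/
def EqUpToScalar {n : ℕ} (φ ψ : (Fin n → ZMod 2) → ℂ) : Prop := ∃ c : ℂ, c ≠ 0 ∧ φ = c • ψ

namespace ZXDiagram

variable {n : ℕ}

/-- Every undetectable fault of weight less than `w` on `D₁` is matched by a fault on `D₂` of at
most the same weight. -/
def FaultsMatched (w : ℕ) (D₁ D₂ : ZXDiagram n) : Prop :=
  ∀ F₁ : D₁.Fault, D₁.Undetectable F₁ → D₁.weight F₁ < w →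
    ∃ F₂ : D₂.Fault, D₂.weight F₂ ≤ D₁.weight F₁ ∧
      EqUpToScalar (D₁.faultyState F₁) (D₂.faultyState F₂)

/-- `w`-fault-equivalence. -/
def FaultEquiv (w : ℕ) (D₁ D₂ : ZXDiagram n) : Prop :=
  FaultsMatched w D₁ D₂ ∧ FaultsMatched w D₂ D₁

/-- The `n`-qubit CAT state `|0…0⟩ + |1…1⟩` as a single `Z`-spider with `n` output legs. -/
def cat (n : ℕ) : ZXDiagram n where
  V := Unit
  E := Fin n
  color _ := Color.Z
  endpt e s := if s then Sum.inr e else Sum.inl ()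
  output_degree_one i := by
    refine ⟨(i, true), by simp, ?_⟩
    rintro ⟨e, s⟩ h
    cases s <;> simp_all

/-- `D` `t`-fault-tolerantly prepares the `n`-qubit CAT state. -/
def FTPreparesCAT (D : ZXDiagram n) (t : ℕ) : Prop := FaultEquiv (t + 1) D (cat n)

/-- A `Z`-graph: all spiders are 3-ary `Z`-spiders. -/
def IsZGraph (D : ZXDiagram n) : Prop :=
  ∀ v : D.V, D.color v = Color.Z ∧ (D.legs (Sum.inl v)).card = 3

end ZXDiagram

/-! ## Generalised CNOT circuits -/

/-- A circuit without inputs and with `m` live qubits, given by its last operation and the circuit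
before it.  Preparing an ancilla appends a new last qubit, measuring a qubit discards it (so that
the later qubits move down by one), and a Pauli correction is executed if and only if its condition
holds for the list of the outcomes (`true` for `1`) of all earlier measurements in chronological
order; no correction is executed when these outcomes are all `0`. -/
inductive Circ : ℕ → Type where
  | empty : Circ 0
  | prepZero {m : ℕ} (c : Circ m) : Circ (m + 1)
  | prepPlus {m : ℕ} (c : Circ m) : Circ (m + 1)
  | cnot {m : ℕ} (c : Circ m) (control target : Fin m) (hne : control ≠ target) : Circ m
  | measZ {m : ℕ} (c : Circ (m + 1)) (q : Fin (m + 1)) : Circ m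
  | measX {m : ℕ} (c : Circ (m + 1)) (q : Fin (m + 1)) : Circ m
  | corrX {m : ℕ} (c : Circ m) (q : Fin m) (cond : List Bool → Bool)
      (hcond : ∀ r, cond (List.replicate r false) = false) : Circ m
  | corrZ {m : ℕ} (c : Circ m) (q : Fin m) (cond : List Bool → Bool)
      (hcond : ∀ r, cond (List.replicate r false) = false) : Circ m

namespace Circ

/-- The number of measurements. -/
def numMeas : {m : ℕ} → Circ m → ℕ
  | _, empty => 0
  | _, prepZero c => c.numMeas
  | _, prepPlus c => c.numMeas
  | _, cnot c _ _ _ => c.numMeas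
  | _, measZ c _ => c.numMeas + 1
  | _, measX c _ => c.numMeas + 1
  | _, corrX c _ _ _ => c.numMeas
  | _, corrZ c _ _ _ => c.numMeas

/-- The number of CNOT gates. -/
def cnotCount : {m : ℕ} → Circ m → ℕ
  | _, empty => 0
  | _, prepZero c => c.cnotCount
  | _, prepPlus c => c.cnotCount
  | _, cnot c _ _ _ => c.cnotCount + 1
  | _, measZ c _ => c.cnotCount
  | _, measX c _ => c.cnotCount
  | _, corrX c _ _ _ => c.cnotCount
  | _, corrZ c _ _ _ => c.cnotCount

/-- The outcomes of all measurements of the circuit, when `o r` is the outcome of the `r`-th one. -/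
def outcomes {m : ℕ} (c : Circ m) (o : ℕ → Bool) : List Bool := (List.range c.numMeas).map o

/-- A measurement outcome as a bit. -/
def bit (b : Bool) : ZMod 2 := if b then 1 else 0

/-- The (unnormalised) state of the live qubits in the branch in which the `r`-th measurement has
the outcome `o r`, the Pauli corrections included. -/
noncomputable def state (o : ℕ → Bool) : {m : ℕ} → Circ m → (Fin m → ZMod 2) → ℂ
  | _, empty => fun _ => 1
  | _, prepZero c => fun b => if b (Fin.last _) = 0 then c.state o (Fin.init b) else 0
  | _, prepPlus c => fun b => ((Real.sqrt 2 : ℝ) : ℂ)⁻¹ * c.state o (Fin.init b)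
  | _, cnot c i j _ => fun b => c.state o (Function.update b j (b j + b i))
  | _, measZ c q => fun b => c.state o (q.insertNth (α := fun _ => ZMod 2) (bit (o c.numMeas)) b)
  | _, measX c q => fun b => ((Real.sqrt 2 : ℝ) : ℂ)⁻¹ *
      ∑ s : ZMod 2, sgn (bit (o c.numMeas) * s) *
        c.state o (q.insertNth (α := fun _ => ZMod 2) s b)
  | _, corrX c q cond _ => fun b =>
      if cond (c.outcomes o) then c.state o (Function.update b q (b q + 1)) else c.state o b
  | _, corrZ c q cond _ => fun b =>
      if cond (c.outcomes o) then sgn (b q) * c.state o b else c.state o b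

/-- Attach a new 1-ary spider of the given colour by an edge to a new last output. -/
def diagramPrep {m : ℕ} (col : Color) (D : ZXDiagram m) : ZXDiagram (m + 1) where
  V := Option D.V
  E := Option D.E
  color v := v.elim col D.color
  endpt e s := match e with
    | some e => (D.endpt e s).map some Fin.castSucc
    | none => if s then Sum.inr (Fin.last m) else Sum.inl none
  output_degree_one i := by
    induction i using Fin.lastCases with
    | last =>
      refine ⟨(none, true), by simp, ?_⟩
      rintro ⟨_ | e, s⟩ h
      · cases s <;> simp_all
      · rcases hD : D.endpt e s with v | q
        · simp [hD] at h
        · simp only [hD, Sum.map_inr, Sum.inr.injEq] at h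
          exact absurd h (Fin.castSucc_lt_last q).ne
    | cast i =>
      obtain ⟨⟨e, s⟩, h, hu⟩ := D.output_degree_one i
      refine ⟨(some e, s), by simp_all, ?_⟩
      rintro ⟨_ | e', s'⟩ h'
      · cases s' <;> simp at h'
        exact absurd h'.symm (Fin.castSucc_lt_last i).ne
      · rcases hD : D.endpt e' s' with v | q
        · simp [hD] at h'
        · simp only [hD, Sum.map_inr, Sum.inr.injEq] at h'
          have := hu (e', s') (by simpa [hD] using Fin.castSucc_injective _ h')
          simp_all

/-- Let the wires of the outputs `i` and `j` end in a new `Z`-spider `false` and a new `X`-spider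
`true` respectively; join these two spiders by an edge, and attach new output wires. -/
def diagramCNOT {m : ℕ} (i j : Fin m) (hne : i ≠ j) (D : ZXDiagram m) : ZXDiagram m where
  V := D.V ⊕ Bool
  E := D.E ⊕ Fin 3
  color v := match v with
    | Sum.inl v => D.color v
    | Sum.inr false => Color.Z
    | Sum.inr true => Color.X
  endpt e s := match e with
    | Sum.inl e => match D.endpt e s with
      | Sum.inl v => Sum.inl (Sum.inl v)
      | Sum.inr q =>
        if q = i then Sum.inl (Sum.inr false)
        else if q = j then Sum.inl (Sum.inr true)
        else Sum.inr q
    | Sum.inr 0 => Sum.inl (Sum.inr s)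
    | Sum.inr 1 => if s then Sum.inr i else Sum.inl (Sum.inr false)
    | Sum.inr 2 => if s then Sum.inr j else Sum.inl (Sum.inr true)
  output_degree_one q := by
    by_cases hi : q = i
    · subst hi
      refine ⟨(Sum.inr 1, true), by simp, ?_⟩
      rintro ⟨e | e, s⟩ h
      · rcases hD : D.endpt e s with v | q'
        · simp [hD] at h
        · simp only [hD] at h
          split_ifs at h <;> simp_all
      · fin_cases e <;> cases s <;> simp_all
    · by_cases hj : q = j
      · subst hj
        refine ⟨(Sum.inr 2, true), by simp, ?_⟩
        rintro ⟨e | e, s⟩ h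
        · rcases hD : D.endpt e s with v | q'
          · simp [hD] at h
          · simp only [hD] at h
            split_ifs at h <;> simp_all
        · fin_cases e <;> cases s <;> simp_all
      · obtain ⟨⟨e, s⟩, h, hu⟩ := D.output_degree_one q
        refine ⟨(Sum.inl e, s), by simp_all, ?_⟩
        rintro ⟨e' | e', s'⟩ h'
        · rcases hD : D.endpt e' s' with v | q'
          · simp [hD] at h'
          · simp only [hD] at h'
            have := hu (e', s')
            split_ifs at h' <;> simp_all
        · fin_cases e' <;> cases s' <;> simp_all

/-- Let the wire of the output `q` end in a new 1-ary spider of the given colour. -/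
def diagramMeas {m : ℕ} (col : Color) (q : Fin (m + 1)) (D : ZXDiagram (m + 1)) :
    ZXDiagram m where
  V := Option D.V
  E := D.E
  color v := v.elim col D.color
  endpt e s := match D.endpt e s with
    | Sum.inl v => Sum.inl (some v)
    | Sum.inr r => match finSuccEquiv' q r with
      | none => Sum.inl none
      | some r' => Sum.inr r'
  output_degree_one i := by
    obtain ⟨⟨e, s⟩, h, hu⟩ := D.output_degree_one (q.succAbove i)
    refine ⟨(e, s), by simp_all, ?_⟩
    rintro ⟨e', s'⟩ h'
    apply hu
    rcases hD : D.endpt e' s' with v | r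
    · simp [hD] at h'
    · rcases hr : finSuccEquiv' q r with _ | r'
      · simp [hD, hr] at h'
      · simp only [hD, hr, Sum.inr.injEq] at h'
        subst h'
        have := (Equiv.symm_apply_eq (finSuccEquiv' q)).2 hr.symm
        simp_all

/-- The associated diagram of the circuit: the branch in which all measurement outcomes are `0`.
The states `|0⟩` and `|+⟩` and the effects `⟨0|` and `⟨+|` are 1-ary `X`-, `Z`-, `X`- and
`Z`-spiders; a CNOT is a 3-ary `Z`-spider on the control joined to a 3-ary `X`-spider on the
target. -/
def diagram : {m : ℕ} → Circ m → ZXDiagram m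
  | _, empty =>
    { V := Empty
      E := Empty
      color := fun v => v.elim
      endpt := fun e _ => e.elim
      output_degree_one := fun i => i.elim0 }
  | _, prepZero c => diagramPrep Color.X c.diagram
  | _, prepPlus c => diagramPrep Color.Z c.diagram
  | _, cnot c i j hne => diagramCNOT i j hne c.diagram
  | _, measZ c q => diagramMeas Color.X q c.diagram
  | _, measX c q => diagramMeas Color.Z q c.diagram
  | _, corrX c _ _ _ => c.diagram
  | _, corrZ c _ _ _ => c.diagram

end Circ

/-- A generalised CNOT circuit that prepares an `n`-qubit state. -/
structure GenCNOTCircuit (n : ℕ) where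
  circ : Circ n
  /-- The post-selection criterion: the list of outcomes that are not thrown away. -/
  allowed : Set (List Bool)
  zero_allowed : List.replicate circ.numMeas false ∈ allowed
  /-- All allowed outcomes lead to the same state up to a scalar (the scalar is zero for outcomes
  that are never observed). -/
  deterministic : ∀ o : ℕ → Bool, circ.outcomes o ∈ allowed →
    ∃ a : ℂ, circ.state o = a • circ.state (fun _ => false)

/-- The circuit `t`-fault-tolerantly prepares the CAT state: its associated diagram does. -/
def GenCNOTCircuit.FTPreparesCAT {n : ℕ} (C : GenCNOTCircuit n) (t : ℕ) : Prop :=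
  C.circ.diagram.FTPreparesCAT t

/-! ## Algorithms and their running time -/

/-- Binary trees, the data that algorithms work on. -/
inductive Data where
  | nil : Data
  | node (l r : Data) : Data

namespace Data

/-- The number of nodes and leaves. -/
def size : Data → ℕ
  | nil => 1
  | node l r => l.size + r.size + 1

/-- The left subtree (`nil` for `nil`). -/
def left : Data → Data
  | nil => nil
  | node l _ => l

/-- The right subtree (`nil` for `nil`). -/
def right : Data → Data
  | nil => nil
  | node _ r => r

/-- Natural numbers in unary. -/
def ofNat : ℕ → Data
  | 0 => nil
  | k + 1 => node nil (ofNat k)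

/-- Lists. -/
def ofList : List Data → Data
  | [] => nil
  | d :: l => node d (ofList l)

end Data

/-- Programs of a Turing-complete while-language that transform a tree into a tree. -/
inductive Prog where
  | skip : Prog
  | nil : Prog
  | left : Prog
  | right : Prog
  | pair (p q : Prog) : Prog
  | seq (p q : Prog) : Prog
  | cond (c p q : Prog) : Prog
  | loop (c p : Prog) : Prog

/-- `p.Runs x y T`: the program `p` terminates on the input `x` with the output `y` in time `T`.
Every elementary step is charged the size of the tree that it reads (and may have to copy).  The
tree `nil` means false in a test, every other tree means true. -/
inductive Prog.Runs : Prog → Data → Data → ℕ → Prop where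
  | skip (x : Data) : Runs Prog.skip x x x.size
  | nil (x : Data) : Runs Prog.nil x Data.nil x.size
  | left (x : Data) : Runs Prog.left x x.left x.size
  | right (x : Data) : Runs Prog.right x x.right x.size
  | pair {p q : Prog} {x y z : Data} {S T : ℕ} (hp : Runs p x y S) (hq : Runs q x z T) :
      Runs (Prog.pair p q) x (Data.node y z) (S + T + x.size)
  | seq {p q : Prog} {x y z : Data} {S T : ℕ} (hp : Runs p x y S) (hq : Runs q y z T) :
      Runs (Prog.seq p q) x z (S + T)
  | condTrue {c p q : Prog} {x l r y : Data} {S T : ℕ} (hc : Runs c x (Data.node l r) S)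
      (hp : Runs p x y T) : Runs (Prog.cond c p q) x y (S + T + x.size)
  | condFalse {c p q : Prog} {x y : Data} {S T : ℕ} (hc : Runs c x Data.nil S)
      (hq : Runs q x y T) : Runs (Prog.cond c p q) x y (S + T + x.size)
  | loopStop {c p : Prog} {x : Data} {S : ℕ} (hc : Runs c x Data.nil S) :
      Runs (Prog.loop c p) x x (S + x.size)
  | loopStep {c p : Prog} {x l r y z : Data} {S T U : ℕ} (hc : Runs c x (Data.node l r) S)
      (hp : Runs p x y T) (hl : Runs (Prog.loop c p) y z U) :
      Runs (Prog.loop c p) x z (S + T + U + x.size)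

/-- The code of an operation with the given operation code, acting on the given qubits. -/
def opCode (op : ℕ) (qubits : List ℕ) : Data :=
  Data.node (Data.ofNat op) (Data.ofList (qubits.map Data.ofNat))

/-- The code of a circuit: the list of its operations, the last one first, with the qubits that
they act on.  The conditions of the corrections are not made available to the algorithm. -/
def Circ.code : {m : ℕ} → Circ m → Data
  | _, .empty => Data.nil
  | _, .prepZero c => Data.node (opCode 0 []) c.code
  | _, .prepPlus c => Data.node (opCode 1 []) c.code
  | _, .cnot c i j _ => Data.node (opCode 2 [i, j]) c.code
  | _, .measZ c q => Data.node (opCode 3 [q]) c.code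
  | _, .measX c q => Data.node (opCode 4 [q]) c.code
  | _, .corrX c q _ _ => Data.node (opCode 5 [q]) c.code
  | _, .corrZ c q _ _ => Data.node (opCode 6 [q]) c.code

/-- The code of a colour. -/
def Color.code : Color → Data
  | Color.Z => Data.ofNat 0
  | Color.X => Data.ofNat 1

/-- The code of a ZX-diagram with respect to a numbering of its spiders and of its edges: the list
of the colours of the spiders, and the list of the edges, each given by its two ends. -/
def ZXDiagram.code {n : ℕ} (D : ZXDiagram n) {v e : ℕ} (spiders : Fin v ≃ D.V)
    (edges : Fin e ≃ D.E) : Data :=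
  let endCode : D.V ⊕ Fin n → Data := fun w => match w with
    | Sum.inl a => Data.node (Data.ofNat 0) (Data.ofNat (spiders.symm a))
    | Sum.inr i => Data.node (Data.ofNat 1) (Data.ofNat i)
  Data.node (Data.ofList (List.ofFn fun a => (D.color (spiders a)).code))
    (Data.ofList (List.ofFn fun k =>
      Data.node (endCode (D.endpt (edges k) false)) (endCode (D.endpt (edges k) true))))

end CatPrep

/-!
Call bits on the half-edges of a phase-free diagram *valid* if they are constant on the legs of
every `Z`-spider and of even parity on the legs of every `X`-spider. An amplitude of the diagram
with a fault is a sum over the valid bits that differ at the two ends of exactly those edges whose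
Pauli contains an `X`; each summand is positive up to a sign that stems from the `Z`-parts. For the
CAT state, only the `X`-parts matter: `D.FTPreparesCAT t` says that without flips `1…1` occurs at
the outputs, and that `w ≤ t` bit flips on edges only lead to bit strings at distance at most `w`
from a constant one (`CatFlips`). The `Z`-part of a fault amounts to a sign between two
complementary bit strings, which a single `Z` at an output produces as well, merged with an `X`
there if need be (`exists_cat_fault`).

Fix valid bits `s` on the wires of the circuit, without flips and with all outputs equal to `1`.
Keep only the wires of value `1` that do not end in a measurement. At the `Z`-spider of a CNOT gate,
there remain at most three legs, at its `X`-spider at most two, since the parity is even, and at a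
preparation at most one. The remaining wires form a multigraph `G` in which only controls can have
degree three. Given bits `y` at the vertices of `G`, the product of `y` and `s` is allowed by all
spiders, and the two ends of a wire differ only if the wire has value `1` and `y` changes along it
(`Circ.Trace.reach`). So every cut of `G` is the effect of a fault of at most the same weight on the
circuit (`Good.reach`), and turning the vertices of `G` into `Z`-spiders preserves fault tolerance.

A vertex of degree at most two is superfluous: it lies on a path, whose two ends become adjacent, or
can be dropped (`Good.elim`). When no such vertex is left, all vertices are controls of degree
three. The control of the first CNOT gate has been eliminated, since one of its wires comes straight
from a preparation (`Circ.Trace.first_control`), so that at most `k - 1` vertices remain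
(`Good.length_lt`).

The bits `s` are found by a symbolic run: the bits on the wires are linear forms over `ZMod 2` in
one variable per ancilla in `|+⟩`, and a `Z`-measurement is the elimination of one variable
(`exists_symSpec`). The form of the first output is not zero, and setting its first variable to `1`
and all others to `0` yields `s`, as all outputs of a CAT state are equal (`good_graphEdges`).
Programs for all this are obtained from a calculus of polynomial-time functions (`PolyFun`) that is
closed under composition, case distinction and those folds over lists whose states have polynomial
size (`PolyFun.foldl_of_size`).
-/

namespace CatPrep

/-! ### Amplitudes of phase-free diagrams -/

theorem zmod2_cases (a : ZMod 2) : a = 0 ∨ a = 1 := by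
  fin_cases a
  · exact Or.inl rfl
  · exact Or.inr rfl

theorem sgn_add (a b : ZMod 2) : sgn (a + b) = sgn a * sgn b := by
  rcases zmod2_cases a with rfl | rfl <;> rcases zmod2_cases b with rfl | rfl <;>
    simp [sgn, show (1 : ZMod 2) + 1 = 0 from rfl]

theorem sgn_ne_zero (a : ZMod 2) : sgn a ≠ 0 := by
  unfold sgn; split_ifs <;> norm_num

theorem sgn_zero : sgn 0 = 1 := by simp [sgn]

theorem sgn_sum {ι : Type*} (s : Finset ι) (f : ι → ZMod 2) :
    sgn (∑ i ∈ s, f i) = ∏ i ∈ s, sgn (f i) := by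
  classical
  induction s using Finset.induction_on with
  | empty => simp [sgn]
  | insert a s ha ih => rw [Finset.sum_insert ha, Finset.prod_insert ha, sgn_add, ih]

/-- The bit patterns on the legs at which a spider has a non-zero coefficient: constant ones for a
`Z`-spider, those of even parity for an `X`-spider. -/
def SpiderOK {L : Type} (legs : Finset L) (x : L → ZMod 2) : Color → Prop
  | Color.Z => ∀ h ∈ legs, ∀ h' ∈ legs, x h = x h'
  | Color.X => ∑ h ∈ legs, x h = 0

/-- Spider coefficients are non-negative reals, positive exactly on the patterns `SpiderOK`. -/
theorem spiderCoeff_spec {L : Type} (legs : Finset L) (x : L → ZMod 2) (col : Color) :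
    ∃ r : ℝ, 0 ≤ r ∧ spiderCoeff legs x col = (r : ℂ) ∧ (0 < r ↔ SpiderOK legs x col) := by
  classical
  cases col with
  | Z =>
    refine ⟨(∏ l ∈ legs, if x l = 0 then 1 else 0) + ∏ l ∈ legs, if x l = 1 then 1 else 0,
      by positivity, by simp [spiderCoeff, apply_ite ((↑) : ℝ → ℂ)], ?_⟩
    rw [Finset.prod_ite_zero, Finset.prod_ite_zero]
    simp only [Finset.prod_const_one]
    by_cases h0 : ∀ i ∈ legs, x i = 0
    · refine ⟨fun _ => ?_, fun _ => ?_⟩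
      · intro h hh h' hh'; rw [h0 h hh, h0 h' hh']
      · rw [if_pos h0]; split_ifs <;> norm_num
    · by_cases h1 : ∀ i ∈ legs, x i = 1
      · refine ⟨fun _ => ?_, fun _ => ?_⟩
        · intro h hh h' hh'; rw [h1 h hh, h1 h' hh']
        · rw [if_neg h0, if_pos h1]; norm_num
      · rw [if_neg h0, if_neg h1]
        refine ⟨fun h => by norm_num at h, fun h => ?_⟩
        exfalso
        push Not at h0 h1
        obtain ⟨i, hi, hi0⟩ := h0
        obtain ⟨j, hj, hj1⟩ := h1
        have := h i hi j hj
        rcases zmod2_cases (x i) with h | h <;> rcases zmod2_cases (x j) with h' | h' <;> simp_all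
  | X =>
    have hs : (0 : ℝ) < (Real.sqrt 2)⁻¹ := by positivity
    refine ⟨(∏ _l ∈ legs, (Real.sqrt 2)⁻¹) * (if ∑ h ∈ legs, x h = 0 then 2 else 0),
      by positivity, ?_, ?_⟩
    · simp only [spiderCoeff]
      rw [Finset.prod_mul_distrib, ← sgn_sum]
      rcases zmod2_cases (∑ h ∈ legs, x h) with h | h <;> simp [h, sgn] <;> ring
    · have hp : (0 : ℝ) < ∏ _l ∈ legs, (Real.sqrt 2)⁻¹ := Finset.prod_pos fun _ _ => hs
      simp only [SpiderOK]
      split_ifs with h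
      · simp [h]
      · simp [h]

theorem SpiderOK.add {L : Type} {legs : Finset L} {x y : L → ZMod 2} {col : Color}
    (hx : SpiderOK legs x col) (hy : SpiderOK legs y col) : SpiderOK legs (x + y) col := by
  cases col with
  | Z => intro h hh h' hh'; simp [hx h hh h' hh', hy h hh h' hh']
  | X =>
    simp only [SpiderOK, Pi.add_apply, Finset.sum_add_distrib] at *
    rw [hx, hy, add_zero]

theorem SpiderOK.smul {L : Type} {legs : Finset L} {x : L → ZMod 2} {col : Color} (c : ZMod 2)
    (hx : SpiderOK legs x col) : SpiderOK legs (c • x) col := by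
  cases col with
  | Z => intro h hh h' hh'; simp [hx h hh h' hh']
  | X =>
    simp only [SpiderOK, Pi.smul_apply] at *
    rw [← Finset.smul_sum, hx, smul_zero]

/-- Spider coefficients are invariant under shifts by an allowed bit pattern. -/
theorem spiderCoeff_add {L : Type} (legs : Finset L) (x y : L → ZMod 2) (col : Color)
    (hy : SpiderOK legs y col) : spiderCoeff legs (x + y) col = spiderCoeff legs x col := by
  classical
  cases col with
  | Z =>
    rcases legs.eq_empty_or_nonempty with rfl | ⟨l0, hl0⟩
    · simp [spiderCoeff]
    · have hc : ∀ h ∈ legs, y h = y l0 := fun h hh => hy h hh l0 hl0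
      simp only [spiderCoeff, Pi.add_apply]
      rcases zmod2_cases (y l0) with h0 | h0
      · congr 1 <;> refine Finset.prod_congr rfl fun l hl => ?_ <;> simp [hc l hl, h0]
      · rw [add_comm]
        congr 1 <;> refine Finset.prod_congr rfl fun l hl => ?_ <;>
          rcases zmod2_cases (x l) with h | h <;>
          simp [h, hc l hl, h0, show (1 : ZMod 2) + 1 = 0 from rfl]
  | X =>
    simp only [spiderCoeff, Finset.prod_mul_distrib, ← sgn_sum, Pi.add_apply, sgn_add]
    rw [show ∑ h ∈ legs, y h = 0 from hy, sgn_zero, mul_one]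

theorem Pauli.entry_add (P : Pauli) (i j d : ZMod 2) :
    P.entry (i + d) (j + d) = sgn (P.2 * d) * P.entry i j := by
  unfold Pauli.entry
  have : i + d = j + d + P.1 ↔ i = j + P.1 := by
    rw [add_right_comm j d]; exact add_left_inj d
  simp only [this, mul_add, sgn_add]
  split_ifs <;> ring

namespace ZXDiagram

variable {n : ℕ}

theorem mem_legs (D : ZXDiagram n) (w : D.V ⊕ Fin n) (h : D.E × Bool) :
    h ∈ D.legs w ↔ D.endpt h.1 h.2 = w := by
  classical
  simp [legs]

/-- The bits `x` on the half-edges are allowed by all spiders and equal `b` at the outputs. -/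
def Valid (D : ZXDiagram n) (x : D.E × Bool → ZMod 2) (b : Fin n → ZMod 2) : Prop :=
  (∀ v : D.V, SpiderOK (D.legs (Sum.inl v)) x (D.color v)) ∧
    ∀ i : Fin n, ∀ h ∈ D.legs (Sum.inr i), x h = b i

/-- The number of edges whose two ends carry different bits. -/
def mism (D : ZXDiagram n) (x : D.E × Bool → ZMod 2) : ℕ :=
  ∑ e : D.E, if x (e, true) = x (e, false) then 0 else 1

/-- Some fault that consists of at most `w` Paulis `X` lets the basis state `b` occur at the
outputs. -/
def Reach (D : ZXDiagram n) (w : ℕ) (b : Fin n → ZMod 2) : Prop :=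
  ∃ x, D.Valid x b ∧ D.mism x ≤ w

theorem Reach.mono {D : ZXDiagram n} {w w' : ℕ} {b : Fin n → ZMod 2} (h : D.Reach w b)
    (hw : w ≤ w') : D.Reach w' b :=
  let ⟨x, hx, hm⟩ := h
  ⟨x, hx, hm.trans hw⟩

theorem mism_eq_zero_iff (D : ZXDiagram n) (x : D.E × Bool → ZMod 2) :
    D.mism x = 0 ↔ ∀ e, x (e, true) = x (e, false) := by
  simp [mism]

theorem Valid.add {D : ZXDiagram n} {x y : D.E × Bool → ZMod 2} {b c : Fin n → ZMod 2}
    (hx : D.Valid x b) (hy : D.Valid y c) : D.Valid (x + y) (b + c) :=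
  ⟨fun v => SpiderOK.add (hx.1 v) (hy.1 v), fun i h hh => by simp [hx.2 i h hh, hy.2 i h hh]⟩

theorem Valid.smul {D : ZXDiagram n} {x : D.E × Bool → ZMod 2} {b : Fin n → ZMod 2}
    (hx : D.Valid x b) (c : ZMod 2) : D.Valid (c • x) (c • b) :=
  ⟨fun v => SpiderOK.smul c (hx.1 v), fun i h hh => by simp [hx.2 i h hh]⟩

/-- The bits `x` on the half-edges are compatible with the `X`-part of the fault `F`. -/
def Compat (D : ZXDiagram n) (F : D.Fault) (x : D.E × Bool → ZMod 2) : Prop :=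
  ∀ e, x (e, true) = x (e, false) + (F e).1

/-- The exponent of the sign with which `x` contributes to the state of the diagram with
fault `F`. -/
def phase (D : ZXDiagram n) (F : D.Fault) (x : D.E × Bool → ZMod 2) : ZMod 2 :=
  ∑ e, (F e).2 * x (e, false)

/-- The contribution of the bits `x` on the half-edges to an amplitude. -/
noncomputable def term (D : ZXDiagram n) (F : D.Fault) (b : Fin n → ZMod 2)
    (x : D.E × Bool → ZMod 2) : ℂ :=
  (∏ e : D.E, (F e).entry (x (e, true)) (x (e, false))) *
    (∏ v : D.V, spiderCoeff (D.legs (Sum.inl v)) x (D.color v)) *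
    ∏ i : Fin n, ∏ h ∈ D.legs (Sum.inr i), if x h = b i then 1 else 0

theorem faultyState_eq (D : ZXDiagram n) (F : D.Fault) (b : Fin n → ZMod 2) :
    ∃ _ : Fintype (D.E × Bool → ZMod 2), D.faultyState F b = ∑ x, D.term F b x := by
  classical
  exact ⟨_, rfl⟩

theorem term_spec (D : ZXDiagram n) (F : D.Fault) (b : Fin n → ZMod 2)
    (x : D.E × Bool → ZMod 2) :
    ∃ r : ℝ, 0 ≤ r ∧ D.term F b x = sgn (D.phase F x) * (r : ℂ) ∧
      (0 < r ↔ D.Valid x b ∧ D.Compat F x) := by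
  classical
  choose r hr0 hr hrp using fun v : D.V =>
    spiderCoeff_spec (D.legs (Sum.inl v)) x (D.color v)
  refine ⟨(if ∀ e, x (e, true) = x (e, false) + (F e).1 then 1 else 0) * (∏ v, r v) *
    (if ∀ i, ∀ h ∈ D.legs (Sum.inr i), x h = b i then 1 else 0), ?_, ?_, ?_⟩
  · have : 0 ≤ ∏ v, r v := Finset.prod_nonneg fun v _ => hr0 v
    positivity
  · have h1 : (∏ e : D.E, (F e).entry (x (e, true)) (x (e, false))) = sgn (D.phase F x) *
        (if ∀ e, x (e, true) = x (e, false) + (F e).1 then 1 else 0) := by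
      have : ∀ e, (F e).entry (x (e, true)) (x (e, false)) =
          sgn ((F e).2 * x (e, false)) *
            (if x (e, true) = x (e, false) + (F e).1 then 1 else 0) := by
        intro e; unfold Pauli.entry; split_ifs <;> simp
      simp only [this, Finset.prod_mul_distrib, phase, sgn_sum]
      rw [Finset.prod_ite_zero]
      simp
    have h2 : (∏ i : Fin n, ∏ h ∈ D.legs (Sum.inr i), if x h = b i then (1 : ℂ) else 0) =
        if ∀ i, ∀ h ∈ D.legs (Sum.inr i), x h = b i then 1 else 0 := by
      simp only [Finset.prod_ite_zero, Finset.prod_const_one, Finset.mem_univ, true_imp_iff]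
    rw [term, h1, h2]
    simp only [hr]
    push_cast
    split_ifs <;> simp
  · by_cases h1 : ∀ e, x (e, true) = x (e, false) + (F e).1
    · by_cases h2 : ∀ i, ∀ h ∈ D.legs (Sum.inr i), x h = b i
      · rw [if_pos h1, if_pos h2, one_mul, mul_one]
        constructor
        · intro hp
          refine ⟨⟨fun v => (hrp v).1 ?_, h2⟩, h1⟩
          refine lt_of_le_of_ne (hr0 v) fun h0 => hp.ne' ?_
          exact Finset.prod_eq_zero (Finset.mem_univ v) h0.symm
        · rintro ⟨⟨hv, -⟩, -⟩
          exact Finset.prod_pos fun v _ => (hrp v).2 (hv v)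
      · rw [if_neg h2, mul_zero]
        exact ⟨fun h => absurd h (lt_irrefl _), fun h => absurd h.1.2 h2⟩
    · rw [if_neg h1, zero_mul, zero_mul]
      exact ⟨fun h => absurd h (lt_irrefl _), fun h => absurd h.2 h1⟩

theorem exists_of_faultyState_ne_zero {D : ZXDiagram n} {F : D.Fault} {b : Fin n → ZMod 2}
    (h : D.faultyState F b ≠ 0) : ∃ x, D.Valid x b ∧ D.Compat F x := by
  obtain ⟨_, hs⟩ := D.faultyState_eq F b
  rw [hs] at h
  obtain ⟨x, -, hx⟩ := Finset.exists_ne_zero_of_sum_ne_zero h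
  obtain ⟨r, hr0, hr, hrp⟩ := D.term_spec F b x
  refine ⟨x, hrp.1 (lt_of_le_of_ne hr0 ?_)⟩
  rintro rfl
  simp [hr] at hx

/-- There is no cancellation if all contributions have the same sign. -/
theorem faultyState_ne_zero {D : ZXDiagram n} {F : D.Fault} {b : Fin n → ZMod 2}
    {x₀ : D.E × Bool → ZMod 2} (h0 : D.Valid x₀ b) (h0' : D.Compat F x₀)
    (hph : ∀ x, D.Valid x b → D.Compat F x → D.phase F x = D.phase F x₀) :
    D.faultyState F b ≠ 0 := by
  obtain ⟨_, hs⟩ := D.faultyState_eq F b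
  choose r hr0 hr hrp using D.term_spec F b
  have : D.faultyState F b = sgn (D.phase F x₀) * ((∑ x, r x : ℝ) : ℂ) := by
    rw [hs]
    push_cast
    rw [Finset.mul_sum]
    refine Finset.sum_congr rfl fun x _ => ?_
    rcases (hr0 x).eq_or_lt with h | h
    · simp [hr, ← h]
    · have := (hrp x).1 h
      rw [hr, hph x this.1 this.2]
  rw [this]
  refine mul_ne_zero (sgn_ne_zero _) ?_
  have : 0 < ∑ x, r x :=
    Finset.sum_pos' (fun x _ => hr0 x) ⟨x₀, Finset.mem_univ _, (hrp x₀).2 ⟨h0, h0'⟩⟩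
  exact_mod_cast this.ne'

/-- A mismatch-free allowed pattern `y` is a symmetry of the state with any fault, up to sign. -/
theorem faultyState_add {D : ZXDiagram n} (F : D.Fault) {y : D.E × Bool → ZMod 2}
    {c : Fin n → ZMod 2} (hy : D.Valid y c) (hy0 : ∀ e, y (e, true) = y (e, false))
    (b : Fin n → ZMod 2) :
    D.faultyState F (b + c) = sgn (D.phase F y) * D.faultyState F b := by
  classical
  obtain ⟨i1, hs⟩ := D.faultyState_eq F (b + c)
  obtain ⟨i2, hs'⟩ := D.faultyState_eq F b
  obtain rfl : i1 = i2 := Subsingleton.elim _ _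
  rw [hs, hs', Finset.mul_sum, ← Equiv.sum_comp (Equiv.addRight y)]
  refine Finset.sum_congr rfl fun x _ => ?_
  change D.term F (b + c) (x + y) = _
  simp only [term]
  have h1 : (∏ e : D.E, (F e).entry ((x + y) (e, true)) ((x + y) (e, false))) =
      sgn (D.phase F y) * ∏ e : D.E, (F e).entry (x (e, true)) (x (e, false)) := by
    rw [phase, sgn_sum, ← Finset.prod_mul_distrib]
    refine Finset.prod_congr rfl fun e _ => ?_
    rw [Pi.add_apply, Pi.add_apply, hy0, Pauli.entry_add]
  have h2 : (∏ v : D.V, spiderCoeff (D.legs (Sum.inl v)) (x + y) (D.color v)) =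
      ∏ v : D.V, spiderCoeff (D.legs (Sum.inl v)) x (D.color v) :=
    Finset.prod_congr rfl fun v _ => spiderCoeff_add _ _ _ _ (hy.1 v)
  have h3 : (∏ i : Fin n, ∏ h ∈ D.legs (Sum.inr i),
        if (x + y) h = (b + c) i then (1 : ℂ) else 0) =
      ∏ i : Fin n, ∏ h ∈ D.legs (Sum.inr i), if x h = b i then 1 else 0 := by
    refine Finset.prod_congr rfl fun i _ => Finset.prod_congr rfl fun h hh => ?_
    rw [Pi.add_apply, Pi.add_apply, hy.2 i h hh]
    simp only [add_left_inj]
  rw [h1, h2, h3]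
  ring

end ZXDiagram

/-! ### Fault-tolerant preparation of the CAT state as a condition on bit flips -/

theorem eqUpToScalar_of_support {n : ℕ} {φ ψ : (Fin n → ZMod 2) → ℂ} {b : Fin n → ZMod 2} {ε : ℂ}
    (hφ : φ b ≠ 0) (hψ : ψ b ≠ 0) (hφ1 : φ (b + 1) = ε * φ b) (hψ1 : ψ (b + 1) = ε * ψ b)
    (hφs : ∀ b', φ b' ≠ 0 → b' = b ∨ b' = b + 1) (hψs : ∀ b', ψ b' ≠ 0 → b' = b ∨ b' = b + 1) :
    EqUpToScalar φ ψ := by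
  refine ⟨φ b / ψ b, div_ne_zero hφ hψ, ?_⟩
  funext b'
  rw [Pi.smul_apply, smul_eq_mul]
  by_cases h0 : b' = b
  · subst h0; field_simp
  · by_cases h1 : b' = b + 1
    · subst h1; rw [hφ1, hψ1]; field_simp
    · have := not_imp_comm.1 (hφs b') (by tauto)
      have := not_imp_comm.1 (hψs b') (by tauto)
      simp [*]

theorem pi_zmod2_add_self {n : ℕ} (b : Fin n → ZMod 2) : b + b = 0 := by
  funext i; exact CharTwo.add_self_eq_zero _

namespace ZXDiagram

variable {n : ℕ}

/-- The number of positions at which `b` is different from the constant bit string `c`. -/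
def distConst (b : Fin n → ZMod 2) (c : ZMod 2) : ℕ :=
  (Finset.univ.filter fun i => b i ≠ c).card

theorem distConst_eq_zero {b : Fin n → ZMod 2} {c : ZMod 2} :
    distConst b c = 0 ↔ b = fun _ => c := by
  simp [distConst, Finset.filter_eq_empty_iff, funext_iff]

/-- Flips of at most `w ≤ t` bits on the edges lead to a bit string with at most `w` positions
different from a constant one; without flips, `1…1` occurs. -/
def CatFlips (D : ZXDiagram n) (t : ℕ) : Prop :=
  D.Reach 0 1 ∧ ∀ w ≤ t, ∀ b, D.Reach w b → ∃ c, distConst b c ≤ w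

theorem CatFlips.const {D : ZXDiagram n} {t : ℕ} (h : D.CatFlips t) {b : Fin n → ZMod 2}
    (hb : D.Reach 0 b) : ∃ c, b = fun _ => c := by
  obtain ⟨c, hc⟩ := h.2 0 (Nat.zero_le _) b hb
  exact ⟨c, distConst_eq_zero.1 (Nat.le_zero.1 hc)⟩

theorem mism_le_weight {D : ZXDiagram n} {F : D.Fault} {x : D.E × Bool → ZMod 2}
    (h : D.Compat F x) : D.mism x ≤ D.weight F := by
  classical
  rw [mism, weight, Finset.card_filter]
  refine Finset.sum_le_sum fun e _ => ?_
  by_cases hF : F e = 0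
  · have := h e; simp_all
  · split_ifs <;> simp_all

theorem faultyState_support {D : ZXDiagram n} {t : ℕ} (hD : D.CatFlips t) {F : D.Fault}
    {b b' : Fin n → ZMod 2} (hb : D.faultyState F b ≠ 0) (hb' : D.faultyState F b' ≠ 0) :
    b' = b ∨ b' = b + 1 := by
  obtain ⟨x, hx, hxc⟩ := exists_of_faultyState_ne_zero hb
  obtain ⟨x', hx', hxc'⟩ := exists_of_faultyState_ne_zero hb'
  have h : D.Reach 0 (b' + b) := by
    refine ⟨x' + x, hx'.add hx, ((D.mism_eq_zero_iff _).2 fun e => ?_).le⟩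
    rw [Pi.add_apply, Pi.add_apply, hxc e, hxc' e,
      add_add_add_comm, CharTwo.add_self_eq_zero, add_zero]
  obtain ⟨c, hc⟩ := hD.const h
  have : b' = b + fun _ => c := by
    rw [← hc, add_comm b' b, ← add_assoc, pi_zmod2_add_self, zero_add]
  rcases zmod2_cases c with rfl | rfl
  · left; rw [this]; exact add_zero b
  · exact Or.inr this

/-! The faults of the CAT diagram are families of Paulis indexed by `Fin n`. -/

/-- The CAT state with the Pauli `F i` applied to the qubit `i`. -/
noncomputable def catState (F : Fin n → Pauli) : (Fin n → ZMod 2) → ℂ := (cat n).faultyState F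

/-- The number of non-identity Paulis in `F`. -/
def catWeight (F : Fin n → Pauli) : ℕ := ∑ i, if F i = 0 then 0 else 1

theorem cat_weight (F : Fin n → Pauli) : (cat n).weight F = catWeight F := by
  classical
  simp only [weight, Finset.card_filter]
  refine Finset.sum_congr rfl fun i _ => ?_
  by_cases h : F i = 0
  · rw [if_pos h]; exact if_neg (not_not.2 h)
  · rw [if_neg h]; exact if_pos h

theorem cat_valid_iff (x : Fin n × Bool → ZMod 2) (b : Fin n → ZMod 2) :
    (cat n).Valid x b ↔
      (∀ i j : Fin n, x (i, false) = x (j, false)) ∧ ∀ i : Fin n, x (i, true) = b i := by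
  constructor
  · rintro ⟨h1, h2⟩
    refine ⟨fun i j => h1 () (i, false) ?_ (j, false) ?_, fun i => h2 i (i, true) ?_⟩ <;>
      rw [mem_legs] <;> simp [cat]
  · rintro ⟨h1, h2⟩
    refine ⟨fun v => ?_, fun i => ?_⟩
    · rintro ⟨e, s⟩ h ⟨e', s'⟩ h'
      rw [mem_legs] at h h'
      cases s <;> cases s' <;> simp [cat] at h h'
      exact h1 e e'
    · rintro ⟨e, s⟩ h
      rw [mem_legs] at h
      cases s <;> simp [cat] at h
      obtain rfl : e = i := Sum.inr.inj h
      exact h2 e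

theorem cat_catFlips (hn : 0 < n) : (cat n).CatFlips 0 := by
  constructor
  · exact ⟨fun _ => 1, (cat_valid_iff _ _).2 ⟨fun _ _ => rfl, fun _ => rfl⟩,
      by simp [mism]⟩
  · rintro w hw b ⟨x, hx, hm⟩
    obtain rfl := Nat.le_zero.1 hw
    have hm := (mism_eq_zero_iff _ _).1 (Nat.le_zero.1 hm)
    replace hx := (cat_valid_iff _ _).1 hx
    refine ⟨x ((⟨0, hn⟩ : Fin n), false), (distConst_eq_zero.2 ?_).le⟩
    funext i
    exact (hx.2 i).symm.trans ((hm i).trans (hx.1 _ _))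

theorem catState_ne_zero (F : Fin n → Pauli) {b : Fin n → ZMod 2} {c : ZMod 2}
    (h : ∀ i, b i = c + (F i).1) : catState F b ≠ 0 := by
  refine faultyState_ne_zero (D := cat n) (x₀ := fun e => if e.2 then b e.1 else c)
    ((cat_valid_iff _ _).2 ⟨fun _ _ => rfl, fun _ => rfl⟩) (fun e => by simpa using h e) ?_
  intro x hx hxc
  replace hx := (cat_valid_iff _ _).1 hx
  refine Finset.sum_congr rfl fun e _ => ?_
  have h1 := ((h e).symm.trans (hx.2 e).symm).trans (hxc e)
  simp [add_right_cancel h1]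

theorem catState_add_one (F : Fin n → Pauli) (b : Fin n → ZMod 2) :
    catState F (b + 1) = sgn (∑ i, (F i).2) * catState F b := by
  have h := faultyState_add (D := cat n) F (y := fun _ => 1) (c := 1)
    ((cat_valid_iff _ _).2 ⟨fun _ _ => rfl, fun _ => rfl⟩) (fun _ => rfl) b
  simp only [phase, mul_one] at h
  exact h

theorem catState_support (hn : 0 < n) {F : Fin n → Pauli} {b b' : Fin n → ZMod 2}
    (hb : catState F b ≠ 0) (hb' : catState F b' ≠ 0) : b' = b ∨ b' = b + 1 :=
  faultyState_support (cat_catFlips hn) hb hb'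

theorem distConst_le_of_catState {F : Fin n → Pauli} {b : Fin n → ZMod 2}
    (h : catState F b ≠ 0) :
    ∃ c, (∀ i, b i = c + (F i).1) ∧ distConst b c ≤ catWeight F := by
  classical
  obtain ⟨x, hx, hxc⟩ := exists_of_faultyState_ne_zero h
  replace hx := (cat_valid_iff _ _).1 hx
  have key : ∃ c, ∀ i, b i = c + (F i).1 := by
    rcases Nat.eq_zero_or_pos n with rfl | hn
    · exact ⟨0, fun i => i.elim0⟩
    · exact ⟨x ((⟨0, hn⟩ : Fin n), false), fun i => by
        refine (hx.2 i).symm.trans ((hxc i).trans ?_)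
        exact congrArg (· + (F i).1) (hx.1 _ _)⟩
  obtain ⟨c, hc⟩ := key
  refine ⟨c, hc, ?_⟩
  rw [distConst, catWeight, Finset.card_filter]
  refine Finset.sum_le_sum fun i _ => ?_
  by_cases h0 : F i = 0
  · simp [hc i, h0]
  · rw [if_neg h0]; split_ifs <;> simp

/-- Bit flips cannot be undetectable by cancellation, so that the CAT state of a fault-tolerant
preparation pins down the reachable bit strings. -/
theorem FTPreparesCAT.catFlips {D : ZXDiagram n} {t : ℕ} (h : D.FTPreparesCAT t) :
    D.CatFlips t := by
  classical
  obtain ⟨h1, h2⟩ := h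
  constructor
  · have hs : catState (0 : Fin n → Pauli) 1 ≠ 0 :=
      catState_ne_zero (c := 1) 0 (by intro i; rfl)
    have hw : (cat n).weight 0 = 0 := by simp [weight]
    obtain ⟨F, hF, a, ha, hE⟩ := h2 0 (fun h => hs (congrFun h 1)) (by omega)
    rw [hw] at hF
    have : D.faultyState F 1 ≠ 0 := by
      intro h0
      apply hs
      refine (congrFun hE 1).trans ?_
      rw [Pi.smul_apply, h0, smul_zero]
    obtain ⟨x, hx, hxc⟩ := exists_of_faultyState_ne_zero this
    exact ⟨x, hx, (mism_le_weight hxc).trans hF⟩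
  · rintro w hw b ⟨x, hx, hm⟩
    set F : D.Fault := fun e => (x (e, true) + x (e, false), 0) with hFdef
    have hc : D.Compat F x := by
      intro e
      rw [hFdef, add_left_comm, CharTwo.add_self_eq_zero, add_zero]
    have hwF : D.weight F ≤ D.mism x := by
      rw [mism, weight, Finset.card_filter]
      refine Finset.sum_le_sum fun e _ => ?_
      by_cases he : x (e, true) = x (e, false)
      · simp [hFdef, he, CharTwo.add_self_eq_zero]
      · split_ifs <;> simp
    have hs : D.faultyState F b ≠ 0 :=
      faultyState_ne_zero hx hc fun y _ _ => by simp [phase, hFdef]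
    obtain ⟨F₂, hF₂, a, ha, hE⟩ := h1 F (fun h => hs (by rw [h]; rfl)) (by omega)
    have : catState F₂ b ≠ 0 := by
      intro h0
      apply hs
      rw [hE, Pi.smul_apply, show (cat n).faultyState F₂ b = 0 from h0, smul_zero]
    obtain ⟨c, -, hc⟩ := distConst_le_of_catState this
    have hF₂ := (cat_weight F₂).symm.trans_le hF₂
    exact ⟨c, by omega⟩

/-- A family of Paulis on the outputs as a fault on the output edges of `D`; on a bare wire the
Paulis of its two ends are multiplied. -/
def outFault (D : ZXDiagram n) (F : Fin n → Pauli) : D.Fault := fun e =>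
  ∑ s : Bool, Sum.elim (fun _ => 0) F (D.endpt e s)

theorem sum_outputs {M : Type*} [AddCommMonoid M] (D : ZXDiagram n) (F : Fin n → M) :
    ∑ e : D.E, ∑ s : Bool, Sum.elim (fun _ => 0) F (D.endpt e s) = ∑ i, F i := by
  classical
  rw [← Fintype.sum_prod_type' (f := fun e s => Sum.elim (fun _ => 0) F (D.endpt e s))]
  have : ∀ h : D.E × Bool, Sum.elim (fun _ => 0) F (D.endpt h.1 h.2) =
      ∑ i, if D.endpt h.1 h.2 = Sum.inr i then F i else 0 := by
    intro h
    rcases D.endpt h.1 h.2 with v | i <;> simp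
  simp only [this]
  rw [Finset.sum_comm]
  refine Finset.sum_congr rfl fun i _ => ?_
  obtain ⟨h0, hh0, hu⟩ := D.output_degree_one i
  rw [Finset.sum_eq_single h0]
  · rw [if_pos hh0]
  · intro h _ hne
    exact if_neg fun hh => hne (hu h hh)
  · simp

theorem weight_outFault_le (D : ZXDiagram n) (F : Fin n → Pauli) :
    D.weight (D.outFault F) ≤ catWeight F := by
  classical
  have hc : ∀ w : D.V ⊕ Fin n, (if Sum.elim (fun _ => 0) F w = 0 then 0 else 1) =
      Sum.elim (fun _ => 0) (fun i => if F i = 0 then 0 else 1) w := by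
    rintro (v | i)
    · simp
    · by_cases h : F i = 0 <;> simp [h]
  rw [catWeight, ← D.sum_outputs, weight, Finset.card_filter]
  refine Finset.sum_le_sum fun e _ => ?_
  simp only [← hc]
  split_ifs with h
  · by_contra hlt
    have hall : ∀ s, Sum.elim (fun _ => 0) F (D.endpt e s) = 0 := by
      simpa [and_comm] using hlt
    exact h (by simp [outFault, hall])
  · exact Nat.zero_le _

/-- Bits `b` at a distance at most `w` from a constant, and a sign `σ` that needs `w ≠ 0`, are the
effect of at most `w` Paulis on the CAT state. -/
theorem exists_cat_fault (hn : 0 < n) {b : Fin n → ZMod 2} {c : ZMod 2} {w : ℕ}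
    (hc : distConst b c ≤ w) (σ : ZMod 2) (hσ : w = 0 → σ = 0) :
    ∃ F : Fin n → Pauli, (∀ i, (F i).1 = b i + c) ∧ ∑ i, (F i).2 = σ ∧ catWeight F ≤ w := by
  classical
  rcases zmod2_cases σ with h0 | h1
  · refine ⟨fun i => (b i + c, 0), fun _ => rfl, by simp [h0], ?_⟩
    refine le_trans ?_ hc
    rw [catWeight, distConst, Finset.card_filter]
    refine Finset.sum_le_sum fun i _ => ?_
    by_cases hi : b i = c <;> simp [hi, CharTwo.add_self_eq_zero]
    split_ifs <;> simp
  · have hw : 1 ≤ w := by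
      by_contra h
      have := hσ (by omega)
      rw [h1] at this
      exact one_ne_zero this
    -- the single `Z` is put on a qubit that carries an `X` already, if there is one
    have hi0 : ∃ i0 : Fin n, (∀ i, b i = c) ∨ b i0 ≠ c := by
      by_cases hbc : ∀ i, b i = c
      · exact ⟨⟨0, hn⟩, Or.inl hbc⟩
      · push Not at hbc
        exact hbc.imp fun _ => Or.inr
    obtain ⟨i0, hi0⟩ := hi0
    refine ⟨fun i => (b i + c, if i = i0 then 1 else 0), fun _ => rfl, by simp [h1], ?_⟩
    rcases hi0 with hall | hi0
    · refine le_trans (le_of_eq ?_) hw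
      simp [catWeight, hall, CharTwo.add_self_eq_zero, Prod.ext_iff]
    · refine le_trans ?_ hc
      rw [catWeight, distConst, Finset.card_filter]
      refine Finset.sum_le_sum fun i _ => ?_
      by_cases hi : b i = c
      · have : i ≠ i0 := by rintro rfl; exact hi0 hi
        simp [hi, this, CharTwo.add_self_eq_zero]
      · rw [if_pos hi]; split_ifs <;> simp

/-- The flips of a fault on `D` leave a bit string near a constant one, and its `Z`-part only
matters by its sign on the valid bits `y` that lead from `b` to `b + 1`. -/
theorem CatFlips.matched_cat {D : ZXDiagram n} {t : ℕ} (hn : 0 < n) (h : D.CatFlips t) :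
    FaultsMatched (t + 1) D (cat n) := by
  classical
  obtain ⟨y, hy, hy0⟩ := h.1
  have hy0 := (mism_eq_zero_iff _ _).1 (Nat.le_zero.1 hy0)
  intro F hF hw
  obtain ⟨b, hb⟩ := Function.ne_iff.1 hF
  obtain ⟨x, hx, hxc⟩ := exists_of_faultyState_ne_zero hb
  obtain ⟨c, hc⟩ := h.2 (D.weight F) (by omega) b ⟨x, hx, mism_le_weight hxc⟩
  obtain ⟨F₂, hX, hZ, hwt⟩ := exists_cat_fault hn hc (D.phase F y) (fun h0 => by
    rw [weight, Finset.card_eq_zero, Finset.filter_eq_empty_iff] at h0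
    refine Finset.sum_eq_zero fun e he => ?_
    simp [not_not.1 (h0 he)])
  have hb2 : catState F₂ b ≠ 0 := by
    refine catState_ne_zero (c := c) F₂ fun i => ?_
    rw [hX, add_left_comm, CharTwo.add_self_eq_zero, add_zero]
  refine ⟨F₂, (cat_weight F₂).trans_le hwt, ?_⟩
  exact eqUpToScalar_of_support (ψ := catState F₂) hb hb2 (faultyState_add F hy hy0 b)
    (by rw [catState_add_one, hZ]) (fun b' hb' => faultyState_support h hb hb')
    (fun b' hb' => catState_support hn hb2 hb')

/-- A fault on the outputs of `cat n` is pushed to the edges of `D` at the outputs. -/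
theorem CatFlips.cat_matched {D : ZXDiagram n} {t : ℕ} (hn : 0 < n) (h : D.CatFlips t) :
    FaultsMatched (t + 1) (cat n) D := by
  classical
  obtain ⟨y, hy, hy0⟩ := h.1
  have hy0 := (mism_eq_zero_iff _ _).1 (Nat.le_zero.1 hy0)
  intro F' hF hw
  -- the edges of `cat n` are its outputs, so that a fault on it is a Pauli for every output
  obtain ⟨F, rfl⟩ : ∃ F : Fin n → Pauli, F = F' := ⟨F', rfl⟩
  obtain ⟨b, hb⟩ := Function.ne_iff.1 hF
  replace hb : catState F b ≠ 0 := hb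
  obtain ⟨c, hc, -⟩ := distConst_le_of_catState hb
  have hfst : ∀ w : D.V ⊕ Fin n, (Sum.elim (fun _ => (0 : Pauli)) F w).1 =
      Sum.elim (fun _ => 0) (fun i => (F i).1) w := by rintro (v | i) <;> simp
  have hsnd : ∀ w : D.V ⊕ Fin n, (Sum.elim (fun _ => (0 : Pauli)) F w).2 =
      Sum.elim (fun _ => 0) (fun i => (F i).2) w := by rintro (v | i) <;> simp
  set x : D.E × Bool → ZMod 2 := fun h =>
    c * y h + Sum.elim (fun _ => 0) (fun i => (F i).1) (D.endpt h.1 h.2) with hxdef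
  -- the bits of `c…c`, with those at the outputs flipped
  have hx : D.Valid x b := by
    have hcv := hy.smul c
    refine ⟨fun v => ?_, fun i l hl => ?_⟩
    · have hl : ∀ l ∈ D.legs (Sum.inl v), x l = (c • y) l := by
        intro l hl
        rw [mem_legs] at hl
        simp [hxdef, hl]
      have := hcv.1 v
      cases hcol : D.color v with
      | Z =>
        rw [hcol] at this
        intro l hl1 l' hl2
        rw [hl l hl1, hl l' hl2]
        exact this l hl1 l' hl2
      | X =>
        rw [hcol] at this
        exact (Finset.sum_congr rfl hl).trans this
    · have := hy.2 i l hl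
      rw [mem_legs] at hl
      simp [hxdef, hl, this, hc]
  have hxc : D.Compat (D.outFault F) x := by
    intro e
    simp only [hxdef, outFault, Fintype.sum_bool, Prod.fst_add, hfst, hy0]
    have := CharTwo.add_self_eq_zero
      (Sum.elim (fun _ => 0) (fun i => (F i).1) (D.endpt e false) : ZMod 2)
    linear_combination -this
  -- a wire that carries a fault ends in an output, so its bits are determined by `b`
  have hout : ∀ e, (D.outFault F e).2 ≠ 0 → ∃ s i, D.endpt e s = Sum.inr i := by
    intro e he
    by_contra hno
    push Not at hno
    apply he
    have : ∀ s, Sum.elim (fun _ => (0 : Pauli)) F (D.endpt e s) = 0 := by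
      intro s
      rcases hs : D.endpt e s with v | i
      · simp
      · exact absurd hs (hno s i)
    simp [outFault, this]
  have hb2 : D.faultyState (D.outFault F) b ≠ 0 := by
    refine faultyState_ne_zero hx hxc fun x' hx' hxc' => ?_
    refine Finset.sum_congr rfl fun e _ => ?_
    by_cases he : (D.outFault F e).2 = 0
    · rw [he, zero_mul, zero_mul]
    · obtain ⟨s, i, hs⟩ := hout e he
      have h1 := hx.2 i (e, s) ((D.mem_legs _ _).2 hs)
      have h2 := hx'.2 i (e, s) ((D.mem_legs _ _).2 hs)
      have h3 := hxc e
      have h4 := hxc' e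
      congr 1
      cases s
      · rw [h1, h2]
      · rw [h1] at h3; rw [h2] at h4
        exact add_right_cancel (h4.symm.trans h3)
  have hphase : D.phase (D.outFault F) y = ∑ i, (F i).2 := by
    rw [← D.sum_outputs, phase]
    refine Finset.sum_congr rfl fun e _ => ?_
    have e2 : (D.outFault F e).2 =
        ∑ s : Bool, Sum.elim (fun _ => 0) (fun i => (F i).2) (D.endpt e s) := by
      simp only [outFault, Prod.snd_sum, hsnd]
    rw [← e2]
    by_cases he : (D.outFault F e).2 = 0
    · rw [he, zero_mul]
    · obtain ⟨s, i, hs⟩ := hout e he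
      have h1 := hy.2 i (e, s) ((D.mem_legs _ _).2 hs)
      have : y (e, false) = 1 := by
        cases s
        · exact h1
        · rw [← hy0]; exact h1
      rw [this, mul_one]
  refine ⟨D.outFault F, (D.weight_outFault_le F).trans_eq (cat_weight F).symm, ?_⟩
  exact eqUpToScalar_of_support (φ := catState F) hb hb2 (catState_add_one F b)
    (by rw [faultyState_add _ hy hy0, hphase]) (fun b' hb' => catState_support hn hb hb')
    (fun b' hb' => faultyState_support h hb2 hb')

/-- The converse of `FTPreparesCAT.catFlips`: since the CAT state is stabilised by `X…X`, a
`Z`-type fault changes at most one relative sign, which a single `Z` does as well. -/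
theorem CatFlips.ftPreparesCAT {D : ZXDiagram n} {t : ℕ} (hn : 0 < n) (h : D.CatFlips t) :
    D.FTPreparesCAT t :=
  ⟨h.matched_cat hn, h.cat_matched hn⟩

end ZXDiagram

/-! ### Reachable bit strings of the diagram of a circuit -/

theorem SpiderOK.congr {L : Type} {legs : Finset L} {x y : L → ZMod 2} {col : Color}
    (hx : SpiderOK legs x col) (h : ∀ l ∈ legs, y l = x l) : SpiderOK legs y col := by
  cases col with
  | Z => intro l hl l' hl'; rw [h l hl, h l' hl']; exact hx l hl l' hl'
  | X => exact (Finset.sum_congr rfl h).trans hx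

theorem spiderOK_map {L L' : Type} (f : L ↪ L') (legs : Finset L) (x : L' → ZMod 2) (col : Color) :
    SpiderOK (legs.map f) x col ↔ SpiderOK legs (fun l => x (f l)) col := by
  cases col with
  | Z => simp [SpiderOK]
  | X => simp [SpiderOK]

theorem spiderOK_singleton {L : Type} (l : L) (x : L → ZMod 2) (col : Color) :
    SpiderOK {l} x col ↔ (col = Color.X → x l = 0) := by
  cases col with
  | Z => simp [SpiderOK]
  | X => simp [SpiderOK]

theorem spiderOK_triple_Z {L : Type} {legs : Finset L} {a b c : L}
    (hl : ∀ l, l ∈ legs ↔ l = a ∨ l = b ∨ l = c) (x : L → ZMod 2) :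
    SpiderOK legs x Color.Z ↔ x a = x b ∧ x b = x c := by
  simp only [SpiderOK, hl]
  constructor
  · intro h
    exact ⟨h a (by simp) b (by simp), h b (by simp) c (by simp)⟩
  · rintro ⟨h1, h2⟩ l (rfl | rfl | rfl) l' (rfl | rfl | rfl) <;> simp [h1, h2]

theorem spiderOK_triple_X {L : Type} {legs : Finset L} {a b c : L}
    (hl : ∀ l, l ∈ legs ↔ l = a ∨ l = b ∨ l = c) (hab : a ≠ b) (hac : a ≠ c)
    (hbc : b ≠ c) (x : L → ZMod 2) :
    SpiderOK legs x Color.X ↔ x a + (x b + x c) = 0 := by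
  classical
  obtain rfl : legs = {a, b, c} := by ext l; simp [hl]
  simp [SpiderOK, hab, hac, hbc]

namespace ZXDiagram

variable {n : ℕ}

/-- Resetting one output bit costs at most one flip. -/
theorem Reach.update {D : ZXDiagram n} {w : ℕ} {b : Fin n → ZMod 2} (h : D.Reach w b) (i : Fin n)
    (z : ZMod 2) : D.Reach (w + if z = b i then 0 else 1) (Function.update b i z) := by
  classical
  split_ifs with hz
  · rw [hz, Function.update_eq_self]; exact h
  obtain ⟨x, hx, hm⟩ := h
  obtain ⟨h0, hh0, hu⟩ := D.output_degree_one i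
  refine ⟨Function.update x h0 z, ⟨fun v => (hx.1 v).congr fun l hl => ?_, fun r l hl => ?_⟩, ?_⟩
  · rw [mem_legs] at hl
    have : l ≠ h0 := by rintro rfl; rw [hh0] at hl; cases hl
    rw [Function.update_of_ne this]
  · by_cases hr : r = i
    · subst hr
      rw [mem_legs] at hl
      rw [hu l hl, Function.update_self, Function.update_self]
    · have hl' := hl
      rw [mem_legs] at hl'
      have : l ≠ h0 := by
        rintro rfl; rw [hh0] at hl'; exact hr (Sum.inr.inj hl').symm
      rw [Function.update_of_ne this, Function.update_of_ne hr]
      exact hx.2 r l hl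
  · refine le_trans ?_ (Nat.add_le_add_right hm 1)
    have : (1 : ℕ) = ∑ e : D.E, if e = h0.1 then 1 else 0 := by simp
    rw [this, mism, mism, ← Finset.sum_add_distrib]
    refine Finset.sum_le_sum fun e _ => ?_
    by_cases he : e = h0.1
    · rw [if_pos he]; split_ifs <;> omega
    · have hne : ∀ s, (e, s) ≠ h0 := fun s hs => he (by rw [← hs])
      rw [Function.update_of_ne (hne _), Function.update_of_ne (hne _)]
      omega

theorem reach_zero_iff {D : ZXDiagram n} {b : Fin n → ZMod 2} :
    D.Reach 0 b ↔ ∃ x, D.Valid x b ∧ ∀ e, x (e, true) = x (e, false) := by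
  simp only [Reach, Nat.le_zero, mism_eq_zero_iff]

end ZXDiagram

namespace Circ

open ZXDiagram

variable {m : ℕ}

/-- The half-edges of `D` as half-edges of `diagramPrep col D`. -/
def prepEmb (E : Type) : E × Bool ↪ Option E × Bool where
  toFun h := (some h.1, h.2)
  inj' := by rintro ⟨a, s⟩ ⟨b, t⟩ h; simpa using h

theorem legs_prep_inl_some (col : Color) (D : ZXDiagram m) (v : D.V) :
    (diagramPrep col D).legs (Sum.inl (some v)) = (D.legs (Sum.inl v)).map (prepEmb D.E) := by
  refine Finset.ext fun ⟨e, s⟩ => (mem_legs _ _ _).trans (Iff.trans ?_ Finset.mem_map.symm)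
  constructor
  · intro h
    rcases e with _ | e
    · cases s <;> simp [diagramPrep] at h
    · refine ⟨(e, s), ?_, rfl⟩
      rw [mem_legs]
      simp only [diagramPrep] at h
      rcases hD : D.endpt e s with v' | q
      · simpa [hD] using h
      · simp [hD] at h
  · rintro ⟨⟨e', s'⟩, h, heq⟩
    obtain ⟨rfl, rfl⟩ : some e' = e ∧ s' = s := Prod.mk.inj heq
    rw [mem_legs] at h
    simp [diagramPrep, show D.endpt e' s' = _ from h]

theorem legs_prep_inl_none (col : Color) (D : ZXDiagram m) :
    (diagramPrep col D).legs (Sum.inl none) = {((none : Option D.E), false)} := by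
  refine Finset.ext fun ⟨e, s⟩ => (mem_legs _ _ _).trans (Iff.trans ?_ Finset.mem_singleton.symm)
  rcases e with _ | e
  · cases s <;> simp [diagramPrep]
  · rcases hD : D.endpt e s with v' | q <;> simp [diagramPrep, hD]

theorem endpt_prep_some (col : Color) (D : ZXDiagram m) (e : D.E) (s : Bool) (r : Fin m) :
    (diagramPrep col D).endpt (some e) s = Sum.inr r.castSucc ↔ D.endpt e s = Sum.inr r := by
  rcases hD : D.endpt e s with v' | q <;> simp [diagramPrep, hD]

theorem mism_prep (col : Color) (D : ZXDiagram m) (x : Option D.E × Bool → ZMod 2) :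
    (diagramPrep col D).mism x = (if x (none, true) = x (none, false) then 0 else 1) +
      D.mism fun h => x (some h.1, h.2) :=
  Fintype.sum_option _

theorem reach_prep {col : Color} {D : ZXDiagram m} {w : ℕ} {b : Fin m → ZMod 2}
    (h : D.Reach w b) (z : ZMod 2) (hz : col = Color.X → z = 0) :
    (diagramPrep col D).Reach w (Fin.snoc (α := fun _ => ZMod 2) b z) := by
  obtain ⟨x, hx, hm⟩ := h
  refine ⟨fun l => match l.1 with
    | some e => x (e, l.2)
    | none => z, ⟨?_, ?_⟩, ?_⟩
  · rintro (_ | v)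
    · rw [legs_prep_inl_none]
      exact (spiderOK_singleton _ _ _).2 hz
    · rw [legs_prep_inl_some]
      exact (spiderOK_map _ _ _ _).2 (hx.1 v)
  · intro i l hl
    obtain ⟨e, s⟩ := l
    rw [mem_legs] at hl
    induction i using Fin.lastCases with
    | last =>
      rw [Fin.snoc_last]
      rcases e with _ | e
      · rfl
      · rcases hD : D.endpt e s with v' | q
        · simp [diagramPrep, hD] at hl
        · simp only [diagramPrep, hD, Sum.map_inr, Sum.inr.injEq] at hl
          exact absurd hl (Fin.castSucc_lt_last q).ne
    | cast i =>
      rw [Fin.snoc_castSucc]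
      rcases e with _ | e
      · cases s <;> simp [diagramPrep] at hl
        exact absurd hl.symm (Fin.castSucc_lt_last i).ne
      · exact hx.2 i (e, s) ((mem_legs _ _ _).2 ((endpt_prep_some _ _ _ _ _).1 hl))
  · refine (mism_prep _ _ _).trans_le ?_
    simpa using hm

theorem reach_of_prep {col : Color} {D : ZXDiagram m} {b : Fin (m + 1) → ZMod 2}
    (h : (diagramPrep col D).Reach 0 b) :
    D.Reach 0 (Fin.init b) ∧ (col = Color.X → b (Fin.last m) = 0) := by
  rw [reach_zero_iff] at h
  obtain ⟨x, hx, hm⟩ := h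
  constructor
  · rw [reach_zero_iff]
    refine ⟨fun l => x (some l.1, l.2), ⟨fun v => ?_, fun i l hl => ?_⟩, fun e => hm (some e)⟩
    · have := hx.1 (some v)
      rw [legs_prep_inl_some] at this
      exact (spiderOK_map _ _ _ _).1 this
    · rw [mem_legs] at hl
      exact hx.2 i.castSucc (some l.1, l.2)
        ((mem_legs _ _ _).2 ((endpt_prep_some _ _ _ _ _).2 hl))
  · intro hcol
    have h1 := hx.1 none
    rw [legs_prep_inl_none] at h1
    have h2 := (spiderOK_singleton _ _ _).1 h1 hcol
    have h3 := hx.2 (Fin.last m) (none, true) ((mem_legs _ _ _).2 (by simp [diagramPrep]))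
    rw [← h3]
    exact (hm none).trans h2

/-! Measurements. -/

theorem endpt_meas_none (col : Color) (q : Fin (m + 1)) (D : ZXDiagram (m + 1)) (e : D.E)
    (s : Bool) :
    (diagramMeas col q D).endpt e s = Sum.inl none ↔ D.endpt e s = Sum.inr q := by
  rcases hD : D.endpt e s with v | r
  · simp [diagramMeas, hD]
  · rcases hr : finSuccEquiv' q r with _ | r'
    · have := (Equiv.symm_apply_eq (finSuccEquiv' q)).2 hr.symm
      simp only [finSuccEquiv'_symm_none] at this
      simp [diagramMeas, hD, this]
    · simp only [diagramMeas, hD, hr]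
      simp only [reduceCtorEq, Sum.inr.injEq, false_iff]
      rintro rfl
      simp at hr

theorem endpt_meas_some (col : Color) (q : Fin (m + 1)) (D : ZXDiagram (m + 1)) (e : D.E)
    (s : Bool) (v : D.V) :
    (diagramMeas col q D).endpt e s = Sum.inl (some v) ↔ D.endpt e s = Sum.inl v := by
  rcases hD : D.endpt e s with v' | r
  · simp [diagramMeas, hD]
  · rcases hr : finSuccEquiv' q r with _ | r' <;> simp [diagramMeas, hD, hr]

theorem endpt_meas_inr (col : Color) (q : Fin (m + 1)) (D : ZXDiagram (m + 1)) (e : D.E)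
    (s : Bool) (i : Fin m) :
    (diagramMeas col q D).endpt e s = Sum.inr i ↔ D.endpt e s = Sum.inr (q.succAbove i) := by
  rcases hD : D.endpt e s with v' | r
  · simp [diagramMeas, hD]
  · rcases hr : finSuccEquiv' q r with _ | r'
    · have := (Equiv.symm_apply_eq (finSuccEquiv' q)).2 hr.symm
      simp only [finSuccEquiv'_symm_none] at this
      subst this
      simp [diagramMeas, hD, Fin.ne_succAbove]
    · have := (Equiv.symm_apply_eq (finSuccEquiv' q)).2 hr.symm
      simp only [finSuccEquiv'_symm_some] at this
      subst this
      simp [diagramMeas, hD]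

theorem reach_meas_iff {col : Color} {q : Fin (m + 1)} {D : ZXDiagram (m + 1)} {w : ℕ}
    {b : Fin m → ZMod 2} :
    (diagramMeas col q D).Reach w b ↔
      ∃ z, (col = Color.X → z = 0) ∧ D.Reach w (q.insertNth (α := fun _ => ZMod 2) z b) := by
  obtain ⟨l0, hl0, hu⟩ := D.output_degree_one q
  have hnone : (diagramMeas col q D).legs (Sum.inl none) = {l0} := by
    refine Finset.ext fun l => (mem_legs _ _ _).trans
      (Iff.trans ((endpt_meas_none _ _ _ _ _).trans ⟨hu l, ?_⟩) Finset.mem_singleton.symm)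
    rintro rfl; exact hl0
  have hsome : ∀ v, (diagramMeas col q D).legs (Sum.inl (some v)) = D.legs (Sum.inl v) := by
    intro v
    exact Finset.ext fun l => (mem_legs _ _ _).trans
      ((endpt_meas_some _ _ _ _ _ _).trans (mem_legs _ _ _).symm)
  constructor
  · rintro ⟨x, hx, hm⟩
    refine ⟨x l0, ?_, x, ⟨fun v => ?_, fun i l hl => ?_⟩, hm⟩
    · have := hx.1 none
      rw [hnone] at this
      exact (spiderOK_singleton _ _ _).1 this
    · have := hx.1 (some v)
      rw [hsome] at this
      exact this
    · rw [mem_legs] at hl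
      induction i using q.succAboveCases with
      | x => rw [Fin.insertNth_apply_same, hu l hl]
      | p i =>
        rw [Fin.insertNth_apply_succAbove]
        exact hx.2 i l ((mem_legs _ _ _).2 ((endpt_meas_inr _ _ _ _ _ _).2 hl))
  · rintro ⟨z, hz, x, hx, hm⟩
    refine ⟨x, ⟨?_, fun i l hl => ?_⟩, hm⟩
    · rintro (_ | v)
      · rw [hnone]
        refine (spiderOK_singleton _ _ _).2 fun hcol => ?_
        have := hx.2 q l0 ((mem_legs _ _ _).2 hl0)
        rw [Fin.insertNth_apply_same, hz hcol] at this
        exact this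
      · rw [hsome]
        exact hx.1 v
    · rw [mem_legs] at hl
      have := hx.2 (q.succAbove i) l ((mem_legs _ _ _).2 ((endpt_meas_inr _ _ _ _ _ _).1 hl))
      rwa [Fin.insertNth_apply_succAbove] at this

/-! CNOT gates. -/

/-- The half-edges of `D` as half-edges of `diagramCNOT i j hne D`. -/
def cnotEmb (E : Type) : E × Bool ↪ (E ⊕ Fin 3) × Bool where
  toFun h := (Sum.inl h.1, h.2)
  inj' := by rintro ⟨a, s⟩ ⟨b, t⟩ h; simpa using h

theorem endpt_cnot_inl (i j : Fin m) (hne : i ≠ j) (D : ZXDiagram m) (e : D.E) (s : Bool)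
    (v : D.V) :
    (diagramCNOT i j hne D).endpt (Sum.inl e) s = Sum.inl (Sum.inl v) ↔
      D.endpt e s = Sum.inl v := by
  rcases hD : D.endpt e s with v' | r
  · simp [diagramCNOT, hD]
  · simp only [diagramCNOT, hD]
    split_ifs <;> simp

theorem endpt_cnot_control (i j : Fin m) (hne : i ≠ j) (D : ZXDiagram m) (e : D.E) (s : Bool) :
    (diagramCNOT i j hne D).endpt (Sum.inl e) s = Sum.inl (Sum.inr false) ↔
      D.endpt e s = Sum.inr i := by
  rcases hD : D.endpt e s with v' | r
  · simp [diagramCNOT, hD]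
  · simp only [diagramCNOT, hD]
    split_ifs <;> simp_all

theorem endpt_cnot_target (i j : Fin m) (hne : i ≠ j) (D : ZXDiagram m) (e : D.E) (s : Bool) :
    (diagramCNOT i j hne D).endpt (Sum.inl e) s = Sum.inl (Sum.inr true) ↔
      D.endpt e s = Sum.inr j := by
  rcases hD : D.endpt e s with v' | r
  · simp [diagramCNOT, hD]
  · simp only [diagramCNOT, hD]
    split_ifs <;> simp_all

theorem endpt_cnot_inr (i j : Fin m) (hne : i ≠ j) (D : ZXDiagram m) (e : D.E) (s : Bool)
    (r : Fin m) :
    (diagramCNOT i j hne D).endpt (Sum.inl e) s = Sum.inr r ↔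
      r ≠ i ∧ r ≠ j ∧ D.endpt e s = Sum.inr r := by
  rcases hD : D.endpt e s with v' | r
  · simp [diagramCNOT, hD]
  · simp only [diagramCNOT, hD]
    split_ifs <;> simp_all <;> grind

theorem legs_cnot_inl (i j : Fin m) (hne : i ≠ j) (D : ZXDiagram m) (v : D.V) :
    (diagramCNOT i j hne D).legs (Sum.inl (Sum.inl v)) =
      (D.legs (Sum.inl v)).map (cnotEmb D.E) := by
  refine Finset.ext fun ⟨e, s⟩ => (mem_legs _ _ _).trans (Iff.trans ?_ Finset.mem_map.symm)
  constructor
  · intro h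
    rcases e with e | c
    · exact ⟨(e, s), (mem_legs _ _ _).2 ((endpt_cnot_inl _ _ _ _ _ _ _).1 h), rfl⟩
    · fin_cases c <;> cases s <;> simp [diagramCNOT] at h
  · rintro ⟨⟨e', s'⟩, h, heq⟩
    obtain ⟨rfl, rfl⟩ : Sum.inl e' = e ∧ s' = s := Prod.mk.inj heq
    exact (endpt_cnot_inl _ _ _ _ _ _ _).2 ((mem_legs _ _ _).1 h)

theorem mism_cnot (i j : Fin m) (hne : i ≠ j) (D : ZXDiagram m)
    (x : (D.E ⊕ Fin 3) × Bool → ZMod 2) :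
    (diagramCNOT i j hne D).mism x = (D.mism fun h => x (Sum.inl h.1, h.2)) +
      ∑ c : Fin 3, if x (Sum.inr c, true) = x (Sum.inr c, false) then 0 else 1 :=
  Fintype.sum_sum_type _

theorem spiderOK_cnot_control (i j : Fin m) (hne : i ≠ j) (D : ZXDiagram m) {l₀ : D.E × Bool}
    (hl₀ : D.endpt l₀.1 l₀.2 = Sum.inr i)
    (hu : ∀ l : D.E × Bool, D.endpt l.1 l.2 = Sum.inr i → l = l₀)
    (x : (D.E ⊕ Fin 3) × Bool → ZMod 2) :
    SpiderOK (L := (D.E ⊕ Fin 3) × Bool)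
        ((diagramCNOT i j hne D).legs (Sum.inl (Sum.inr false))) x Color.Z ↔
      x (Sum.inl l₀.1, l₀.2) = x (Sum.inr 0, false) ∧
        x (Sum.inr 0, false) = x (Sum.inr 1, false) := by
  have hl : ∀ l : (D.E ⊕ Fin 3) × Bool,
      l ∈ (diagramCNOT i j hne D).legs (Sum.inl (Sum.inr false)) ↔
        l = (Sum.inl l₀.1, l₀.2) ∨ l = (Sum.inr 0, false) ∨ l = (Sum.inr 1, false) := by
    rintro ⟨e | c, s⟩
    · refine (mem_legs _ _ _).trans ((endpt_cnot_control _ _ _ _ _ _).trans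
        ⟨fun h => ?_, fun h => ?_⟩)
      · left; rw [← hu (e, s) h]
      · simp only [Prod.mk.injEq, Sum.inl.injEq, reduceCtorEq, false_and, or_false] at h
        rw [h.1, h.2]; exact hl₀
    · refine (mem_legs _ _ _).trans ?_
      fin_cases c <;> cases s <;> simp [diagramCNOT]
  exact spiderOK_triple_Z hl x

theorem spiderOK_cnot_target (i j : Fin m) (hne : i ≠ j) (D : ZXDiagram m) {l₀ : D.E × Bool}
    (hl₀ : D.endpt l₀.1 l₀.2 = Sum.inr j)
    (hu : ∀ l : D.E × Bool, D.endpt l.1 l.2 = Sum.inr j → l = l₀)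
    (x : (D.E ⊕ Fin 3) × Bool → ZMod 2) :
    SpiderOK (L := (D.E ⊕ Fin 3) × Bool)
        ((diagramCNOT i j hne D).legs (Sum.inl (Sum.inr true))) x Color.X ↔
      x (Sum.inl l₀.1, l₀.2) + (x (Sum.inr 0, true) + x (Sum.inr 2, false)) = 0 := by
  have hl : ∀ l : (D.E ⊕ Fin 3) × Bool,
      l ∈ (diagramCNOT i j hne D).legs (Sum.inl (Sum.inr true)) ↔
        l = (Sum.inl l₀.1, l₀.2) ∨ l = (Sum.inr 0, true) ∨ l = (Sum.inr 2, false) := by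
    rintro ⟨e | c, s⟩
    · refine (mem_legs _ _ _).trans ((endpt_cnot_target _ _ _ _ _ _).trans
        ⟨fun h => ?_, fun h => ?_⟩)
      · left; rw [← hu (e, s) h]
      · simp only [Prod.mk.injEq, Sum.inl.injEq, reduceCtorEq, false_and, or_false] at h
        rw [h.1, h.2]; exact hl₀
    · refine (mem_legs _ _ _).trans ?_
      fin_cases c <;> cases s <;> simp [diagramCNOT]
  exact spiderOK_triple_X hl (by simp) (by simp) (by simp) x

theorem reach_cnot {i j : Fin m} {hne : i ≠ j} {D : ZXDiagram m} {w : ℕ} {b : Fin m → ZMod 2}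
    (h : D.Reach w b) :
    (diagramCNOT i j hne D).Reach w (Function.update b j (b j + b i)) := by
  classical
  obtain ⟨x, hx, hm⟩ := h
  obtain ⟨li, hli, hui⟩ := D.output_degree_one i
  obtain ⟨lj, hlj, huj⟩ := D.output_degree_one j
  have hxi := hx.2 i li ((mem_legs _ _ _).2 hli)
  have hxj := hx.2 j lj ((mem_legs _ _ _).2 hlj)
  refine ⟨fun l => match l.1 with
    | Sum.inl e => x (e, l.2)
    | Sum.inr 0 => b i
    | Sum.inr 1 => b i
    | Sum.inr 2 => b j + b i, ⟨?_, ?_⟩, ?_⟩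
  · rintro (v | _ | _)
    · rw [legs_cnot_inl]
      exact (spiderOK_map _ _ _ _).2 (hx.1 v)
    · exact (spiderOK_cnot_control i j hne D hli hui _).2 ⟨hxi, rfl⟩
    · refine (spiderOK_cnot_target i j hne D hlj huj _).2 ?_
      change x lj + (b i + (b j + b i)) = 0
      rw [hxj, add_left_comm (b i), CharTwo.add_self_eq_zero, add_zero,
        CharTwo.add_self_eq_zero]
  · rintro r ⟨e | c, s⟩ hl
    · rw [mem_legs] at hl
      obtain ⟨-, hr, h⟩ := (endpt_cnot_inr _ _ _ _ _ _ _).1 hl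
      rw [Function.update_of_ne hr]
      exact hx.2 r (e, s) ((mem_legs _ _ _).2 h)
    · rw [mem_legs] at hl
      fin_cases c <;> cases s <;> simp [diagramCNOT] at hl <;> subst hl
      · simp [Function.update_of_ne hne]
      · simp
  · refine (mism_cnot _ _ _ _ _).trans_le ?_
    simpa [Fin.sum_univ_three] using hm

theorem reach_of_cnot {i j : Fin m} {hne : i ≠ j} {D : ZXDiagram m} {b : Fin m → ZMod 2}
    (h : (diagramCNOT i j hne D).Reach 0 b) :
    D.Reach 0 (Function.update b j (b j + b i)) := by
  classical
  obtain ⟨li, hli, hui⟩ := D.output_degree_one i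
  obtain ⟨lj, hlj, huj⟩ := D.output_degree_one j
  rw [reach_zero_iff] at h ⊢
  obtain ⟨(x : (D.E ⊕ Fin 3) × Bool → ZMod 2), hx, hm⟩ := h
  replace hm : ∀ e : D.E ⊕ Fin 3, x (e, true) = x (e, false) := hm
  have o1 : x (Sum.inr 1, false) = b i :=
    (hm (Sum.inr 1)).symm.trans (hx.2 i (Sum.inr 1, true) ((mem_legs _ _ _).2 rfl))
  have o2 : x (Sum.inr 2, false) = b j :=
    (hm (Sum.inr 2)).symm.trans (hx.2 j (Sum.inr 2, true) ((mem_legs _ _ _).2 rfl))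
  have c1 := (spiderOK_cnot_control i j hne D hli hui x).1 (hx.1 (Sum.inr false))
  have c2 := (spiderOK_cnot_target i j hne D hlj huj x).1 (hx.1 (Sum.inr true))
  have e1 : x (Sum.inl li.1, li.2) = b i := (c1.1.trans c1.2).trans o1
  have e2 : x (Sum.inr 0, true) = b i := (hm (Sum.inr 0)).trans (c1.2.trans o1)
  have e3 : x (Sum.inl lj.1, lj.2) = b j + b i := by
    rw [e2, o2] at c2
    rw [add_comm (b j)]
    exact CharTwo.add_eq_zero.1 c2
  refine ⟨fun l => x (Sum.inl l.1, l.2), ⟨fun v => ?_, fun r l hl => ?_⟩,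
    fun e => hm (Sum.inl e)⟩
  · have := hx.1 (Sum.inl v)
    rw [legs_cnot_inl] at this
    exact (spiderOK_map _ _ _ _).1 this
  · rw [mem_legs] at hl
    by_cases hj : r = j
    · subst hj
      rw [Function.update_self, huj l hl]; exact e3
    · rw [Function.update_of_ne hj]
      by_cases hi : r = i
      · subst hi
        rw [hui l hl]; exact e1
      · exact hx.2 r (Sum.inl l.1, l.2)
          ((mem_legs _ _ _).2 ((endpt_cnot_inr _ _ _ _ _ _ _).2 ⟨hi, hj, hl⟩))

end Circ

/-! ### The wires that carry the value one -/

/-- Names of vertices: `(0, l)` and `(2, l)` are the `Z`-spider and the `X`-spider of the `l`-th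
CNOT gate, `(3, r)` is the spider of the `r`-th preparation, and `(1, i)` is the output `i`. -/
abbrev Vtx := ℕ × ℕ

/-- The sum of `g a b` over the edges `(a, b)` of a multigraph. -/
def edgeSum (g : Vtx → Vtx → ℕ) (es : List (Vtx × Vtx)) : ℕ :=
  (es.map fun e => g e.1 e.2).sum

/-- The number of edges between vertices of different values. -/
def cutSize (y : Vtx → ZMod 2) : List (Vtx × Vtx) → ℕ :=
  edgeSum fun a b => if y a = y b then 0 else 1

/-- The degree of a vertex; a self-loop counts twice. -/
def deg (v : Vtx) : List (Vtx × Vtx) → ℕ :=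
  edgeSum fun a b => (if a = v then 1 else 0) + if b = v then 1 else 0

section edgeSum

variable (g : Vtx → Vtx → ℕ) (e : Vtx × Vtx) (es es' : List (Vtx × Vtx))

@[simp] theorem edgeSum_nil : edgeSum g [] = 0 := rfl

@[simp] theorem edgeSum_cons : edgeSum g (e :: es) = g e.1 e.2 + edgeSum g es := by
  simp [edgeSum]

@[simp] theorem edgeSum_append : edgeSum g (es ++ es') = edgeSum g es + edgeSum g es' := by
  simp [edgeSum]

theorem edgeSum_ofFn {n : ℕ} (f : Fin n → Vtx × Vtx) :
    edgeSum g (List.ofFn f) = ∑ i, g (f i).1 (f i).2 := by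
  simp [edgeSum, List.map_ofFn, List.sum_ofFn]

end edgeSum

/-- The edge `e` if it carries the value one. -/
def keepIf (s : ZMod 2) (e : Vtx × Vtx) : List (Vtx × Vtx) := if s = 1 then [e] else []

theorem edgeSum_keepIf (g : Vtx → Vtx → ℕ) (s : ZMod 2) (e : Vtx × Vtx) :
    edgeSum g (keepIf s e) = if s = 1 then g e.1 e.2 else 0 := by
  unfold keepIf; split_ifs <;> simp

namespace Circ

open ZXDiagram

/-- The number of preparations. -/
def prepCount : {m : ℕ} → Circ m → ℕ
  | _, empty => 0
  | _, prepZero c => c.prepCount + 1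
  | _, prepPlus c => c.prepCount + 1
  | _, cnot c _ _ _ => c.prepCount
  | _, measZ c _ => c.prepCount
  | _, measX c _ => c.prepCount
  | _, corrX c _ _ _ => c.prepCount
  | _, corrZ c _ _ _ => c.prepCount

/-- `Trace c L G`: in some assignment of bits to the wires that all spiders allow, the `q`-th live
wire starts at the vertex `(L q).1` and has the value `(L q).2`, and `G` is the multigraph of the
completed wires of value one.  Wires that are measured do not become edges. -/
inductive Trace : {m : ℕ} → Circ m → (Fin m → Vtx × ZMod 2) → List (Vtx × Vtx) → Prop where
  | empty (L) : Trace empty L []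
  | prepZero {m : ℕ} {c : Circ m} {L G} (h : Trace c L G) :
      Trace c.prepZero (Fin.snoc (α := fun _ => Vtx × ZMod 2) L ((3, c.prepCount), 0)) G
  | prepPlus {m : ℕ} {c : Circ m} {L G} (h : Trace c L G) (z : ZMod 2) :
      Trace c.prepPlus (Fin.snoc (α := fun _ => Vtx × ZMod 2) L ((3, c.prepCount), z)) G
  | cnot {m : ℕ} {c : Circ m} {L G} (h : Trace c L G) (i j : Fin m) (hne : i ≠ j) :
      Trace (c.cnot i j hne)
        (Function.update (Function.update L i ((0, c.cnotCount), (L i).2)) j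
          ((2, c.cnotCount), (L i).2 + (L j).2))
        (keepIf (L i).2 ((L i).1, (0, c.cnotCount)) ++
          (keepIf (L j).2 ((L j).1, (2, c.cnotCount)) ++
            (keepIf (L i).2 ((0, c.cnotCount), (2, c.cnotCount)) ++ G)))
  | measZ {m : ℕ} {c : Circ (m + 1)} {L G} (h : Trace c L G) (q : Fin (m + 1))
      (hq : (L q).2 = 0) : Trace (c.measZ q) (fun i => L (q.succAbove i)) G
  | measX {m : ℕ} {c : Circ (m + 1)} {L G} (h : Trace c L G) (q : Fin (m + 1)) :
      Trace (c.measX q) (fun i => L (q.succAbove i)) G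
  | corrX {m : ℕ} {c : Circ m} {L G} (h : Trace c L G) (q cond hcond) :
      Trace (c.corrX q cond hcond) L G
  | corrZ {m : ℕ} {c : Circ m} {L G} (h : Trace c L G) (q cond hcond) :
      Trace (c.corrZ q cond hcond) L G

/-- An assignment `y` to the vertices gives bits on the wires: a wire of value one takes the values
of its ends and all other wires are `0`.  An `X`-spider allows this since it has an even number of
wires of value one. -/
theorem Trace.reach {m : ℕ} {c : Circ m} {L : Fin m → Vtx × ZMod 2} {G : List (Vtx × Vtx)}
    (h : Trace c L G) (y : Vtx → ZMod 2) :
    c.diagram.Reach (cutSize y G) fun q => (L q).2 * y (L q).1 := by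
  induction h with
  | empty L =>
    exact ⟨fun h => h.1.elim, ⟨fun v => v.elim, fun i => i.elim0⟩, by simp [mism, diagram]⟩
  | prepZero h ih =>
    change (diagramPrep Color.X _).Reach _ _
    convert reach_prep (col := Color.X) ih 0 (fun _ => rfl) using 1
    funext q
    induction q using Fin.lastCases <;> simp
  | @prepPlus m c L G h z ih =>
    change (diagramPrep Color.Z _).Reach _ _
    convert reach_prep (col := Color.Z) ih (z * y (3, c.prepCount)) (fun h => by cases h) using 1
    funext q
    induction q using Fin.lastCases <;> simp
  | @cnot m c L G h i j hne ih =>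
    set zv : Vtx := (0, c.cnotCount)
    set xv : Vtx := (2, c.cnotCount)
    have h1 := ih.update i ((L i).2 * y zv)
    have h2 := h1.update j ((L j).2 * y xv)
    have h3 := reach_cnot (hne := hne) h2
    have h4 := h3.update j (((L i).2 + (L j).2) * y xv)
    rw [Function.update_self, Function.update_of_ne hne, Function.update_self,
      Function.update_of_ne hne.symm, Function.update_self] at h4
    have hfun : Function.update (Function.update (Function.update (Function.update
          (fun q => (L q).2 * y (L q).1) i ((L i).2 * y zv)) j ((L j).2 * y xv)) j
            ((L j).2 * y xv + (L i).2 * y zv)) j (((L i).2 + (L j).2) * y xv) =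
        fun q => (Function.update (Function.update L i (zv, (L i).2)) j
          (xv, (L i).2 + (L j).2) q).2 * y (Function.update (Function.update L i (zv, (L i).2)) j
          (xv, (L i).2 + (L j).2) q).1 := by
      funext q
      by_cases hj : q = j
      · subst hj; simp
      · by_cases hi : q = i
        · subst hi; simp [hj]
        · simp [hj, hi]
    rw [hfun] at h4
    refine h4.mono ?_
    simp only [cutSize, edgeSum_append, edgeSum_keepIf]
    rcases zmod2_cases (L i).2 with hi | hi <;> rcases zmod2_cases (L j).2 with hj | hj <;>
      simp only [hi, hj] <;>
      rcases zmod2_cases (y zv) with e1 | e1 <;> rcases zmod2_cases (y xv) with e2 | e2 <;>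
      rcases zmod2_cases (y (L i).1) with e3 | e3 <;>
      rcases zmod2_cases (y (L j).1) with e4 | e4 <;>
      simp [e1, e2, e3, e4, show (1 : ZMod 2) + 1 = 0 from rfl] <;> omega
  | @measZ m c L G h q hq ih =>
    refine reach_meas_iff.2 ⟨0, fun _ => rfl, ?_⟩
    convert ih using 1
    funext r
    induction r using q.succAboveCases <;> simp [hq]
  | @measX m c L G h q ih =>
    refine reach_meas_iff.2 ⟨(L q).2 * y (L q).1, fun h => (by cases h), ?_⟩
    convert ih using 1
    funext r
    induction r using q.succAboveCases <;> simp
  | corrX h q cond hcond ih => exact ih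
  | corrZ h q cond hcond ih => exact ih

/-- The bits on the wires in the fault-free diagram, in the order of the operations. -/
theorem exists_trace {m : ℕ} {c : Circ m} {b : Fin m → ZMod 2} (h : c.diagram.Reach 0 b) :
    ∃ L G, Trace c L G ∧ ∀ q, (L q).2 = b q := by
  induction c with
  | empty => exact ⟨fun i => i.elim0, [], Trace.empty _, fun i => i.elim0⟩
  | prepZero c ih =>
    obtain ⟨h1, h2⟩ := reach_of_prep h
    obtain ⟨L, G, hT, hL⟩ := ih h1
    refine ⟨_, G, hT.prepZero, fun q => ?_⟩
    induction q using Fin.lastCases with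
    | last => simp [h2 rfl]
    | cast q => simp [hL q, Fin.init]
  | @prepPlus m c ih =>
    obtain ⟨h1, h2⟩ := reach_of_prep h
    obtain ⟨L, G, hT, hL⟩ := ih h1
    refine ⟨_, G, hT.prepPlus (b (Fin.last m)), fun q => ?_⟩
    induction q using Fin.lastCases with
    | last => simp
    | cast q => simp [hL q, Fin.init]
  | cnot c i j hne ih =>
    obtain ⟨L, G, hT, hL⟩ := ih (reach_of_cnot h)
    refine ⟨_, _, hT.cnot i j hne, fun q => ?_⟩
    by_cases hj : q = j
    · subst hj
      simp only [Function.update_self, hL, Function.update_of_ne hne]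
      rw [add_left_comm, CharTwo.add_self_eq_zero, add_zero]
    · by_cases hi : q = i
      · subst hi
        simp [hL, hj]
      · simp [hL, hj, hi]
  | measZ c q ih =>
    obtain ⟨z, hz, h1⟩ := reach_meas_iff.1 h
    obtain ⟨L, G, hT, hL⟩ := ih h1
    exact ⟨_, G, hT.measZ q (by rw [hL, Fin.insertNth_apply_same, hz rfl]), fun r => by simp [hL]⟩
  | measX c q ih =>
    obtain ⟨z, hz, h1⟩ := reach_meas_iff.1 h
    obtain ⟨L, G, hT, hL⟩ := ih h1
    exact ⟨_, G, hT.measX q, fun r => by simp [hL]⟩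
  | corrX c q cond hcond ih =>
    obtain ⟨L, G, hT, hL⟩ := ih h
    exact ⟨L, G, hT.corrX q cond hcond, hL⟩
  | corrZ c q cond hcond ih =>
    obtain ⟨L, G, hT, hL⟩ := ih h
    exact ⟨L, G, hT.corrZ q cond hcond, hL⟩

/-! ### Degrees of the vertices -/

/-- The contribution of a live wire to the degree of `v`. -/
def liveInd (v : Vtx) (p : Vtx × ZMod 2) : ℕ := if p.2 = 1 ∧ p.1 = v then 1 else 0

/-- The number of edges and of live wires of value one at `v`. -/
def totDeg {m : ℕ} (v : Vtx) (L : Fin m → Vtx × ZMod 2) (G : List (Vtx × Vtx)) : ℕ :=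
  deg v G + ∑ q, liveInd v (L q)

theorem totDeg_snoc {m : ℕ} (v : Vtx) (L : Fin m → Vtx × ZMod 2) (G : List (Vtx × Vtx))
    (p : Vtx × ZMod 2) :
    totDeg v (Fin.snoc (α := fun _ => Vtx × ZMod 2) L p) G = totDeg v L G + liveInd v p := by
  simp [totDeg, Fin.sum_univ_castSucc, add_assoc]

theorem totDeg_succAbove_le {m : ℕ} (v : Vtx) (L : Fin (m + 1) → Vtx × ZMod 2)
    (G : List (Vtx × Vtx)) (q : Fin (m + 1)) :
    totDeg v (fun i => L (q.succAbove i)) G ≤ totDeg v L G := by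
  rw [totDeg, totDeg, Fin.sum_univ_succAbove _ q]
  omega

theorem sum_liveInd_update {m : ℕ} (v : Vtx) (L : Fin m → Vtx × ZMod 2) (i : Fin m)
    (p : Vtx × ZMod 2) :
    ∑ q, liveInd v (Function.update L i p q) + liveInd v (L i) =
      ∑ q, liveInd v (L q) + liveInd v p := by
  rw [← Finset.add_sum_erase _ _ (Finset.mem_univ i),
    ← Finset.add_sum_erase (a := i) _ (fun q => liveInd v (L q)) (Finset.mem_univ i)]
  rw [Function.update_self]
  have : ∑ q ∈ Finset.univ.erase i, liveInd v (Function.update L i p q) =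
      ∑ q ∈ Finset.univ.erase i, liveInd v (L q) := by
    refine Finset.sum_congr rfl fun q hq => ?_
    rw [Function.update_of_ne (Finset.ne_of_mem_erase hq)]
  omega

/-- A CNOT gate replaces the end of the wire of `i` at its old vertex by an edge there, and likewise
for `j`, so that only the degrees of the two new vertices change. -/
theorem totDeg_cnot {m : ℕ} (v zv xv : Vtx) (L : Fin m → Vtx × ZMod 2) (G : List (Vtx × Vtx))
    {i j : Fin m} (hne : i ≠ j) :
    totDeg v
        (Function.update (Function.update L i (zv, (L i).2)) j (xv, (L i).2 + (L j).2))
        (keepIf (L i).2 ((L i).1, zv) ++ (keepIf (L j).2 ((L j).1, xv) ++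
          (keepIf (L i).2 (zv, xv) ++ G))) =
      totDeg v L G + (if zv = v ∧ (L i).2 = 1 then 3 else 0) +
        (if xv = v ∧ ((L i).2 = 1 ∨ (L j).2 = 1) then 2 else 0) := by
  have h1 := sum_liveInd_update v L i (zv, (L i).2)
  have h2 := sum_liveInd_update v (Function.update L i (zv, (L i).2)) j (xv, (L i).2 + (L j).2)
  rw [Function.update_of_ne hne.symm] at h2
  simp only [totDeg, deg, edgeSum_append, edgeSum_keepIf]
  generalize ∑ q, liveInd v (Function.update (Function.update L i (zv, (L i).2)) j
    (xv, (L i).2 + (L j).2) q) = S2 at *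
  generalize ∑ q, liveInd v (Function.update L i (zv, (L i).2) q) = S1 at *
  generalize ∑ q, liveInd v (L q) = S0 at *
  generalize edgeSum _ G = d
  simp only [liveInd] at h1 h2
  rcases zmod2_cases (L i).2 with hi | hi <;> rcases zmod2_cases (L j).2 with hj | hj <;>
    simp only [hi, hj, show (1 : ZMod 2) + 1 = 0 from rfl, zero_ne_one, false_and,
      true_and, and_false, and_true, if_false, if_true, or_false, or_true, add_zero,
      zero_add] at h1 h2 ⊢
  · omega
  all_goals split_ifs at h1 h2 ⊢ <;> omega

/-- Upper bounds for the degrees after `k` CNOT gates and `r` preparations. -/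
def degBound (k r : ℕ) (v : Vtx) : ℕ :=
  if v.1 = 0 ∧ v.2 < k then 3 else if v.1 = 2 ∧ v.2 < k then 2 else
    if v.1 = 3 ∧ v.2 < r then 1 else 0

theorem Trace.totDeg_le {m : ℕ} {c : Circ m} {L : Fin m → Vtx × ZMod 2} {G : List (Vtx × Vtx)}
    (h : Trace c L G) (v : Vtx) : totDeg v L G ≤ degBound c.cnotCount c.prepCount v := by
  induction h with
  | empty L => simp [totDeg, deg]
  | @prepZero m c L G h ih =>
    rw [totDeg_snoc]
    simp only [liveInd, cnotCount, prepCount, degBound, zero_ne_one, false_and, if_false] at ih ⊢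
    grind
  | @prepPlus m c L G h z ih =>
    rw [totDeg_snoc]
    obtain ⟨a, l⟩ := v
    simp only [liveInd, cnotCount, prepCount, degBound, Prod.mk.injEq] at ih ⊢
    grind
  | @cnot m c L G h i j hne ih =>
    rw [totDeg_cnot _ _ _ _ _ hne]
    obtain ⟨a, l⟩ := v
    simp only [cnotCount, prepCount, degBound, Prod.mk.injEq] at ih ⊢
    grind
  | measZ h q hq ih => exact (totDeg_succAbove_le _ _ _ _).trans ih
  | measX h q ih => exact (totDeg_succAbove_le _ _ _ _).trans ih
  | corrX h q cond hcond ih => exact ih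
  | corrZ h q cond hcond ih => exact ih

/-- Before the first CNOT gate, every wire comes straight from a preparation. -/
theorem Trace.of_cnotCount_eq_zero {m : ℕ} {c : Circ m} {L : Fin m → Vtx × ZMod 2}
    {G : List (Vtx × Vtx)} (h : Trace c L G) (hk : c.cnotCount = 0) :
    G = [] ∧ ∀ q, ∃ r, (L q).1 = (3, r) ∧ r < c.prepCount := by
  induction h with
  | empty L => exact ⟨rfl, fun q => q.elim0⟩
  | prepZero h ih =>
    refine ⟨(ih hk).1, fun q => ?_⟩
    induction q using Fin.lastCases with
    | last => simp [prepCount]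
    | cast q =>
      obtain ⟨r, h1, h2⟩ := (ih hk).2 q
      exact ⟨r, by simpa using h1, Nat.lt_succ_of_lt h2⟩
  | prepPlus h z ih =>
    refine ⟨(ih hk).1, fun q => ?_⟩
    induction q using Fin.lastCases with
    | last => simp [prepCount]
    | cast q =>
      obtain ⟨r, h1, h2⟩ := (ih hk).2 q
      exact ⟨r, by simpa using h1, Nat.lt_succ_of_lt h2⟩
  | cnot h i j hne ih => simp [cnotCount] at hk
  | measZ h q hq ih => exact ⟨(ih hk).1, fun r => (ih hk).2 _⟩
  | measX h q ih => exact ⟨(ih hk).1, fun r => (ih hk).2 _⟩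
  | corrX h q cond hcond ih => exact ih hk
  | corrZ h q cond hcond ih => exact ih hk

/-- The control of the first CNOT gate is joined to the spider of a preparation, unless it has the
value zero. -/
theorem Trace.first_control {m : ℕ} {c : Circ m} {L : Fin m → Vtx × ZMod 2}
    {G : List (Vtx × Vtx)} (h : Trace c L G) (hk : c.cnotCount ≠ 0) :
    totDeg (0, 0) L G ≤ 2 ∨ ∃ r < c.prepCount, ((3, r), (0, 0)) ∈ G := by
  induction h with
  | empty L => exact absurd rfl hk
  | prepZero h ih =>
    rw [totDeg_snoc]
    refine (ih hk).imp (fun h => ?_) fun ⟨r, h1, h2⟩ => ⟨r, Nat.lt_succ_of_lt h1, h2⟩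
    simpa [liveInd] using h
  | prepPlus h z ih =>
    rw [totDeg_snoc]
    refine (ih hk).imp (fun h => ?_) fun ⟨r, h1, h2⟩ => ⟨r, Nat.lt_succ_of_lt h1, h2⟩
    simpa [liveInd] using h
  | @cnot m c L G h i j hne ih =>
    rw [totDeg_cnot _ _ _ _ _ hne]
    by_cases h0 : c.cnotCount = 0
    · obtain ⟨r, hr, hr'⟩ := (h.of_cnotCount_eq_zero h0).2 i
      rcases zmod2_cases (L i).2 with hi | hi
      · left
        have := h.totDeg_le (0, 0)
        simp only [degBound, h0] at this
        simp [hi]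
        simpa using this.trans (by simp)
      · exact Or.inr ⟨r, hr', by simp [keepIf, hi, hr, h0]⟩
    · refine (ih h0).imp (fun h => ?_) fun ⟨r, h1, h2⟩ => ⟨r, h1, by simp [h2]⟩
      simpa [h0] using h
  | measZ h q hq ih =>
    exact (ih hk).imp ((totDeg_succAbove_le _ _ _ _).trans) id
  | measX h q ih => exact (ih hk).imp ((totDeg_succAbove_le _ _ _ _).trans) id
  | corrX h q cond hcond ih => exact ih hk
  | corrZ h q cond hcond ih => exact ih hk

/-- Changing output bits costs at most one flip each. -/
theorem _root_.CatPrep.ZXDiagram.Reach.change {n : ℕ} {D : ZXDiagram n} {w : ℕ}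
    {b : Fin n → ZMod 2} (h : D.Reach w b) (b' : Fin n → ZMod 2) :
    D.Reach (w + ∑ i, if b' i = b i then 0 else 1) b' := by
  classical
  have key : ∀ s : Finset (Fin n), D.Reach (w + ∑ i ∈ s, if b' i = b i then 0 else 1)
      fun i => if i ∈ s then b' i else b i := by
    intro s
    induction s using Finset.induction_on with
    | empty => simpa using h
    | insert a s ha ih =>
      have h1 := ih.update a (b' a)
      rw [if_neg ha] at h1
      rw [Finset.sum_insert ha, add_comm (ite _ _ _), ← add_assoc]
      convert h1 using 1
      funext i
      by_cases hi : i = a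
      · subst hi; simp
      · simp [hi]
  simpa using key Finset.univ

/-- The multigraph of all wires of value one, when all outputs have the value one. -/
def closeUp {n : ℕ} (L : Fin n → Vtx × ZMod 2) (G : List (Vtx × Vtx)) : List (Vtx × Vtx) :=
  List.ofFn (fun q : Fin n => ((L q).1, ((1, q) : Vtx))) ++ G

theorem Trace.reach_closeUp {n : ℕ} {c : Circ n} {L : Fin n → Vtx × ZMod 2}
    {G : List (Vtx × Vtx)} (h : Trace c L G) (hL : ∀ q, (L q).2 = 1) (y : Vtx → ZMod 2) :
    c.diagram.Reach (cutSize y (closeUp L G)) fun q => y (1, q) := by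
  refine ((h.reach y).change _).mono (le_of_eq ?_)
  rw [closeUp, cutSize, edgeSum_append, edgeSum_ofFn, add_comm]
  simp [hL, eq_comm]

theorem Trace.deg_closeUp {n : ℕ} {L : Fin n → Vtx × ZMod 2} {G : List (Vtx × Vtx)}
    (hL : ∀ q, (L q).2 = 1) (v : Vtx) :
    deg v (closeUp L G) = totDeg v L G + ∑ q : Fin n, if (1, (q : ℕ)) = v then 1 else 0 := by
  rw [closeUp, deg, edgeSum_append, edgeSum_ofFn, totDeg, Finset.sum_add_distrib]
  simp [liveInd, hL, deg]
  omega

/-- Two distinct output wires cannot be connected without a CNOT gate. -/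
theorem Trace.cnotCount_ne_zero {n t : ℕ} {c : Circ n} {L : Fin n → Vtx × ZMod 2}
    {G : List (Vtx × Vtx)} (h : Trace c L G) (hL : ∀ q, (L q).2 = 1) (hn : 1 < n)
    (hc : c.diagram.CatFlips t) : c.cnotCount ≠ 0 := by
  intro hk
  obtain ⟨rfl, hr⟩ := h.of_cnotCount_eq_zero hk
  let q0 : Fin n := ⟨0, by omega⟩
  let q1 : Fin n := ⟨1, hn⟩
  -- the bit `1` at the vertex of the first output does not cut any edge
  obtain ⟨a, ha⟩ := hc.const (h.reach fun v => if v = (L q0).1 then 1 else 0)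
  have h0 := congrFun ha q0
  have h1 := congrFun ha q1
  simp only [hL, if_true, one_mul] at h0 h1
  have heq : (L q1).1 = (L q0).1 := by
    by_contra hne
    rw [if_neg hne] at h1
    rw [← h0] at h1
    exact zero_ne_one h1
  obtain ⟨r, hr1, -⟩ := hr q0
  have hle := h.totDeg_le (3, r)
  have : ∑ q ∈ ({q0, q1} : Finset (Fin n)), liveInd (3, r) (L q) ≤ ∑ q, liveInd (3, r) (L q) :=
    Finset.sum_le_sum_of_subset (Finset.subset_univ _)
  rw [Finset.sum_pair (by simp [q0, q1])] at this
  simp only [liveInd, hL, heq, hr1, and_self, if_true] at this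
  simp only [totDeg, liveInd, degBound] at hle
  grind

end Circ

/-! ### Elimination of vertices of degree at most two -/

/-- The other ends of the edges at `v`, without self-loops. -/
def nbrs (v : Vtx) (es : List (Vtx × Vtx)) : List Vtx :=
  es.flatMap fun e => if e.1 = v then (if e.2 = v then [] else [e.2]) else
    if e.2 = v then [e.1] else []

/-- The edges that do not meet `v`. -/
def away (v : Vtx) (es : List (Vtx × Vtx)) : List (Vtx × Vtx) :=
  es.filter fun e => !(decide (e.1 = v) || decide (e.2 = v))

/-- Delete the vertex `v` and its edges; if `v` lies on a path, the two ends of the path become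
adjacent. -/
def elim (v : Vtx) (es : List (Vtx × Vtx)) : List (Vtx × Vtx) :=
  if (nbrs v es).length = 2 then
    ((nbrs v es).headD (0, 0), (nbrs v es).tail.headD (0, 0)) :: away v es
  else away v es

/-- Eliminate the first vertex of degree at most two, if there is one. -/
def elimStep (st : List Vtx × List (Vtx × Vtx)) : List Vtx × List (Vtx × Vtx) :=
  if (st.1.filter fun v => decide (deg v st.2 ≤ 2)).isEmpty then st
  else
    (st.1.filter fun v => !decide (v = (st.1.filter fun v => decide (deg v st.2 ≤ 2)).headD (0, 0)),
      elim ((st.1.filter fun v => decide (deg v st.2 ≤ 2)).headD (0, 0)) st.2)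

/-- Eliminate vertices until all remaining ones have a degree of at least three. -/
def reduce (st : List Vtx × List (Vtx × Vtx)) : List Vtx × List (Vtx × Vtx) :=
  st.1.foldl (fun s _ => elimStep s) st

theorem elimStep_cases (st : List Vtx × List (Vtx × Vtx)) :
    (elimStep st = st ∧ ∀ v ∈ st.1, 3 ≤ deg v st.2) ∨
      ∃ v ∈ st.1, deg v st.2 ≤ 2 ∧
        elimStep st = (st.1.filter fun w => !decide (w = v), elim v st.2) := by
  unfold elimStep
  rcases h : st.1.filter fun v => decide (deg v st.2 ≤ 2) with _ | ⟨v, l⟩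
  · left
    rw [List.filter_eq_nil_iff] at h
    refine ⟨by simp, fun v hv => ?_⟩
    have := h v hv
    simp only [decide_eq_true_eq] at this
    omega
  · right
    have hv : v ∈ st.1.filter fun v => decide (deg v st.2 ≤ 2) := by rw [h]; simp
    rw [List.mem_filter, decide_eq_true_eq] at hv
    exact ⟨v, hv.1, hv.2, by simp⟩

theorem mem_nbrs {v a : Vtx} {es : List (Vtx × Vtx)} :
    a ∈ nbrs v es ↔ a ≠ v ∧ ((v, a) ∈ es ∨ (a, v) ∈ es) := by
  simp only [nbrs, List.mem_flatMap]
  constructor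
  · rintro ⟨⟨p, q⟩, he, h⟩
    simp only at h
    split_ifs at h with h1 h2 h3 <;> simp_all
  · rintro ⟨hne, h | h⟩
    · exact ⟨_, h, by simp [hne]⟩
    · exact ⟨_, h, by simp [hne]⟩

theorem mem_away {v : Vtx} {e : Vtx × Vtx} {es : List (Vtx × Vtx)} :
    e ∈ away v es ↔ e ∈ es ∧ e.1 ≠ v ∧ e.2 ≠ v := by
  simp [away]

/-- The edges are those at `v`, the self-loops at `v` and those away from `v`. -/
theorem edgeSum_split (v : Vtx) (es : List (Vtx × Vtx)) :
    ∃ l, ∀ g : Vtx → Vtx → ℕ, (∀ a b, g a b = g b a) →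
      edgeSum g es = ((nbrs v es).map (g v)).sum + edgeSum g (away v es) + l * g v v := by
  induction es with
  | nil => exact ⟨0, fun g _ => by simp [nbrs, away]⟩
  | cons e es ih =>
    obtain ⟨l, hl⟩ := ih
    obtain ⟨a, b⟩ := e
    by_cases ha : a = v
    · by_cases hb : b = v
      · refine ⟨l + 1, fun g hg => ?_⟩
        rw [edgeSum_cons, hl g hg]
        simp [nbrs, away, ha, hb]
        ring
      · refine ⟨l, fun g hg => ?_⟩
        rw [edgeSum_cons, hl g hg]
        simp [nbrs, away, ha, hb]
        ring
    · by_cases hb : b = v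
      · refine ⟨l, fun g hg => ?_⟩
        rw [edgeSum_cons, hl g hg]
        simp [nbrs, away, ha, hb, hg a v]
        ring
      · refine ⟨l, fun g hg => ?_⟩
        rw [edgeSum_cons, hl g hg]
        simp [nbrs, away, ha, hb]
        ring

theorem deg_self_ge (v : Vtx) (es : List (Vtx × Vtx)) : (nbrs v es).length ≤ deg v es := by
  obtain ⟨l, hl⟩ := edgeSum_split v es
  rw [deg, hl _ fun a b => add_comm _ _]
  have : (nbrs v es).length = ((nbrs v es).map fun _ => 1).sum := by simp
  rw [this]
  refine le_trans (List.sum_le_sum fun a _ => ?_)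
    (le_trans (Nat.le_add_right _ _) (Nat.le_add_right _ _))
  simp

theorem sum_map_indicator (w : Vtx) (l : List Vtx) :
    (l.map fun a => if a = w then 1 else 0).sum = l.count w := by
  induction l with
  | nil => rfl
  | cons a l ih => simp [List.count_cons, ih, add_comm]

theorem deg_of_ne {v w : Vtx} (hw : w ≠ v) (es : List (Vtx × Vtx)) :
    deg w es = (nbrs v es).count w + deg w (away v es) := by
  obtain ⟨l, hl⟩ := edgeSum_split v es
  rw [deg, hl _ fun a b => add_comm _ _]
  simp [hw.symm, sum_map_indicator]

theorem elim_eq (v : Vtx) (es : List (Vtx × Vtx)) :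
    ((nbrs v es).length ≠ 2 ∧ elim v es = away v es) ∨
      ∃ a b, nbrs v es = [a, b] ∧ elim v es = (a, b) :: away v es := by
  unfold elim
  split_ifs with h
  · right
    obtain ⟨a, b, hab⟩ := List.length_eq_two.1 h
    exact ⟨a, b, hab, by simp [hab]⟩
  · exact Or.inl ⟨h, rfl⟩

theorem deg_elim_le {v w : Vtx} (hw : w ≠ v) (es : List (Vtx × Vtx)) :
    deg w (elim v es) ≤ deg w es := by
  rw [deg_of_ne hw es]
  rcases elim_eq v es with ⟨-, h⟩ | ⟨a, b, hn, h⟩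
  · rw [h]; omega
  · rw [h, hn, deg, edgeSum_cons, ← sum_map_indicator]
    simp

theorem deg_elim_eq {v w : Vtx} (hw : w ≠ v) {es : List (Vtx × Vtx)}
    (h1 : (nbrs v es).length = 2 ∨ w ∉ nbrs v es) : deg w (elim v es) = deg w es := by
  rw [deg_of_ne hw es]
  rcases elim_eq v es with ⟨h2, h⟩ | ⟨a, b, hn, h⟩
  · rw [h, List.count_eq_zero_of_not_mem (h1.resolve_left h2), zero_add]
  · rw [h, hn, deg, edgeSum_cons, ← sum_map_indicator]
    simp

/-- The edges `es` on the vertices `vs` and the outputs are a reduced form of the diagram `D` with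
`k` CNOT gates: every cut of the multigraph is the effect of a fault on `D` of at most the same
weight, and a vertex of degree three is the control of one of the gates.  The control of the first
gate is about to disappear. -/
structure Good {n : ℕ} (D : ZXDiagram n) (k : ℕ) (vs : List Vtx) (es : List (Vtx × Vtx)) :
    Prop where
  reach : ∀ y : Vtx → ZMod 2, D.Reach (cutSize y es) fun q => y (1, q)
  out : ∀ i < n, deg (1, i) es = 1
  ends : ∀ e ∈ es, (e.1 ∈ vs ∨ e.1.1 = 1 ∧ e.1.2 < n) ∧ (e.2 ∈ vs ∨ e.2.1 = 1 ∧ e.2.2 < n)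
  tag : ∀ v ∈ vs, v.1 ≠ 1
  nodup : vs.Nodup
  high : ∀ v ∈ vs, 3 ≤ deg v es → v.1 = 0 ∧ v.2 < k ∧ deg v es = 3
  first : (0, 0) ∉ vs ∨ deg (0, 0) es ≤ 2 ∨
    ∃ u ∈ vs, u ≠ (0, 0) ∧ deg u es ≤ 1 ∧ (0, 0) ∈ nbrs u es

/-- An output cannot hang on a leaf: the two would be disconnected from the other outputs. -/
theorem Good.nbrs_ne_output {n k t : ℕ} {D : ZXDiagram n} {vs : List Vtx}
    {es : List (Vtx × Vtx)} (h : Good D k vs es) (hn : 1 < n) (hD : D.CatFlips t) {v : Vtx}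
    (hv : v ∈ vs) {i : ℕ} (hi : i < n) (hN : nbrs v es = [(1, i)]) : False := by
  have hne : ((1, i) : Vtx) ≠ v := by
    rintro rfl; exact h.tag _ hv rfl
  have h0 : deg (1, i) (away v es) = 0 := by
    have := deg_of_ne hne es
    rw [h.out i hi, hN] at this
    simpa using this
  obtain ⟨l, hl⟩ := edgeSum_split v es
  -- the cut that separates the leaf and the output from the rest is empty
  set y : Vtx → ZMod 2 := fun a => if a = v ∨ a = (1, i) then 1 else 0 with hy
  have hcut : cutSize y es = 0 := by
    rw [cutSize, hl _ fun a b => by simp only [eq_comm], hN]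
    have : edgeSum (fun a b => if y a = y b then 0 else 1) (away v es) = 0 := by
      rw [edgeSum, List.sum_eq_zero_iff]
      simp only [List.mem_map]
      rintro _ ⟨e, he, rfl⟩
      have h1 := (mem_away.1 he).2
      rw [deg, edgeSum, List.sum_eq_zero_iff] at h0
      have h2 := h0 _ (List.mem_map_of_mem he)
      have h3 : e.1 ≠ (1, i) := by rintro h; simp [h] at h2
      have h4 : e.2 ≠ (1, i) := by rintro h; simp [h] at h2
      simp [hy, h1, h3, h4]
    rw [this]
    simp [hy]
  have hr := h.reach y
  rw [hcut] at hr
  obtain ⟨c, hc⟩ := hD.const hr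
  have e1 := congrFun hc ⟨i, hi⟩
  obtain ⟨j, hj, hij⟩ : ∃ j < n, j ≠ i := by
    rcases Nat.eq_zero_or_pos i with h | h
    · exact ⟨1, hn, by omega⟩
    · exact ⟨0, by omega, by omega⟩
  have e2 := congrFun hc ⟨j, hj⟩
  have hjv : ((1, j) : Vtx) ≠ v := by
    rintro rfl; exact h.tag _ hv rfl
  simp only [hy, or_true, if_true] at e1
  simp only [hy, hjv, Prod.mk.injEq, hij, and_false, or_false, if_false] at e2
  rw [← e1] at e2
  exact zero_ne_one e2

/-- A cut of the graph after the elimination of `v` extends to `v`: give `v` the bit of one of its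
neighbours. -/
theorem cutSize_elim {v : Vtx} {es : List (Vtx × Vtx)} (hv : deg v es ≤ 2) (y : Vtx → ZMod 2) :
    ∃ z, cutSize (Function.update y v z) es ≤ cutSize y (elim v es) := by
  obtain ⟨l, hl⟩ := edgeSum_split v es
  have hlen := (deg_self_ge v es).trans hv
  have haway : ∀ z, cutSize (Function.update y v z) (away v es) = cutSize y (away v es) := by
    intro z
    simp only [cutSize, edgeSum]
    congr 1
    refine List.map_congr_left fun e he => ?_
    have := (mem_away.1 he).2
    rw [Function.update_of_ne this.1, Function.update_of_ne this.2]
  have hne : ∀ a ∈ nbrs v es, a ≠ v := fun a ha => (mem_nbrs.1 ha).1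
  have key : ∀ z, cutSize (Function.update y v z) es =
      ((nbrs v es).map fun a => if z = y a then 0 else 1).sum + cutSize y (away v es) := by
    intro z
    rw [← haway z, cutSize, hl _ fun a b => by simp only [eq_comm]]
    rw [if_pos rfl, mul_zero, add_zero]
    congr 2
    refine List.map_congr_left fun a ha => ?_
    rw [Function.update_self, Function.update_of_ne (hne a ha)]
  rcases elim_eq v es with ⟨h2, h⟩ | ⟨a, b, hN, h⟩
  · rw [h]
    match hN : nbrs v es with
    | [] => exact ⟨0, by rw [key, hN]; simp⟩
    | [a] => exact ⟨y a, by rw [key, hN]; simp⟩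
    | [a, b] => simp [hN] at h2
    | a :: b :: c :: l' => simp [hN] at hlen
  · refine ⟨y a, ?_⟩
    rw [h, key, hN, cutSize, edgeSum_cons]
    simp

/-- The elimination of a vertex of degree at most two preserves the invariant. -/
theorem Good.elim {n k t : ℕ} {D : ZXDiagram n} {vs : List Vtx} {es : List (Vtx × Vtx)}
    (h : Good D k vs es) (hn : 1 < n) (hD : D.CatFlips t) {v : Vtx} (hv : v ∈ vs)
    (hdeg : deg v es ≤ 2) : Good D k (vs.filter fun w => !decide (w = v)) (elim v es) := by
  have hvo : ∀ i, ((1, i) : Vtx) ≠ v := by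
    rintro i rfl; exact h.tag _ hv rfl
  have hmem : ∀ w, w ∈ (vs.filter fun w => !decide (w = v)) ↔ w ∈ vs ∧ w ≠ v := by
    intro w; simp
  have hlen := (deg_self_ge v es).trans hdeg
  have hout : ∀ w, w ≠ v → (w ∈ vs ∨ w.1 = 1 ∧ w.2 < n) →
      (w ∈ (vs.filter fun w => !decide (w = v)) ∨ w.1 = 1 ∧ w.2 < n) := by
    rintro w hw (h1 | h1)
    · exact Or.inl ((hmem w).2 ⟨h1, hw⟩)
    · exact Or.inr h1
  have hnb : ∀ a ∈ nbrs v es,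
      a ∈ (vs.filter fun w => !decide (w = v)) ∨ a.1 = 1 ∧ a.2 < n := by
    intro a ha
    obtain ⟨hne, h1 | h1⟩ := mem_nbrs.1 ha
    · exact hout a hne (h.ends _ h1).2
    · exact hout a hne (h.ends _ h1).1
  refine ⟨fun y => ?_, fun i hi => ?_, fun e he => ?_, fun w hw => h.tag w ((hmem w).1 hw).1,
    h.nodup.filter _, fun w hw h3 => ?_, ?_⟩
  · obtain ⟨z, hz⟩ := cutSize_elim hdeg y
    have := (h.reach (Function.update y v z)).mono hz
    convert this using 2 with q
    rw [Function.update_of_ne (hvo q)]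
  · -- the degree of an output can only decrease if `v` is a leaf that hangs on it
    refine (deg_elim_eq (hvo i) ?_).trans (h.out i hi)
    by_contra hcon
    push Not at hcon
    obtain ⟨h2, hi'⟩ := hcon
    match hN : nbrs v es with
    | [] => rw [hN] at hi'; simp at hi'
    | [a] =>
      rw [hN, List.mem_singleton] at hi'
      exact h.nbrs_ne_output hn hD hv hi (by rw [hN, hi'])
    | [a, b] => simp [hN] at h2
    | a :: b :: c :: l' => simp [hN] at hlen
  · have haw : ∀ e ∈ away v es, _ := fun e he =>
      let h1 := mem_away.1 he
      And.intro (hout _ h1.2.1 (h.ends e h1.1).1) (hout _ h1.2.2 (h.ends e h1.1).2)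
    rcases elim_eq v es with ⟨h2, h'⟩ | ⟨a, b, hN, h'⟩
    · rw [h'] at he; exact haw e he
    · rw [h', List.mem_cons] at he
      rcases he with rfl | he
      · exact ⟨hnb a (by simp [hN]), hnb b (by simp [hN])⟩
      · exact haw e he
  · obtain ⟨hw1, hw2⟩ := (hmem w).1 hw
    have hle := deg_elim_le hw2 es
    obtain ⟨h4, h5, h6⟩ := h.high w hw1 (h3.trans hle)
    exact ⟨h4, h5, by omega⟩
  · by_cases hv0 : v = (0, 0)
    · left; rw [hmem]; exact fun h => h.2 hv0.symm
    rcases h.first with h1 | h1 | ⟨u, hu, hu0, hud, hun⟩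
    · left; rw [hmem]; exact fun h => h1 h.1
    · exact Or.inr (Or.inl ((deg_elim_le (Ne.symm hv0) es).trans h1))
    · by_cases huv : u = v
      · -- the leaf at the first control is eliminated, so that the control has degree two now
        subst huv
        by_cases h00 : ((0, 0) : Vtx) ∈ vs
        · right; left
          have hl1 := (deg_self_ge u es).trans hud
          have heq : CatPrep.elim u es = away u es := by
            rcases elim_eq u es with ⟨h2, h'⟩ | ⟨a, b, hN, h'⟩
            · exact h'
            · simp [hN] at hl1
          have hd := deg_of_ne (Ne.symm hu0) es
          have hc := List.count_pos_iff.2 hun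
          have h3 : deg (0, 0) es ≤ 3 := by
            by_contra hlt
            have := (h.high _ h00 (by omega)).2.2
            omega
          rw [heq]
          omega
        · left; rw [hmem]; exact fun h => h00 h.1
      · right; right
        refine ⟨u, (hmem u).2 ⟨hu, huv⟩, hu0, (deg_elim_le huv es).trans hud, ?_⟩
        have haw : ∀ e ∈ away v es, e ∈ CatPrep.elim v es := by
          intro e he
          rcases elim_eq v es with ⟨h2, h'⟩ | ⟨a, b, hN, h'⟩ <;> rw [h']
          · exact he
          · exact List.mem_cons_of_mem _ he
        rw [mem_nbrs] at hun ⊢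
        refine ⟨hun.1, hun.2.imp (fun h => haw _ (mem_away.2 ⟨h, ?_, ?_⟩))
          fun h => haw _ (mem_away.2 ⟨h, ?_, ?_⟩)⟩
        exacts [huv, Ne.symm hv0, Ne.symm hv0, huv]

theorem Good.elimStep {n k t : ℕ} {D : ZXDiagram n} {st : List Vtx × List (Vtx × Vtx)}
    (h : Good D k st.1 st.2) (hn : 1 < n) (hD : D.CatFlips t) :
    Good D k (elimStep st).1 (elimStep st).2 := by
  rcases elimStep_cases st with ⟨h1, -⟩ | ⟨v, hv, hdeg, h1⟩
  · rwa [h1]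
  · rw [h1]; exact h.elim hn hD hv hdeg

theorem Good.reduce {n k t : ℕ} {D : ZXDiagram n} {st : List Vtx × List (Vtx × Vtx)}
    (h : Good D k st.1 st.2) (hn : 1 < n) (hD : D.CatFlips t) :
    Good D k (reduce st).1 (reduce st).2 := by
  unfold CatPrep.reduce
  have : ∀ (l : List Vtx) (s : List Vtx × List (Vtx × Vtx)), Good D k s.1 s.2 →
      Good D k (l.foldl (fun s _ => CatPrep.elimStep s) s).1
        (l.foldl (fun s _ => CatPrep.elimStep s) s).2 := by
    intro l
    induction l with
    | nil => exact fun s hs => hs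
    | cons a l ih => exact fun s hs => ih _ (hs.elimStep hn hD)
  exact this _ _ h

theorem three_le_deg_foldl (l : List Vtx) :
    ∀ s : List Vtx × List (Vtx × Vtx), (s.1.length ≤ l.length ∨ ∀ v ∈ s.1, 3 ≤ deg v s.2) →
      ∀ v ∈ (l.foldl (fun s _ => elimStep s) s).1,
        3 ≤ deg v (l.foldl (fun s _ => elimStep s) s).2 := by
  induction l with
  | nil =>
    rintro s (h | h)
    · have : s.1 = [] := List.length_eq_zero_iff.1 (Nat.le_zero.1 h)
      simp [this]
    · exact h
  | cons a l ih =>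
    intro s h
    refine ih (elimStep s) ?_
    rcases elimStep_cases s with ⟨h1, h2⟩ | ⟨v, hv, hdeg, h1⟩
    · right; rwa [h1]
    · left
      have h := h.resolve_right fun h => absurd (h v hv) (by omega)
      rw [h1]
      have : (s.1.filter fun w => !decide (w = v)).length < s.1.length :=
        List.length_filter_lt_length_iff_exists.2 ⟨v, hv, by simp⟩
      simp only [List.length_cons] at h
      simp only
      omega

theorem Good.deg_eq_three {n k t : ℕ} {D : ZXDiagram n} {st : List Vtx × List (Vtx × Vtx)}
    (h : Good D k st.1 st.2) (hn : 1 < n) (hD : D.CatFlips t) {v : Vtx}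
    (hv : v ∈ (CatPrep.reduce st).1) : deg v (CatPrep.reduce st).2 = 3 :=
  ((h.reduce hn hD).high v hv (three_le_deg_foldl st.1 st (Or.inl le_rfl) v hv)).2.2

theorem Good.length_lt {n k t : ℕ} {D : ZXDiagram n} {st : List Vtx × List (Vtx × Vtx)}
    (h : Good D k st.1 st.2) (hn : 1 < n) (hD : D.CatFlips t) (hk : k ≠ 0) :
    (CatPrep.reduce st).1.length + 1 ≤ k := by
  have hg := h.reduce hn hD
  have h3 := three_le_deg_foldl st.1 st (Or.inl le_rfl)
  change ∀ v ∈ (CatPrep.reduce st).1, 3 ≤ deg v (CatPrep.reduce st).2 at h3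
  have h0 : ((0, 0) : Vtx) ∉ (CatPrep.reduce st).1 := by
    intro h0
    rcases hg.first with h1 | h1 | ⟨u, hu, -, hud, -⟩
    · exact h1 h0
    · have := h3 _ h0; omega
    · have := h3 _ hu; omega
  have hsub : (CatPrep.reduce st).1.toFinset ⊆
      (Finset.Ico 1 k).map ⟨fun l => ((0, l) : Vtx), fun a b h => by simpa using h⟩ := by
    intro v hv
    rw [List.mem_toFinset] at hv
    obtain ⟨e1, e2, -⟩ := hg.high v hv (h3 v hv)
    obtain ⟨a, l⟩ := v
    simp only at e1 e2
    subst e1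
    refine Finset.mem_map.2 ⟨l, Finset.mem_Ico.2 ⟨?_, e2⟩, rfl⟩
    rcases Nat.eq_zero_or_pos l with rfl | hl
    · exact absurd hv h0
    · exact hl
  have := Finset.card_le_card hsub
  rw [List.toFinset_card_of_nodup hg.nodup, Finset.card_map, Nat.card_Ico] at this
  omega

/-! ### Linear forms for the values of the wires -/

/-- A linear form over `ZMod 2` by its list of coefficients. -/
abbrev Form := List Bool

/-- The value of a form at the assignment `ρ`. -/
def Form.eval : (ℕ → ZMod 2) → Form → ZMod 2
  | _, [] => 0
  | ρ, b :: w => (if b then ρ 0 else 0) + Form.eval (fun i => ρ (i + 1)) w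

/-- The sum of two forms. -/
def Form.add : Form → Form → Form
  | [], w => w
  | a :: u, w => xor a (w.headD false) :: Form.add u w.tail

/-- The coefficient of `w` at the first variable that occurs in `u`. -/
def Form.coef : Form → Form → Bool
  | [], _ => false
  | true :: _, w => w.headD false
  | false :: u, w => Form.coef u w.tail

/-- Solve the equation `u = 0` for the first variable that occurs in `u`, and insert the solution
into `w`. -/
def Form.pivot (u w : Form) : Form := if Form.coef u w then Form.add u w else w

/-- The variable `r`. -/
def Form.var (r : ℕ) : Form := List.replicate r false ++ [true]

namespace Form

theorem eval_tail (ρ : ℕ → ZMod 2) (w : Form) :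
    eval ρ w = (if w.headD false then ρ 0 else 0) + eval (fun i => ρ (i + 1)) w.tail := by
  cases w <;> simp [eval]

theorem eval_add (u : Form) : ∀ (ρ : ℕ → ZMod 2) (w : Form),
    eval ρ (add u w) = eval ρ u + eval ρ w := by
  induction u with
  | nil => intro ρ w; simp [add, eval]
  | cons a u ih =>
    intro ρ w
    rw [add, eval, ih, eval, eval_tail ρ w]
    have := CharTwo.add_self_eq_zero (ρ 0)
    cases a <;> cases List.headD w false <;> simp <;>
      first | ring1 | linear_combination this | linear_combination -this

/-- Unless `u` vanishes identically, `δ` is the assignment that is `1` at the first variable of `u`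
and `0` elsewhere. -/
theorem exists_pivot (u : Form) : (∀ ρ, eval ρ u = 0) ∧ (∀ w, coef u w = false) ∨
    ∃ δ : ℕ → ZMod 2, (∀ w, eval δ w = if coef u w then 1 else 0) ∧
      (∀ (ρ : ℕ → ZMod 2) (z : ZMod 2) (w : Form),
        eval (ρ + z • δ) w = eval ρ w + z * (if coef u w then 1 else 0)) ∧ coef u u = true := by
  induction u with
  | nil => exact Or.inl ⟨fun _ => rfl, fun _ => rfl⟩
  | cons a u ih =>
    have hzero : ∀ w : Form, eval (fun _ => 0) w = 0 := by
      intro w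
      induction w with
      | nil => rfl
      | cons a w ih => simp [eval, ih]
    cases a with
    | true =>
      have hc : ∀ w, coef (true :: u) w = w.headD false := fun _ => rfl
      refine Or.inr ⟨fun i => if i = 0 then 1 else 0, fun w => ?_, fun ρ z w => ?_, rfl⟩
      · rw [eval_tail, hc]
        simpa using hzero w.tail
      · rw [eval_tail, eval_tail ρ, hc]
        have h0 : (fun i => (ρ + z • (fun i => if i = 0 then (1 : ZMod 2) else 0 : ℕ → ZMod 2))
            (i + 1)) = fun i => ρ (i + 1) := by funext i; simp
        rw [h0]
        by_cases hw : List.headD w false = true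
        · simp only [if_pos hw, Pi.add_apply, Pi.smul_apply, smul_eq_mul, if_true]
          ring
        · simp only [if_neg hw, mul_zero, add_zero]
    | false =>
      have hc : ∀ w, coef (false :: u) w = coef u w.tail := fun _ => rfl
      rcases ih with ⟨h1, h2⟩ | ⟨δ, h1, h2, h3⟩
      · exact Or.inl ⟨fun ρ => by simp [eval, h1], fun w => by rw [hc, h2]⟩
      · refine Or.inr ⟨fun i => if i = 0 then 0 else δ (i - 1), fun w => ?_, fun ρ z w => ?_, ?_⟩
        · rw [eval_tail, hc, ← h1]
          have : (fun i => if i + 1 = 0 then (0 : ZMod 2) else δ (i + 1 - 1)) = δ := by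
            funext i; simp
          rw [this]
          simp
        · rw [eval_tail, eval_tail ρ, hc]
          have := h2 (fun i => ρ (i + 1)) z w.tail
          have h0 : (fun i => (ρ + z • (fun i => if i = 0 then 0 else δ (i - 1) : ℕ → ZMod 2))
              (i + 1)) = (fun i => ρ (i + 1)) + z • δ := by funext i; simp
          rw [h0, this]
          simp [add_assoc]
        · exact h3

/-- Changing the first variable of `u` such that `u` vanishes is the substitution `pivot u`. -/
theorem eval_pivot (u : Form) (ρ : ℕ → ZMod 2) :
    ∃ ρ', (∀ w, eval ρ (pivot u w) = eval ρ' w) ∧ eval ρ' u = 0 := by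
  rcases exists_pivot u with ⟨h1, h2⟩ | ⟨δ, -, h2, h3⟩
  · exact ⟨ρ, fun w => by simp [pivot, h2], h1 ρ⟩
  · refine ⟨ρ + eval ρ u • δ, fun w => ?_, ?_⟩
    · rw [h2, pivot]
      split_ifs
      · rw [eval_add]; ring
      · ring
    · rw [h2, h3, if_pos rfl, mul_one, CharTwo.add_self_eq_zero]

theorem eval_pivot_of_eval_eq_zero {u : Form} {ρ : ℕ → ZMod 2} (h : eval ρ u = 0) (w : Form) :
    eval ρ (pivot u w) = eval ρ w := by
  unfold pivot
  split_ifs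
  · rw [eval_add, h, zero_add]
  · rfl

theorem eval_congr : ∀ (w : Form) {ρ ρ' : ℕ → ZMod 2}, (∀ i < w.length, ρ i = ρ' i) →
    eval ρ w = eval ρ' w := by
  intro w
  induction w with
  | nil => intro ρ ρ' _; rfl
  | cons a w ih =>
    intro ρ ρ' h
    rw [eval, eval, h 0 (by simp), ih fun i hi => h (i + 1) (by simpa using hi)]

theorem eval_var (r : ℕ) : ∀ ρ, eval ρ (var r) = ρ r := by
  induction r with
  | zero => intro ρ; simp [var, eval]
  | succ r ih =>
    intro ρ
    have : var (r + 1) = false :: var r := by simp [var, List.replicate_succ]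
    rw [this, eval, ih]
    simp

theorem length_add (u : Form) : ∀ w, (add u w).length = max u.length w.length := by
  induction u with
  | nil => intro w; simp [add]
  | cons a u ih => intro w; simp [add, ih]; omega

theorem length_pivot_le (u w : Form) : (pivot u w).length ≤ max u.length w.length := by
  unfold pivot
  split_ifs
  · exact (length_add u w).le
  · exact le_max_right _ _

theorem length_var (r : ℕ) : (var r).length = r + 1 := by simp [var]

end Form

/-! ### The graph of a circuit, computed symbolically -/

/-- An operation: its code and the qubits that it acts on. -/
abbrev Op := ℕ × List ℕ

/-- The live wires with the vertices at which they start and the forms for their values, the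
completed wires with the forms for their values, the vertices, the number of CNOT gates, and the
number of preparations. -/
abbrev SymState :=
  List (Vtx × Form) × (List ((Vtx × Vtx) × Form) × (List Vtx × (ℕ × ℕ)))

/-- Replace the entry at the position `i`. -/
def setAt {α : Type} (l : List α) (i : ℕ) (x : α) : List α := l.take i ++ x :: l.drop (i + 1)

/-- Delete the entry at the position `i`. -/
def delAt {α : Type} (l : List α) (i : ℕ) : List α := l.take i ++ l.drop (i + 1)

/-- The entry at the position `i`. -/
def getAt (l : List (Vtx × Form)) (i : ℕ) : Vtx × Form := (l.drop i).headD ((0, 0), [])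

/-- The effect of a preparation, where `f` is the form for the value of the new wire. -/
def prepStep (st : SymState) (f : Form) : SymState :=
  (st.1 ++ [((3, st.2.2.2.2), f)], (st.2.1, ((3, st.2.2.2.2) :: st.2.2.1,
    (st.2.2.2.1, st.2.2.2.2 + 1))))

/-- The effect of a CNOT gate with control `i` and target `j`. -/
def cnotStep (st : SymState) (i j : ℕ) : SymState :=
  (setAt (setAt st.1 i ((0, st.2.2.2.1), (getAt st.1 i).2)) j
      ((2, st.2.2.2.1), Form.add (getAt st.1 i).2 (getAt st.1 j).2),
    ((((getAt st.1 i).1, (0, st.2.2.2.1)), (getAt st.1 i).2) ::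
        (((getAt st.1 j).1, (2, st.2.2.2.1)), (getAt st.1 j).2) ::
          (((0, st.2.2.2.1), (2, st.2.2.2.1)), (getAt st.1 i).2) :: st.2.1,
      ((0, st.2.2.2.1) :: (2, st.2.2.2.1) :: st.2.2.1, (st.2.2.2.1 + 1, st.2.2.2.2))))

/-- The effect of a `Z`-basis measurement of the qubit `q` with outcome `0`. -/
def measZStep (st : SymState) (q : ℕ) : SymState :=
  ((delAt st.1 q).map fun l => (l.1, Form.pivot (getAt st.1 q).2 l.2),
    (st.2.1.map fun e => (e.1, Form.pivot (getAt st.1 q).2 e.2), st.2.2))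

/-- The effect of an operation. -/
def opStep (st : SymState) (op : Op) : SymState :=
  if op.1 = 0 then prepStep st []
  else if op.1 = 1 then prepStep st (Form.var st.2.2.2.2)
  else if op.1 = 2 then cnotStep st (op.2.headD 0) (op.2.tail.headD 0)
  else if op.1 = 3 then measZStep st (op.2.headD 0)
  else if op.1 = 4 then (delAt st.1 (op.2.headD 0), st.2)
  else st

/-- The effect of a list of operations, the last one first. -/
def symRun (ops : List Op) : SymState :=
  ops.foldr (fun op st => opStep st op) ([], ([], ([], (0, 0))))

theorem setAt_ofFn {α : Type} {m : ℕ} (f : Fin m → α) (i : Fin m) (x : α) :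
    setAt (List.ofFn f) i x = List.ofFn (Function.update f i x) := by
  apply List.ext_getElem
  · simp [setAt]; omega
  · intro k h1 h2
    simp only [setAt, List.getElem_ofFn]
    rcases lt_trichotomy k i with h | h | h
    · rw [List.getElem_append_left (by simp; omega),
        Function.update_of_ne (by intro h'; simp [← h'] at h)]
      simp
    · subst h
      rw [List.getElem_append_right (by simp)]
      simp
    · have hk : k < m := by simpa using h2
      rw [List.getElem_append_right (by simp; omega),
        Function.update_of_ne (by intro h'; simp [← h'] at h)]
      have : k - (List.take i (List.ofFn f)).length = (k - i - 1) + 1 := by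
        simp; omega
      simp only [this, List.getElem_cons_succ, List.getElem_drop, List.getElem_ofFn]
      congr 2
      omega

theorem delAt_ofFn {α : Type} {m : ℕ} (f : Fin (m + 1) → α) (i : Fin (m + 1)) :
    delAt (List.ofFn f) i = List.ofFn fun q => f (i.succAbove q) := by
  apply List.ext_getElem
  · simp [delAt]; omega
  · intro k h1 h2
    have hk : k < m := by simpa using h2
    simp only [delAt, List.getElem_ofFn]
    by_cases h : k < i
    · rw [List.getElem_append_left (by simp; omega),
        Fin.succAbove_of_castSucc_lt _ _ (by simpa [Fin.lt_def] using h)]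
      simp only [List.getElem_take, List.getElem_ofFn]
      rfl
    · rw [List.getElem_append_right (by simp; omega),
        Fin.succAbove_of_le_castSucc _ _ (by simpa [Fin.le_def] using h)]
      simp only [List.getElem_drop, List.getElem_ofFn]
      congr 1
      ext
      simp
      omega

theorem getAt_ofFn {m : ℕ} (f : Fin m → Vtx × Form) (i : Fin m) :
    getAt (List.ofFn f) i = f i := by
  rw [getAt, List.drop_eq_getElem_cons (by simp)]
  simp

/-- The operations of a circuit, the last one first. -/
def Circ.ops : {m : ℕ} → Circ m → List Op
  | _, .empty => []
  | _, .prepZero c => (0, []) :: c.ops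
  | _, .prepPlus c => (1, []) :: c.ops
  | _, .cnot c i j _ => (2, [(i : ℕ), (j : ℕ)]) :: c.ops
  | _, .measZ c q => (3, [(q : ℕ)]) :: c.ops
  | _, .measX c q => (4, [(q : ℕ)]) :: c.ops
  | _, .corrX c q _ _ => (5, [(q : ℕ)]) :: c.ops
  | _, .corrZ c q _ _ => (6, [(q : ℕ)]) :: c.ops

/-- The completed wires of value one under the assignment `ρ`. -/
def evalEdges (ρ : ℕ → ZMod 2) (es : List ((Vtx × Vtx) × Form)) : List (Vtx × Vtx) :=
  es.flatMap fun e => keepIf (Form.eval ρ e.2) e.1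

/-- The live wires with their values under the assignment `ρ`. -/
def evalLive {m : ℕ} (ρ : ℕ → ZMod 2) (Λ : Fin m → Vtx × Form) : Fin m → Vtx × ZMod 2 :=
  fun q => ((Λ q).1, Form.eval ρ (Λ q).2)

/-- The symbolic state describes all traces of the circuit. -/
structure SymSpec {m : ℕ} (c : Circ m) (st : SymState) (Λ : Fin m → Vtx × Form) : Prop where
  live : st.1 = List.ofFn Λ
  cnots : st.2.2.2.1 = c.cnotCount
  preps : st.2.2.2.2 = c.prepCount
  nodup : st.2.2.1.Nodup
  mem : ∀ v, v ∈ st.2.2.1 ↔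
    v.1 = 0 ∧ v.2 < c.cnotCount ∨ v.1 = 2 ∧ v.2 < c.cnotCount ∨ v.1 = 3 ∧ v.2 < c.prepCount
  length_le : ∀ q, (Λ q).2.length ≤ c.prepCount
  sound : ∀ ρ, c.Trace (evalLive ρ Λ) (evalEdges ρ st.2.1)
  complete : ∀ L G, c.Trace L G → ∃ ρ, L = evalLive ρ Λ

theorem evalLive_snoc {m : ℕ} (ρ : ℕ → ZMod 2) (Λ : Fin m → Vtx × Form) (p : Vtx × Form) :
    evalLive ρ (Fin.snoc (α := fun _ => Vtx × Form) Λ p) =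
      Fin.snoc (α := fun _ => Vtx × ZMod 2) (evalLive ρ Λ) (p.1, Form.eval ρ p.2) := by
  funext q
  induction q using Fin.lastCases <;> simp [evalLive]

theorem ofFn_snoc {α : Type} {m : ℕ} (f : Fin m → α) (x : α) :
    List.ofFn (Fin.snoc (α := fun _ => α) f x : Fin (m + 1) → α) = List.ofFn f ++ [x] := by
  rw [List.ofFn_succ']
  simp

theorem SymSpec.prep_nodup {m : ℕ} {c : Circ m} {st : SymState} {Λ : Fin m → Vtx × Form}
    (h : SymSpec c st Λ) : ((3, st.2.2.2.2) :: st.2.2.1).Nodup := by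
  refine List.nodup_cons.2 ⟨fun hm => ?_, h.nodup⟩
  rw [h.mem, h.preps] at hm
  simp at hm

/-- The forms parametrise all traces. For a `Z`-measurement of a wire with the form `u`, every
assignment yields one with `u = 0` by a change of the first variable of `u`. -/
theorem exists_symSpec {m : ℕ} (c : Circ m) : ∃ Λ, SymSpec c (symRun c.ops) Λ := by
  induction c with
  | empty =>
    refine ⟨fun i => i.elim0, ⟨rfl, rfl, rfl, List.nodup_nil, ?_, fun i => i.elim0,
      fun ρ => Circ.Trace.empty _, fun L G _ => ⟨0, funext fun i => i.elim0⟩⟩⟩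
    simp [symRun, Circ.ops, Circ.cnotCount, Circ.prepCount]
  | @prepZero m c ih =>
    obtain ⟨Λ, h⟩ := ih
    have hrun : symRun c.prepZero.ops = prepStep (symRun c.ops) [] := rfl
    rw [hrun]
    refine ⟨Fin.snoc (α := fun _ => Vtx × Form) Λ ((3, c.prepCount), []), ⟨?_, h.cnots, ?_,
      h.prep_nodup, ?_, ?_, ?_, ?_⟩⟩
    · rw [ofFn_snoc, ← h.live, ← h.preps]; rfl
    · simp [prepStep, h.preps, Circ.prepCount]
    · rintro ⟨a, l⟩
      simp only [prepStep, List.mem_cons, h.mem, h.preps, Circ.cnotCount, Circ.prepCount,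
        Prod.mk.injEq]
      omega
    · intro q
      induction q using Fin.lastCases with
      | last => simp
      | cast q => simpa [Circ.prepCount] using (h.length_le q).trans (Nat.le_succ _)
    · intro ρ
      rw [evalLive_snoc]
      exact (h.sound ρ).prepZero
    · intro L G hT
      cases hT with
      | prepZero hT =>
        obtain ⟨ρ, rfl⟩ := h.complete _ _ hT
        exact ⟨ρ, by rw [evalLive_snoc]; rfl⟩
  | @prepPlus m c ih =>
    obtain ⟨Λ, h⟩ := ih
    have hrun : symRun c.prepPlus.ops =
      prepStep (symRun c.ops) (Form.var (symRun c.ops).2.2.2.2) := rfl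
    rw [hrun]
    refine ⟨Fin.snoc (α := fun _ => Vtx × Form) Λ ((3, c.prepCount), Form.var c.prepCount),
      ⟨?_, h.cnots, ?_, h.prep_nodup, ?_, ?_, ?_, ?_⟩⟩
    · rw [ofFn_snoc, ← h.live, ← h.preps]; rfl
    · simp [prepStep, h.preps, Circ.prepCount]
    · rintro ⟨a, l⟩
      simp only [prepStep, List.mem_cons, h.mem, h.preps, Circ.cnotCount, Circ.prepCount,
        Prod.mk.injEq]
      omega
    · intro q
      induction q using Fin.lastCases with
      | last => simp [Form.length_var, Circ.prepCount]
      | cast q => simpa [Circ.prepCount] using (h.length_le q).trans (Nat.le_succ _)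
    · intro ρ
      rw [evalLive_snoc]
      exact (h.sound ρ).prepPlus _
    · intro L G hT
      cases hT with
      | prepPlus hT z =>
        obtain ⟨ρ, rfl⟩ := h.complete _ _ hT
        refine ⟨Function.update ρ c.prepCount z, ?_⟩
        have : evalLive (Function.update ρ c.prepCount z) Λ = evalLive ρ Λ := by
          funext q
          refine Prod.ext rfl (Form.eval_congr _ fun i hi => ?_)
          rw [Function.update_of_ne (hi.trans_le (h.length_le q)).ne]
        rw [evalLive_snoc, this, Form.eval_var, Function.update_self]
  | @cnot m c i j hne ih =>
    obtain ⟨Λ, h⟩ := ih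
    have hrun : symRun (c.cnot i j hne).ops = cnotStep (symRun c.ops) i j := rfl
    rw [hrun]
    have hi : getAt (symRun c.ops).1 i = Λ i := by rw [h.live, getAt_ofFn]
    have hj : getAt (symRun c.ops).1 j = Λ j := by rw [h.live, getAt_ofFn]
    have hlive : ∀ ρ, evalLive ρ (Function.update (Function.update Λ i
        ((0, c.cnotCount), (Λ i).2)) j ((2, c.cnotCount), Form.add (Λ i).2 (Λ j).2)) =
        Function.update (Function.update (evalLive ρ Λ) i
          ((0, c.cnotCount), (evalLive ρ Λ i).2)) j
            ((2, c.cnotCount), (evalLive ρ Λ i).2 + (evalLive ρ Λ j).2) := by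
      intro ρ
      funext q
      by_cases hj : q = j
      · subst hj; simp [evalLive, Form.eval_add]
      · by_cases hi : q = i
        · subst hi; simp [evalLive, hj]
        · simp [evalLive, hj, hi]
    refine ⟨Function.update (Function.update Λ i ((0, c.cnotCount), (Λ i).2)) j
      ((2, c.cnotCount), Form.add (Λ i).2 (Λ j).2), ⟨?_, ?_, h.preps, ?_, ?_, ?_, ?_, ?_⟩⟩
    · simp only [cnotStep, h.live, getAt_ofFn, setAt_ofFn, h.cnots]
    · simp [cnotStep, h.cnots, Circ.cnotCount]
    · have := h.nodup
      simp only [cnotStep, List.nodup_cons, List.mem_cons, h.mem, h.cnots, Prod.mk.injEq]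
      simp [this]
    · rintro ⟨a, l⟩
      simp only [cnotStep, List.mem_cons, h.mem, h.cnots, Circ.cnotCount, Circ.prepCount,
        Prod.mk.injEq]
      omega
    · intro q
      by_cases hj : q = j
      · subst hj
        simpa [Form.length_add, Circ.prepCount] using ⟨h.length_le i, h.length_le q⟩
      · by_cases hi : q = i
        · subst hi
          simpa [hj, Circ.prepCount] using h.length_le q
        · simpa [hj, hi, Circ.prepCount] using h.length_le q
    · intro ρ
      have := (h.sound ρ).cnot i j hne
      rw [hlive]
      convert this using 1
      simp [cnotStep, evalEdges, hi, hj, h.cnots, evalLive]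
    · intro L G hT
      cases hT with
      | cnot hT =>
        obtain ⟨ρ, rfl⟩ := h.complete _ _ hT
        exact ⟨ρ, (hlive ρ).symm⟩
  | @measZ m c q ih =>
    obtain ⟨Λ, h⟩ := ih
    have hrun : symRun (c.measZ q).ops = measZStep (symRun c.ops) q := rfl
    rw [hrun]
    have hq : getAt (symRun c.ops).1 q = Λ q := by rw [h.live, getAt_ofFn]
    refine ⟨fun i => ((Λ (q.succAbove i)).1, Form.pivot (Λ q).2 (Λ (q.succAbove i)).2),
      ⟨?_, h.cnots, h.preps, h.nodup, h.mem, ?_, ?_, ?_⟩⟩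
    · simp only [measZStep, h.live, getAt_ofFn, delAt_ofFn, List.map_ofFn]
      rfl
    · intro i
      exact (Form.length_pivot_le _ _).trans (max_le (h.length_le _) (h.length_le _))
    · intro ρ
      obtain ⟨ρ', h1, h2⟩ := Form.eval_pivot (Λ q).2 ρ
      have := (h.sound ρ').measZ q h2
      convert this using 1
      · funext i; simp [evalLive, h1]
      · simp only [measZStep, hq, evalEdges, List.flatMap_map, h1]
    · intro L G hT
      cases hT with
      | measZ hT q hq0 =>
        obtain ⟨ρ, rfl⟩ := h.complete _ _ hT
        refine ⟨ρ, funext fun i => ?_⟩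
        simp [evalLive, Form.eval_pivot_of_eval_eq_zero hq0]
  | @measX m c q ih =>
    obtain ⟨Λ, h⟩ := ih
    have hrun : symRun (c.measX q).ops =
      (delAt (symRun c.ops).1 q, (symRun c.ops).2) := rfl
    rw [hrun]
    refine ⟨fun i => Λ (q.succAbove i),
      ⟨?_, h.cnots, h.preps, h.nodup, h.mem, fun i => h.length_le _,
        fun ρ => (h.sound ρ).measX q, ?_⟩⟩
    · simp only [h.live, delAt_ofFn]
    · intro L G hT
      cases hT with
      | measX hT q =>
        obtain ⟨ρ, rfl⟩ := h.complete _ _ hT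
        exact ⟨ρ, rfl⟩
  | corrX c q cond hcond ih =>
    obtain ⟨Λ, h⟩ := ih
    exact ⟨Λ, ⟨h.live, h.cnots, h.preps, h.nodup, h.mem, h.length_le,
      fun ρ => (h.sound ρ).corrX q cond hcond, fun L G hT => by
        cases hT with
        | corrX hT => exact h.complete _ _ hT⟩⟩
  | corrZ c q cond hcond ih =>
    obtain ⟨Λ, h⟩ := ih
    exact ⟨Λ, ⟨h.live, h.cnots, h.preps, h.nodup, h.mem, h.length_le,
      fun ρ => (h.sound ρ).corrZ q cond hcond, fun L G hT => by
        cases hT with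
        | corrZ hT => exact h.complete _ _ hT⟩⟩

/-! ### The multigraph of the wires of value one -/

/-- The edges of value one, when the value of the first output is set to one, together with the
edges to the outputs. -/
def graphEdges (st : SymState) : List (Vtx × Vtx) :=
  (st.1.zipIdx.map fun l => (l.1.1, ((1, l.2) : Vtx))) ++
    (st.2.1.filter fun e => Form.coef (getAt st.1 0).2 e.2).map fun e => e.1

/-- The trace in which the first variable of the first output is `1` and the others are `0` has the
value one at all outputs, since the outputs of a fault-free run agree. -/
theorem good_graphEdges {n t : ℕ} {c : Circ n} (hn : 1 < n) (hc : c.diagram.CatFlips t) :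
    c.cnotCount ≠ 0 ∧
      Good c.diagram c.cnotCount (symRun c.ops).2.2.1 (graphEdges (symRun c.ops)) := by
  obtain ⟨Λ, h⟩ := exists_symSpec c
  let q0 : Fin n := ⟨0, by omega⟩
  have hq0 : getAt (symRun c.ops).1 0 = Λ q0 := by rw [h.live]; exact getAt_ofFn Λ q0
  -- some assignment gives the outputs the value one, so the form of the first output is not zero
  obtain ⟨δ, hδ, hδ1⟩ : ∃ δ, (∀ w, Form.eval δ w = if Form.coef (Λ q0).2 w then 1 else 0) ∧
      Form.coef (Λ q0).2 (Λ q0).2 = true := by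
    rcases Form.exists_pivot (Λ q0).2 with ⟨h1, -⟩ | ⟨δ, h1, -, h3⟩
    · exfalso
      obtain ⟨L, G, hT, hL⟩ := Circ.exists_trace hc.1
      obtain ⟨ρ, rfl⟩ := h.complete _ _ hT
      have := hL q0
      simp [evalLive, h1] at this
    · exact ⟨δ, h1, h3⟩
  set L := evalLive δ Λ with hLdef
  set G := evalEdges δ (symRun c.ops).2.1 with hG
  have hT : c.Trace L G := h.sound δ
  have hL : ∀ q, (L q).2 = 1 := by
    obtain ⟨a, ha⟩ := hc.const (by simpa using (hT.reach fun _ => 1).mono (w' := 0) (by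
      simp [cutSize, edgeSum]))
    have h0 := congrFun ha q0
    have h1 : (L q0).2 = 1 := by simp [hLdef, evalLive, hδ, hδ1]
    intro q
    exact (congrFun ha q).trans (h0.symm.trans h1)
  have hes : graphEdges (symRun c.ops) = Circ.closeUp L G := by
    rw [graphEdges, Circ.closeUp]
    congr 1
    · rw [h.live]
      apply List.ext_getElem
      · simp
      · intro k h1 h2
        simp [hLdef, evalLive]
    · rw [hq0, hG, evalEdges]
      simp only [hδ]
      generalize (symRun c.ops).2.1 = es
      induction es with
      | nil => rfl
      | cons e es ih =>
        rw [List.filter_cons, List.flatMap_cons, ← ih]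
        split_ifs with he <;> simp [keepIf]
  have hdeg := Circ.Trace.deg_closeUp (G := G) hL
  have htot := hT.totDeg_le
  refine ⟨hT.cnotCount_ne_zero hL hn hc, ?_⟩
  rw [hes]
  have hdeg' : ∀ v : Vtx, v.1 ≠ 1 → deg v (Circ.closeUp L G) = Circ.totDeg v L G := by
    intro v hv
    rw [hdeg, Finset.sum_eq_zero, add_zero]
    intro q _
    rw [if_neg]
    rintro rfl
    exact hv rfl
  have htag : ∀ v ∈ (symRun c.ops).2.2.1, v.1 ≠ 1 := by
    intro v hv
    rw [h.mem] at hv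
    omega
  have hmem : ∀ v : Vtx, deg v (Circ.closeUp L G) ≠ 0 →
      v ∈ (symRun c.ops).2.2.1 ∨ v.1 = 1 ∧ v.2 < n := by
    intro v hv
    by_cases h1 : v.1 = 1
    · right
      refine ⟨h1, ?_⟩
      by_contra hlt
      apply hv
      rw [hdeg, Finset.sum_eq_zero, add_zero]
      · have := htot v
        simp only [Circ.degBound, h1] at this
        simpa using this
      · intro q _
        rw [if_neg]
        rintro rfl
        exact hlt q.2
    · left
      rw [h.mem]
      rw [hdeg' v h1] at hv
      have := htot v
      simp only [Circ.degBound] at this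
      split_ifs at this <;> omega
  refine ⟨hT.reach_closeUp hL, fun i hi => ?_, fun e he => ?_, htag, h.nodup,
    fun v hv h3 => ?_, ?_⟩
  · rw [hdeg, Finset.sum_eq_single ⟨i, hi⟩]
    · have := htot (1, i)
      simp only [Circ.degBound] at this
      simp at this
      simp [this]
    · intro q _ hq
      rw [if_neg]
      intro h'
      apply hq
      ext
      simpa using h'
    · simp
  · have hpos : ∀ v, (e.1 = v ∨ e.2 = v) → deg v (Circ.closeUp L G) ≠ 0 := by
      intro v hv h0
      rw [deg, edgeSum, List.sum_eq_zero_iff] at h0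
      have := h0 _ (List.mem_map_of_mem he)
      rcases hv with rfl | rfl <;> simp at this
    exact ⟨hmem _ (hpos _ (Or.inl rfl)), hmem _ (hpos _ (Or.inr rfl))⟩
  · rw [hdeg' v (htag v hv)] at h3 ⊢
    have := htot v
    simp only [Circ.degBound] at this
    split_ifs at this <;> omega
  · rcases hT.first_control (hT.cnotCount_ne_zero hL hn hc) with h1 | ⟨r, hr, he⟩
    · right; left
      rwa [hdeg' _ (by simp)]
    · right; right
      refine ⟨(3, r), (h.mem _).2 (by simp [hr]), by simp, ?_, ?_⟩
      · rw [hdeg' _ (by simp)]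
        have := htot (3, r)
        simpa [Circ.degBound, hr] using this
      · exact mem_nbrs.2 ⟨by simp, Or.inl (by simp [Circ.closeUp, he])⟩

/-! ### Functions that are computable in polynomial time -/

/-- An encoding of a type by trees. -/
class Enc (α : Type) where
  enc : α → Data

instance : Enc ℕ := ⟨Data.ofNat⟩

instance : Enc Bool := ⟨fun b => if b then Data.node Data.nil Data.nil else Data.nil⟩

instance {α : Type} [Enc α] : Enc (List α) := ⟨fun l => Data.ofList (l.map Enc.enc)⟩

instance {α β : Type} [Enc α] [Enc β] : Enc (α × β) :=
  ⟨fun x => Data.node (Enc.enc x.1) (Enc.enc x.2)⟩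

/-- The size of the encoding. -/
def esize {α : Type} [Enc α] (a : α) : ℕ := (Enc.enc a).size

/-- The function is computed by a program in polynomial time. -/
@[fun_prop]
def PolyFun {α β : Type} [Enc α] [Enc β] (f : α → β) : Prop :=
  ∃ (P : Prog) (p : Polynomial ℕ), ∀ a, ∃ T, P.Runs (Enc.enc a) (Enc.enc (f a)) T ∧
    T ≤ p.eval (esize a)

section size

theorem Data.one_le_size (d : Data) : 1 ≤ d.size := by cases d <;> simp [Data.size]

theorem Data.size_left_le (d : Data) : d.left.size ≤ d.size := by
  cases d <;> simp [Data.size, Data.left]; omega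

theorem Data.size_right_le (d : Data) : d.right.size ≤ d.size := by
  cases d <;> simp [Data.size, Data.right]; omega

theorem Prog.Runs.size_le {P : Prog} {x y : Data} {T : ℕ} (h : P.Runs x y T) : y.size ≤ T := by
  induction h with
  | skip x => exact le_rfl
  | nil x => exact x.one_le_size
  | left x => exact x.size_left_le
  | right x => exact x.size_right_le
  | @pair p q x _ _ _ _ _ _ h1 h2 => have := x.one_le_size; simp only [Data.size]; omega
  | seq _ _ _ h2 => omega
  | condTrue _ _ _ h2 => omega
  | condFalse _ _ _ h2 => omega
  | loopStop _ _ => omega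
  | loopStep _ _ _ _ _ h3 => omega

variable {α β : Type} [Enc α] [Enc β]

theorem one_le_esize (a : α) : 1 ≤ esize a := Data.one_le_size _

theorem esize_pair (a : α) (b : β) : esize (a, b) = esize a + esize b + 1 := rfl

theorem esize_nil : esize ([] : List α) = 1 := rfl

theorem esize_cons (a : α) (l : List α) : esize (a :: l) = esize a + esize l + 1 := rfl

theorem esize_nat (k : ℕ) : esize k = 2 * k + 1 := by
  induction k with
  | zero => rfl
  | succ k ih =>
    have : esize (k + 1) = 1 + esize k + 1 := rfl
    omega

theorem esize_bool_le (b : Bool) : esize b ≤ 3 := by cases b <;> decide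

theorem esize_append (l l' : List α) : esize (l ++ l') + 1 = esize l + esize l' := by
  induction l with
  | nil => simp [esize_nil, add_comm]
  | cons a l ih => rw [List.cons_append, esize_cons, esize_cons]; omega

theorem esize_tail_le (l : List α) : esize l.tail ≤ esize l := by
  cases l with
  | nil => exact le_rfl
  | cons a l => rw [List.tail_cons, esize_cons]; omega

theorem esize_le_of_mem {a : α} {l : List α} (h : a ∈ l) : esize a ≤ esize l := by
  induction l with
  | nil => simp at h
  | cons b l ih =>
    rw [esize_cons]
    rcases List.mem_cons.1 h with rfl | h
    · omega
    · have := ih h; omega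

theorem length_lt_esize (l : List α) : l.length < esize l := by
  induction l with
  | nil => simp [esize_nil]
  | cons b l ih => rw [esize_cons, List.length_cons]; omega

theorem esize_le_of_forall_mem {l : List α} {B : ℕ} (h : ∀ a ∈ l, esize a ≤ B) :
    esize l ≤ l.length * (B + 1) + 1 := by
  induction l with
  | nil => simp [esize_nil]
  | cons b l ih =>
    have h1 := h b (by simp)
    have h2 := ih fun a ha => h a (by simp [ha])
    rw [esize_cons, List.length_cons, add_mul]
    omega

theorem eval_mono (p : Polynomial ℕ) {x y : ℕ} (h : x ≤ y) : p.eval x ≤ p.eval y := by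
  rw [Polynomial.eval_eq_sum, Polynomial.eval_eq_sum]
  exact Finset.sum_le_sum fun i _ => Nat.mul_le_mul_left _ (Nat.pow_le_pow_left h i)

end size

namespace PolyFun

open Polynomial

variable {α β γ δ σ : Type} [Enc α] [Enc β] [Enc γ] [Enc δ] [Enc σ]

theorem exists_esize_le {f : α → β} (hf : PolyFun f) :
    ∃ p : Polynomial ℕ, ∀ a, esize (f a) ≤ p.eval (esize a) := by
  obtain ⟨P, p, h⟩ := hf
  refine ⟨p, fun a => ?_⟩
  obtain ⟨T, h1, h2⟩ := h a
  exact h1.size_le.trans h2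

/-- A type conversion that does not change the code. -/
theorem of_enc_eq {f : α → β} (h : ∀ a, Enc.enc (f a) = Enc.enc a) : PolyFun f :=
  ⟨.skip, X, fun a => ⟨_, by rw [h]; exact .skip _, by simp [esize]⟩⟩

@[fun_prop]
theorem id : PolyFun fun a : α => a := of_enc_eq fun _ => rfl

/-- A program with a constant output. -/
def constProg : Data → Prog
  | .nil => .nil
  | .node l r => .pair (constProg l) (constProg r)

theorem constProg_runs (d x : Data) : (constProg d).Runs x d (d.size * x.size) := by
  induction d with
  | nil => simpa [Data.size, constProg] using Prog.Runs.nil x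
  | node l r hl hr =>
    have := Prog.Runs.pair hl hr
    simpa [Data.size, constProg, add_mul] using this

@[fun_prop]
theorem const (b : β) : PolyFun fun _ : α => b :=
  ⟨constProg (Enc.enc b), C (esize b) * X, fun a => ⟨_, constProg_runs _ _, by simp [esize]⟩⟩

@[fun_prop]
theorem comp {g : β → γ} {f : α → β} (hg : PolyFun g) (hf : PolyFun f) :
    PolyFun fun a => g (f a) := by
  obtain ⟨Q, q, hq⟩ := hg
  obtain ⟨P, p, hp⟩ := hf
  refine ⟨.seq P Q, p + q.comp p, fun a => ?_⟩
  obtain ⟨S, h1, h2⟩ := hp a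
  obtain ⟨T, h3, h4⟩ := hq (f a)
  refine ⟨_, h1.seq h3, ?_⟩
  rw [eval_add, eval_comp]
  exact add_le_add h2 (h4.trans (eval_mono q (h1.size_le.trans h2)))

@[fun_prop]
theorem prodMk {f : α → β} {g : α → γ} (hf : PolyFun f) (hg : PolyFun g) :
    PolyFun fun a => (f a, g a) := by
  obtain ⟨P, p, hp⟩ := hf
  obtain ⟨Q, q, hq⟩ := hg
  refine ⟨.pair P Q, p + q + X, fun a => ?_⟩
  obtain ⟨S, h1, h2⟩ := hp a
  obtain ⟨T, h3, h4⟩ := hq a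
  refine ⟨_, h1.pair h3, ?_⟩
  simp only [eval_add, eval_X]
  exact add_le_add (add_le_add h2 h4) le_rfl

theorem fst' : PolyFun fun x : α × β => x.1 :=
  ⟨.left, X, fun _ => ⟨_, .left _, by simp [esize]⟩⟩

theorem snd' : PolyFun fun x : α × β => x.2 :=
  ⟨.right, X, fun _ => ⟨_, .right _, by simp [esize]⟩⟩

@[fun_prop]
theorem fst {f : α → β × γ} (hf : PolyFun f) : PolyFun fun a => (f a).1 := fst'.comp hf

@[fun_prop]
theorem snd {f : α → β × γ} (hf : PolyFun f) : PolyFun fun a => (f a).2 := snd'.comp hf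

theorem ite {p : α → Prop} [∀ a, Decidable (p a)] {f g : α → β}
    (hp : PolyFun fun a => decide (p a)) (hf : PolyFun f) (hg : PolyFun g) :
    PolyFun fun a => if p a then f a else g a := by
  obtain ⟨P, p', hp⟩ := hp
  obtain ⟨Q, q, hq⟩ := hf
  obtain ⟨R, r, hr⟩ := hg
  refine ⟨.cond P Q R, p' + q + r + X, fun a => ?_⟩
  obtain ⟨S, h1, h2⟩ := hp a
  obtain ⟨T, h3, h4⟩ := hq a
  obtain ⟨U, h5, h6⟩ := hr a
  simp only [eval_add, eval_X]
  by_cases h : p a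
  · rw [if_pos h]
    simp only [decide_eq_true h] at h1
    exact ⟨_, .condTrue h1 h3, by simp only [esize] at *; omega⟩
  · rw [if_neg h]
    simp only [decide_eq_false h] at h1
    exact ⟨_, .condFalse h1 h5, by simp only [esize] at *; omega⟩

theorem decide_bool {b : α → Bool} (hb : PolyFun b) : PolyFun fun a => decide (b a = true) := by
  simpa using hb

theorem not {b : α → Bool} (hb : PolyFun b) : PolyFun fun a => !b a := by
  have := ite hb.decide_bool (const (β := Bool) false) (const true)
  convert this using 2 with a
  cases b a <;> rfl

theorem and {b c : α → Bool} (hb : PolyFun b) (hc : PolyFun c) : PolyFun fun a => b a && c a := by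
  have := ite hb.decide_bool hc (const (β := Bool) false)
  convert this using 2 with a
  cases b a <;> rfl

theorem or {b c : α → Bool} (hb : PolyFun b) (hc : PolyFun c) : PolyFun fun a => b a || c a := by
  have := ite hb.decide_bool (const (β := Bool) true) hc
  convert this using 2 with a
  cases b a <;> rfl

theorem xor {b c : α → Bool} (hb : PolyFun b) (hc : PolyFun c) :
    PolyFun fun a => Bool.xor (b a) (c a) := by
  have := ite hb.decide_bool hc.not hc
  convert this using 2 with a
  cases b a <;> simp

attribute [fun_prop] not and or xor

@[fun_prop]
theorem cons {f : α → β} {g : α → List β} (hf : PolyFun f) (hg : PolyFun g) :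
    PolyFun fun a => f a :: g a := by
  have : PolyFun fun x : β × List β => x.1 :: x.2 := of_enc_eq fun _ => rfl
  exact this.comp (hf.prodMk hg)

@[fun_prop]
theorem tail {f : α → List β} (hf : PolyFun f) : PolyFun fun a => (f a).tail := by
  have : PolyFun fun l : List β => l.tail :=
    ⟨.right, X, fun l => ⟨(Enc.enc l).size, by
      have := Prog.Runs.right (Enc.enc l)
      cases l <;> exact this, by simp [esize]⟩⟩
  exact this.comp hf

@[fun_prop]
theorem isEmpty {f : α → List β} (hf : PolyFun f) : PolyFun fun a => (f a).isEmpty := by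
  have : PolyFun fun l : List β => l.isEmpty := by
    refine ⟨.cond .skip .nil (.pair .nil .nil), 5 * X, fun l => ?_⟩
    cases l with
    | nil => exact ⟨_, .condFalse (.skip _) (.pair (.nil _) (.nil _)), by simp [esize]; omega⟩
    | cons b l => exact ⟨_, .condTrue (.skip _) (.nil _), by simp [esize]; omega⟩
  exact this.comp hf

@[fun_prop]
theorem headD {f : α → List β} (hf : PolyFun f) (b : β) : PolyFun fun a => (f a).headD b := by
  have : PolyFun fun l : List β => l.headD b := by
    refine ⟨.cond .skip .left (constProg (Enc.enc b)), C (esize b) * X + 3 * X, fun l => ?_⟩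
    cases l with
    | nil => exact ⟨_, .condFalse (.skip _) (constProg_runs _ _), by simp [esize]; omega⟩
    | cons c l => exact ⟨_, .condTrue (.skip _) (.left _), by simp [esize]; omega⟩
  exact this.comp hf

/-- A fold is computable in polynomial time if its step is and if all intermediate states have
polynomial size. -/
theorem foldl_of_size {f : α → σ → β → σ} {s : α → σ} {l : α → List β}
    (hf : PolyFun fun x : (α × σ) × β => f x.1.1 x.1.2 x.2) (hs : PolyFun s) (hl : PolyFun l)
    (q : Polynomial ℕ)
    (hq : ∀ a l', l' <+: l a → esize (l'.foldl (f a) (s a)) ≤ q.eval (esize a)) :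
    PolyFun fun a => (l a).foldl (f a) (s a) := by
  rcases isEmpty_or_nonempty β with hβ | ⟨⟨b⟩⟩
  · convert hs using 2 with a
    rcases l a with _ | ⟨b, l'⟩
    · rfl
    · exact hβ.elim b
  have hbody : PolyFun fun x : List β × α × σ =>
      (x.1.tail, x.2.1, f x.2.1 x.2.2 (x.1.headD b)) :=
    PolyFun.prodMk (by fun_prop) (PolyFun.prodMk (by fun_prop)
      (hf.comp (f := fun x : List β × α × σ => ((x.2.1, x.2.2), x.1.headD b)) (by fun_prop)))
  obtain ⟨B, r, hB⟩ := hbody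
  obtain ⟨L, p, hL⟩ := hl
  -- the state of the loop consists of the remaining list, the environment and the state of the fold
  have hloop : ∀ (a : α) (M : ℕ), ∀ (l : List β) (s : σ),
      (∀ l', l' <+: l → esize (l'.foldl (f a) s) ≤ M) →
      ∃ T, (Prog.loop .left B).Runs (Enc.enc (l, a, s)) (Enc.enc (([] : List β), a,
        l.foldl (f a) s)) T ∧ T ≤ (l.length + 1) *
          (r.eval (esize l + esize a + M + 2) + 2 * (esize l + esize a + M + 2)) := by
    intro a M l
    induction l with
    | nil =>
      intro s hM
      refine ⟨_, .loopStop (.left _), ?_⟩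
      have := hM [] (List.nil_prefix)
      have h2 : (Enc.enc (([] : List β), a, s)).size = esize ([] : List β) + (esize a + esize s + 1)
        + 1 := rfl
      simp only [List.foldl_nil] at this
      simp only [List.length_nil, zero_add, one_mul]
      omega
    | cons c l ih =>
      intro s hM
      obtain ⟨T, h1, h2⟩ := hB (c :: l, a, s)
      obtain ⟨U, h3, h4⟩ := ih (f a s c) fun l' hl' => by
        simpa using hM (c :: l') (by simpa using hl')
      refine ⟨_, .loopStep (.left _) h1 h3, ?_⟩
      have h0 : esize s ≤ M := by simpa using hM [] (List.nil_prefix)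
      have h5 : (Enc.enc (c :: l, a, s)).size = esize (c :: l) + (esize a + esize s + 1) + 1 := rfl
      have h6 : esize (c :: l, a, s) ≤ esize (c :: l) + esize a + M + 2 := by
        simp only [esize_pair]; omega
      have h7 := h2.trans (eval_mono r h6)
      have h8 : esize l ≤ esize (c :: l) := by rw [esize_cons]; omega
      have h9 : U ≤ (l.length + 1) * (r.eval (esize (c :: l) + esize a + M + 2) +
          2 * (esize (c :: l) + esize a + M + 2)) := by
        refine h4.trans (Nat.mul_le_mul_left _ (add_le_add (eval_mono r ?_) ?_)) <;> omega
      rw [List.length_cons, add_mul (l.length + 1), one_mul]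
      omega
  have hlist : PolyFun l := ⟨L, p, hL⟩
  have hmain : PolyFun fun a => (([] : List β), a, (l a).foldl (f a) (s a)) := by
    obtain ⟨I, i, hI⟩ := hlist.prodMk (PolyFun.id.prodMk hs)
    refine ⟨.seq I (.loop .left B), i + (p + 1) * (r.comp (p + X + q + 2) +
      2 * (p + X + q + 2)), fun a => ?_⟩
    obtain ⟨S, h1, h2⟩ := hI a
    obtain ⟨T, h3, h4⟩ := hloop a _ (l a) (s a) (hq a)
    refine ⟨_, h1.seq h3, ?_⟩
    obtain ⟨U, h5, h6⟩ := hL a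
    have h7 : esize (l a) ≤ p.eval (esize a) := h5.size_le.trans h6
    have h8 := length_lt_esize (l a)
    simp only [eval_add, eval_mul, eval_comp, eval_X, eval_ofNat, eval_one]
    refine add_le_add h2 (h4.trans (Nat.mul_le_mul (by omega) (add_le_add (eval_mono r ?_) ?_)))
      <;> omega
  exact hmain.snd.snd

/-- A fold is computable in polynomial time if its step is and if each step increases the size of
the state by a bounded amount. -/
theorem foldl {f : α → σ → β → σ} {s : α → σ} {l : α → List β}
    (hf : PolyFun fun x : (α × σ) × β => f x.1.1 x.1.2 x.2) (hs : PolyFun s) (hl : PolyFun l)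
    (q : Polynomial ℕ)
    (hq : ∀ a s b, esize (f a s b) ≤ esize s + q.eval (esize (a, b))) :
    PolyFun fun a => (l a).foldl (f a) (s a) := by
  obtain ⟨p, hp⟩ := hs.exists_esize_le
  obtain ⟨r, hr⟩ := hl.exists_esize_le
  refine foldl_of_size hf hs hl (p + r * q.comp (X + r + 1)) fun a l' hl' => ?_
  have key : ∀ l'' : List β, (∀ b ∈ l'', b ∈ l a) → ∀ s : σ, esize (l''.foldl (f a) s) ≤
      esize s + l''.length * q.eval (esize a + r.eval (esize a) + 1) := by
    intro l''
    induction l'' with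
    | nil => intro _ s; simp
    | cons b l'' ih =>
      intro hb s
      have h1 := ih (fun c hc => hb c (by simp [hc])) (f a s b)
      have h2 := hq a s b
      have h3 : q.eval (esize (a, b)) ≤ q.eval (esize a + r.eval (esize a) + 1) := by
        apply eval_mono
        have := (esize_le_of_mem (hb b (by simp))).trans (hr a)
        rw [esize_pair]; omega
      rw [List.foldl_cons, List.length_cons, add_mul]
      omega
  have h1 := key l' (fun b hb => hl'.subset hb) (s a)
  have h2 : l'.length ≤ r.eval (esize a) :=
    hl'.length_le.trans ((length_lt_esize _).le.trans (hr a))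
  simp only [eval_add, eval_mul, eval_comp, eval_X, eval_one]
  exact h1.trans (add_le_add (hp a) (Nat.mul_le_mul_right _ h2))

end PolyFun

/-! ### Polynomial-time operations on lists and numbers -/

namespace PolyFun

open Polynomial

variable {α β γ δ σ : Type} [Enc α] [Enc β] [Enc γ] [Enc δ] [Enc σ]

@[fun_prop]
theorem reverse {f : α → List β} (hf : PolyFun f) : PolyFun fun a => (f a).reverse := by
  have : PolyFun fun a => (f a).foldl (fun s b => b :: s) [] :=
    foldl (by fun_prop) (by fun_prop) hf (X + 1) fun a s b => by
      simp only [esize_cons, eval_add, eval_X, eval_one, esize_pair]; omega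
  have hfold : ∀ l s : List β, l.foldl (fun s b => b :: s) s = l.reverse ++ s := by
    intro l
    induction l with
    | nil => intro s; rfl
    | cons b l ih => intro s; rw [List.foldl_cons, ih]; simp
  simpa only [hfold, List.append_nil] using this

theorem foldr_of_size {f : α → β → σ → σ} {s : α → σ} {l : α → List β}
    (hf : PolyFun fun x : (α × σ) × β => f x.1.1 x.2 x.1.2) (hs : PolyFun s) (hl : PolyFun l)
    (q : Polynomial ℕ)
    (hq : ∀ a l', l' <:+ l a → esize (l'.foldr (f a) (s a)) ≤ q.eval (esize a)) :
    PolyFun fun a => (l a).foldr (f a) (s a) := by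
  have := foldl_of_size (f := fun a s b => f a b s) hf hs hl.reverse q fun a l' hl' => by
    rw [← List.reverse_reverse l', List.foldl_reverse]
    exact hq a _ (by rwa [← List.reverse_prefix, List.reverse_reverse])
  simpa using this

theorem foldr {f : α → β → σ → σ} {s : α → σ} {l : α → List β}
    (hf : PolyFun fun x : (α × σ) × β => f x.1.1 x.2 x.1.2) (hs : PolyFun s) (hl : PolyFun l)
    (q : Polynomial ℕ)
    (hq : ∀ a s b, esize (f a b s) ≤ esize s + q.eval (esize (a, b))) :
    PolyFun fun a => (l a).foldr (f a) (s a) := by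
  have := foldl (f := fun a s b => f a b s) hf hs hl.reverse q hq
  simpa using this

@[fun_prop]
theorem append {f g : α → List β} (hf : PolyFun f) (hg : PolyFun g) :
    PolyFun fun a => f a ++ g a := by
  have : PolyFun fun a => (f a).foldr (fun b s => b :: s) (g a) :=
    foldr (by fun_prop) hg hf (X + 1) fun a s b => by
      simp only [esize_cons, eval_add, eval_X, eval_one, esize_pair]; omega
  convert this using 2 with a
  induction f a with
  | nil => rfl
  | cons b l ih => simp [← ih]

theorem flatMap {f : α → β → List γ} {l : α → List β} (hf : PolyFun fun x : α × β => f x.1 x.2)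
    (hl : PolyFun l) : PolyFun fun a => (l a).flatMap (f a) := by
  obtain ⟨q, hq⟩ := hf.exists_esize_le
  have : PolyFun fun a => (l a).foldr (fun b s => f a b ++ s) [] := by
    refine foldr ?_ (by fun_prop) hl q fun a s b => ?_
    · exact (hf.comp (f := fun x : (α × List γ) × β => (x.1.1, x.2)) (by fun_prop)).append
        (by fun_prop)
    · have h1 := hq (a, b)
      have h2 := esize_append (f a b) s
      simp only at h1
      omega
  convert this using 2 with a
  induction l a with
  | nil => rfl
  | cons b l ih => simpa using ih

theorem map {f : α → β → γ} {l : α → List β} (hf : PolyFun fun x : α × β => f x.1 x.2)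
    (hl : PolyFun l) : PolyFun fun a => (l a).map (f a) := by
  have := flatMap (f := fun a b => [f a b]) (by fun_prop) hl
  simpa only [List.map_eq_flatMap] using this

theorem filter {p : α → β → Bool} {l : α → List β} (hp : PolyFun fun x : α × β => p x.1 x.2)
    (hl : PolyFun l) : PolyFun fun a => (l a).filter (p a) := by
  have := flatMap (f := fun a b => if p a b = true then [b] else [])
    (ite hp.decide_bool (by fun_prop) (by fun_prop)) hl
  convert this using 2 with a
  induction l a with
  | nil => rfl
  | cons b l ih => rw [List.filter_cons, List.flatMap_cons, ← ih]; split_ifs <;> rfl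

theorem enc_replicate (k : ℕ) : Enc.enc (List.replicate k false) = Enc.enc k := by
  induction k with
  | zero => rfl
  | succ k ih =>
    rw [List.replicate_succ]
    exact congrArg (Data.node Data.nil) ih

@[fun_prop]
theorem replicate {f : α → ℕ} (hf : PolyFun f) : PolyFun fun a => List.replicate (f a) false :=
  (of_enc_eq enc_replicate).comp hf

@[fun_prop]
theorem length {f : α → List β} (hf : PolyFun f) : PolyFun fun a => (f a).length := by
  obtain ⟨P, p, h⟩ := map (f := fun _ _ => false) (const (α := α × β) false) hf
  refine ⟨P, p, fun a => ?_⟩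
  obtain ⟨T, h1, h2⟩ := h a
  refine ⟨T, ?_, h2⟩
  have h3 : (f a).map (fun _ => false) = List.replicate (f a).length false := by simp
  rw [← enc_replicate, ← h3]
  exact h1

@[fun_prop]
theorem succ {f : α → ℕ} (hf : PolyFun f) : PolyFun fun a => f a + 1 := by
  have : PolyFun fun a => (false :: List.replicate (f a) false).length := by fun_prop
  simpa using this

@[fun_prop]
theorem drop {f : α → ℕ} {l : α → List β} (hf : PolyFun f) (hl : PolyFun l) :
    PolyFun fun a => (l a).drop (f a) := by
  have : PolyFun fun a => (List.replicate (f a) false).foldl (fun s _ => s.tail) (l a) :=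
    foldl (by fun_prop) hl (by fun_prop) 0 fun a s b => by
      simpa using esize_tail_le s
  convert this using 2 with a
  generalize l a = l
  induction f a generalizing l with
  | zero => rfl
  | succ k ih => rw [List.replicate_succ, List.foldl_cons, ← ih, List.drop_tail]

@[fun_prop]
theorem sub {f g : α → ℕ} (hf : PolyFun f) (hg : PolyFun g) : PolyFun fun a => f a - g a := by
  have : PolyFun fun a => ((List.replicate (f a) false).drop (g a)).length := by fun_prop
  simpa using this

@[fun_prop]
theorem take {f : α → ℕ} {l : α → List β} (hf : PolyFun f) (hl : PolyFun l) :
    PolyFun fun a => (l a).take (f a) := by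
  have : PolyFun fun a => ((l a).reverse.drop ((l a).length - f a)).reverse := by fun_prop
  convert this using 2 with a
  rw [List.reverse_drop, List.reverse_reverse, List.length_reverse]
  rcases le_total (f a) (l a).length with h | h
  · congr 1; omega
  · rw [List.take_of_length_le h, List.take_of_length_le (by omega)]

theorem decide_le {f g : α → ℕ} (hf : PolyFun f) (hg : PolyFun g)
    [∀ a, Decidable (f a ≤ g a)] : PolyFun fun a => decide (f a ≤ g a) := by
  have : PolyFun fun a => (List.replicate (f a - g a) false).isEmpty := by fun_prop
  convert this using 2 with a
  rw [Bool.eq_iff_iff]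
  simp [Nat.sub_eq_zero_iff_le]

theorem decide_eq {f g : α → ℕ} (hf : PolyFun f) (hg : PolyFun g)
    [∀ a, Decidable (f a = g a)] : PolyFun fun a => decide (f a = g a) := by
  have := (decide_le hf hg).and (decide_le hg hf)
  convert this using 2 with a
  rw [Bool.eq_iff_iff]
  simp [le_antisymm_iff]

theorem decide_eq_vtx {f g : α → Vtx} (hf : PolyFun f) (hg : PolyFun g)
    [∀ a, Decidable (f a = g a)] : PolyFun fun a => decide (f a = g a) := by
  have := (decide_eq hf.fst hg.fst).and (decide_eq hf.snd hg.snd)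
  convert this using 2 with a
  rw [Bool.eq_iff_iff]
  simp [Prod.ext_iff]

theorem range {f : α → ℕ} (hf : PolyFun f) : PolyFun fun a => List.range (f a) := by
  have hfold : ∀ l : List Bool, l.foldl (fun s _ => s ++ [s.length]) [] = List.range l.length := by
    intro l
    induction l using List.reverseRecOn with
    | nil => rfl
    | append_singleton l b ih => simp [List.foldl_append, ih, List.range_succ]
  obtain ⟨p, hp⟩ := hf.exists_esize_le
  have : PolyFun fun a => (List.replicate (f a) false).foldl (fun s _ => s ++ [s.length]) [] :=
    foldl_of_size (by fun_prop) (by fun_prop) (by fun_prop) (p * (2 * p + 2) + 1)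
      fun a l' hl' => by
        have h1 := hp a
        have h2 : l'.length ≤ f a := by simpa using hl'.length_le
        rw [esize_nat] at h1
        have h3 : ∀ i ∈ List.range l'.length, esize i ≤ 2 * p.eval (esize a) + 1 := by
          intro i hi
          rw [List.mem_range] at hi
          rw [esize_nat]
          omega
        have h4 := esize_le_of_forall_mem h3
        rw [hfold]
        simp only [eval_add, eval_mul, eval_ofNat, eval_one]
        refine h4.trans (Nat.add_le_add_right (Nat.mul_le_mul ?_ le_rfl) _)
        rw [List.length_range]
        omega
  convert this using 2 with a
  rw [hfold, List.length_replicate]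

theorem idxOf {f : α → Vtx} {l : α → List Vtx} (hf : PolyFun f) (hl : PolyFun l) :
    PolyFun fun a => (l a).idxOf (f a) := by
  have : PolyFun fun a => (l a).foldr (fun v i => if v = f a then 0 else i + 1) 0 := by
    refine foldr (ite (decide_eq_vtx (by fun_prop) (hf.comp (by fun_prop))) (by fun_prop)
      (by fun_prop)) (by fun_prop) hl 2 fun a s b => ?_
    simp only [eval_ofNat]
    split_ifs <;> simp only [esize_nat] <;> omega
  convert this using 2 with a
  induction l a with
  | nil => rfl
  | cons v l ih => rw [List.idxOf_cons, List.foldr_cons, ← ih]; simp [beq_iff_eq]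

/-! ### The operations on linear forms -/

theorem form_add {u w : α → Form} (hu : PolyFun u) (hw : PolyFun w) :
    PolyFun fun a => Form.add (u a) (w a) := by
  have hfold : ∀ (u w v : Form), (u.foldl (fun (s : Form × Form) b =>
      (Bool.xor b (s.2.headD false) :: s.1, s.2.tail)) (v, w)).1.reverse ++
      (u.foldl (fun (s : Form × Form) b =>
        (Bool.xor b (s.2.headD false) :: s.1, s.2.tail)) (v, w)).2 = v.reverse ++ Form.add u w := by
    intro u
    induction u with
    | nil => intro w v; rfl
    | cons b u ih => intro w v; rw [List.foldl_cons, ih]; simp [Form.add]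
  have : PolyFun fun a => (u a).foldl (fun (s : Form × Form) b =>
      (Bool.xor b (s.2.headD false) :: s.1, s.2.tail)) (([] : Form), w a) :=
    foldl (by fun_prop) (by fun_prop) hu 4 fun a s b => by
      have h1 := esize_bool_le (Bool.xor b (List.headD s.2 false))
      have h2 := esize_tail_le s.2
      obtain ⟨s1, s2⟩ := s
      simp only [esize_pair, esize_cons, eval_ofNat] at *
      omega
  have h2 := this.fst.reverse.append this.snd
  convert h2 using 2 with a
  rw [hfold]
  rfl

theorem form_coef {u w : α → Form} (hu : PolyFun u) (hw : PolyFun w) :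
    PolyFun fun a => Form.coef (u a) (w a) := by
  let step : Bool × Bool × Form → Bool → Bool × Bool × Form := fun s b =>
    if s.1 = true then s else if b = true then (true, s.2.2.headD false, [])
      else (false, false, s.2.2.tail)
  have htrue : ∀ (u : Form) (r : Bool) (w : Form), u.foldl step (true, r, w) = (true, r, w) := by
    intro u r w
    induction u with
    | nil => rfl
    | cons b u ih => rw [List.foldl_cons]; exact ih
  have hfold : ∀ (u w : Form), (u.foldl step (false, false, w)).2.1 = Form.coef u w := by
    intro u
    induction u with
    | nil => intro w; rfl
    | cons b u ih =>
      intro w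
      rw [List.foldl_cons]
      cases b with
      | true => exact congrArg (fun s => s.2.1) (htrue u (w.headD false) [])
      | false => exact ih w.tail
  have : PolyFun fun a => (u a).foldl step (false, false, w a) := by
    refine foldl (ite (decide_bool (by fun_prop)) (by fun_prop)
      (ite (decide_bool (by fun_prop)) (by fun_prop) (by fun_prop))) (by fun_prop) hu 8
      fun a s b => ?_
    obtain ⟨s1, s2, s3⟩ := s
    have h1 := esize_bool_le (List.headD s3 false)
    have h2 := esize_tail_le s3
    have h3 := one_le_esize s1
    have h4 := one_le_esize s2
    have h5 := one_le_esize s3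
    have h6 := esize_bool_le true
    have h7 := esize_bool_le false
    simp only [eval_ofNat, step]
    split_ifs <;> simp only [esize_pair, esize_nil] at * <;> omega
  have h2 := this.snd.fst
  simpa only [hfold] using h2

theorem form_pivot {u w : α → Form} (hu : PolyFun u) (hw : PolyFun w) :
    PolyFun fun a => Form.pivot (u a) (w a) :=
  ite (form_coef hu hw).decide_bool (form_add hu hw) hw

theorem form_var {r : α → ℕ} (hr : PolyFun r) : PolyFun fun a => Form.var (r a) := by
  unfold Form.var
  fun_prop

attribute [fun_prop] form_add form_coef form_pivot form_var range idxOf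

end PolyFun

/-! ### The running time of the symbolic run -/

theorem mem_setAt {α : Type} {l : List α} {i : ℕ} {x y : α} (h : y ∈ setAt l i x) :
    y = x ∨ y ∈ l := by
  simp only [setAt, List.mem_append, List.mem_cons] at h
  rcases h with h | h | h
  · exact Or.inr (List.mem_of_mem_take h)
  · exact Or.inl h
  · exact Or.inr (List.mem_of_mem_drop h)

theorem length_setAt_le {α : Type} (l : List α) (i : ℕ) (x : α) :
    (setAt l i x).length ≤ l.length + 1 := by
  simp [setAt]; omega

theorem mem_delAt {α : Type} {l : List α} {i : ℕ} {y : α} (h : y ∈ delAt l i) : y ∈ l := by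
  simp only [delAt, List.mem_append] at h
  rcases h with h | h
  · exact List.mem_of_mem_take h
  · exact List.mem_of_mem_drop h

theorem length_delAt_le {α : Type} (l : List α) (i : ℕ) : (delAt l i).length ≤ l.length := by
  simp [delAt]; omega

theorem esize_form_le (w : Form) : esize w ≤ 4 * w.length + 1 := by
  have := esize_le_of_forall_mem (l := w) (B := 3) fun b _ => esize_bool_le b
  omega

/-- All parts of the symbolic state have a size that is linear in `N`. -/
structure Small (N : ℕ) (st : SymState) : Prop where
  live : st.1.length ≤ 2 * N
  edges : st.2.1.length ≤ 3 * N
  verts : st.2.2.1.length ≤ 2 * N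
  cnots : st.2.2.2.1 ≤ N
  preps : st.2.2.2.2 ≤ N
  live_mem : ∀ l ∈ st.1, (l.1.1 ≤ 3 ∧ l.1.2 ≤ N) ∧ l.2.length ≤ N
  edges_mem : ∀ e ∈ st.2.1,
    ((e.1.1.1 ≤ 3 ∧ e.1.1.2 ≤ N) ∧ (e.1.2.1 ≤ 3 ∧ e.1.2.2 ≤ N)) ∧ e.2.length ≤ N
  verts_mem : ∀ v ∈ st.2.2.1, v.1 ≤ 3 ∧ v.2 ≤ N

namespace Small

theorem succ {N : ℕ} {st : SymState} (h : Small N st) : Small (N + 1) st where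
  live := by have := h.live; omega
  edges := by have := h.edges; omega
  verts := by have := h.verts; omega
  cnots := by have := h.cnots; omega
  preps := by have := h.preps; omega
  live_mem l hl := by have := h.live_mem l hl; omega
  edges_mem l hl := by have := h.edges_mem l hl; omega
  verts_mem l hl := by have := h.verts_mem l hl; omega

theorem getAt {N : ℕ} {st : SymState} (h : Small N st) (i : ℕ) :
    ((getAt st.1 i).1.1 ≤ 3 ∧ (CatPrep.getAt st.1 i).1.2 ≤ N) ∧
      (CatPrep.getAt st.1 i).2.length ≤ N := by
  rw [CatPrep.getAt]
  rcases hd : st.1.drop i with _ | ⟨a, l⟩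
  · simp
  · exact h.live_mem a (List.mem_of_mem_drop (i := i) (by rw [hd]; simp))

theorem prepStep {N : ℕ} {st : SymState} (h : Small N st) {f : Form} (hf : f.length ≤ N + 1) :
    Small (N + 1) (prepStep st f) where
  live := by have := h.live; simp [CatPrep.prepStep]; omega
  edges := by have := h.edges; simp [CatPrep.prepStep]; omega
  verts := by have := h.verts; simp [CatPrep.prepStep]; omega
  cnots := h.succ.cnots
  preps := by have := h.preps; simp [CatPrep.prepStep]; omega
  live_mem l hl := by
    have := h.preps
    simp only [CatPrep.prepStep, List.mem_append, List.mem_singleton] at hl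
    rcases hl with hl | rfl
    · exact h.succ.live_mem l hl
    · exact ⟨⟨le_rfl, by simp only; omega⟩, hf⟩
  edges_mem := h.succ.edges_mem
  verts_mem v hv := by
    have := h.preps
    simp only [CatPrep.prepStep, List.mem_cons] at hv
    rcases hv with rfl | hv
    · exact ⟨le_rfl, by simp only; omega⟩
    · exact h.succ.verts_mem v hv

theorem cnotStep {N : ℕ} {st : SymState} (h : Small N st) (i j : ℕ) :
    Small (N + 1) (cnotStep st i j) where
  live := by
    have h1 := h.live
    have h2 := length_setAt_le st.1 i ((0, st.2.2.2.1), (CatPrep.getAt st.1 i).2)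
    have h3 := length_setAt_le (setAt st.1 i ((0, st.2.2.2.1), (CatPrep.getAt st.1 i).2)) j
      ((2, st.2.2.2.1), Form.add (CatPrep.getAt st.1 i).2 (CatPrep.getAt st.1 j).2)
    simp only [CatPrep.cnotStep]
    omega
  edges := by have := h.edges; simp [CatPrep.cnotStep]; omega
  verts := by have := h.verts; simp [CatPrep.cnotStep]; omega
  cnots := by have := h.cnots; simp [CatPrep.cnotStep]; omega
  preps := h.succ.preps
  live_mem l hl := by
    have h1 := h.cnots
    have h2 := h.getAt i
    have h3 := h.getAt j
    rcases mem_setAt hl with rfl | hl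
    · simp only [Form.length_add]; omega
    rcases mem_setAt hl with rfl | hl
    · simp only; omega
    · exact h.succ.live_mem l hl
  edges_mem e he := by
    have h1 := h.cnots
    have h2 := h.getAt i
    have h3 := h.getAt j
    simp only [CatPrep.cnotStep, List.mem_cons] at he
    rcases he with rfl | rfl | rfl | he
    · simp only; omega
    · simp only; omega
    · simp only; omega
    · exact h.succ.edges_mem e he
  verts_mem v hv := by
    have h1 := h.cnots
    simp only [CatPrep.cnotStep, List.mem_cons] at hv
    rcases hv with rfl | rfl | hv
    · simp only; omega
    · simp only; omega
    · exact h.succ.verts_mem v hv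

theorem measZStep {N : ℕ} {st : SymState} (h : Small N st) (q : ℕ) : Small N (measZStep st q) where
  live := by
    have h1 := h.live
    have h2 := length_delAt_le st.1 q
    simp only [CatPrep.measZStep, List.length_map]
    omega
  edges := by simpa [CatPrep.measZStep] using h.edges
  verts := h.verts
  cnots := h.cnots
  preps := h.preps
  live_mem l hl := by
    obtain ⟨l, hl', rfl⟩ := List.mem_map.1 hl
    have h1 := h.live_mem l (mem_delAt hl')
    exact ⟨h1.1, (Form.length_pivot_le _ _).trans (max_le (h.getAt q).2 h1.2)⟩
  edges_mem e he := by
    obtain ⟨e, he', rfl⟩ := List.mem_map.1 he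
    have h1 := h.edges_mem e he'
    exact ⟨h1.1, (Form.length_pivot_le _ _).trans (max_le (h.getAt q).2 h1.2)⟩
  verts_mem := h.verts_mem

theorem opStep {N : ℕ} {st : SymState} (h : Small N st) (op : Op) :
    Small (N + 1) (opStep st op) := by
  unfold CatPrep.opStep
  split_ifs
  · exact h.prepStep (by simp)
  · exact h.prepStep (by rw [Form.length_var]; exact Nat.succ_le_succ h.preps)
  · exact h.cnotStep _ _
  · exact (h.measZStep _).succ
  · exact { h.succ with
      live := (length_delAt_le _ _).trans h.succ.live
      live_mem := fun l hl => h.succ.live_mem l (mem_delAt hl) }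
  · exact h.succ

theorem symRun (ops : List Op) : Small ops.length (symRun ops) := by
  induction ops with
  | nil => constructor <;> simp [CatPrep.symRun]
  | cons op ops ih => exact ih.opStep op

theorem esize_le {N : ℕ} {st : SymState} (h : Small N st) :
    esize st ≤ 7 * N * (8 * N + 26) + 4 * N + 10 := by
  have h1 : esize st.1 ≤ 2 * N * (8 * N + 26) + 1 := by
    refine (esize_le_of_forall_mem (B := 8 * N + 25) fun l hl => ?_).trans
      (Nat.add_le_add_right (Nat.mul_le_mul_right _ h.live) _)
    have := h.live_mem l hl
    have := esize_form_le l.2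
    obtain ⟨⟨a, b⟩, w⟩ := l
    simp only [esize_pair, esize_nat] at *
    omega
  have h2 : esize st.2.1 ≤ 3 * N * (8 * N + 26) + 1 := by
    refine (esize_le_of_forall_mem (B := 8 * N + 25) fun l hl => ?_).trans
      (Nat.add_le_add_right (Nat.mul_le_mul_right _ h.edges) _)
    have := h.edges_mem l hl
    have := esize_form_le l.2
    obtain ⟨⟨⟨a, b⟩, c, d⟩, w⟩ := l
    simp only [esize_pair, esize_nat] at *
    omega
  have h3 : esize st.2.2.1 ≤ 2 * N * (8 * N + 26) + 1 := by
    refine (esize_le_of_forall_mem (B := 8 * N + 25) fun l hl => ?_).trans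
      (Nat.add_le_add_right (Nat.mul_le_mul_right _ h.verts) _)
    have := h.verts_mem l hl
    obtain ⟨a, b⟩ := l
    simp only [esize_pair, esize_nat] at *
    omega
  have h4 := h.cnots
  have h5 := h.preps
  obtain ⟨a, b, c, d, e⟩ := st
  simp only [esize_pair, esize_nat] at *
  generalize 8 * N + 26 = M at *
  have : 7 * N * M = 2 * N * M + 3 * N * M + 2 * N * M := by ring
  omega

end Small

namespace PolyFun

open Polynomial

variable {α β : Type} [Enc α] [Enc β]

@[fun_prop]
theorem setAt {l : α → List β} {i : α → ℕ} {x : α → β} (hl : PolyFun l) (hi : PolyFun i)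
    (hx : PolyFun x) : PolyFun fun a => setAt (l a) (i a) (x a) := by
  unfold CatPrep.setAt
  fun_prop

@[fun_prop]
theorem delAt {l : α → List β} {i : α → ℕ} (hl : PolyFun l) (hi : PolyFun i) :
    PolyFun fun a => delAt (l a) (i a) := by
  unfold CatPrep.delAt
  fun_prop

@[fun_prop]
theorem getAt {l : α → List (Vtx × Form)} {i : α → ℕ} (hl : PolyFun l) (hi : PolyFun i) :
    PolyFun fun a => getAt (l a) (i a) := by
  unfold CatPrep.getAt
  fun_prop

@[fun_prop]
theorem prepStep {st : α → SymState} {f : α → Form} (hst : PolyFun st) (hf : PolyFun f) :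
    PolyFun fun a => prepStep (st a) (f a) := by
  unfold CatPrep.prepStep
  fun_prop

@[fun_prop]
theorem cnotStep {st : α → SymState} {i j : α → ℕ} (hst : PolyFun st) (hi : PolyFun i)
    (hj : PolyFun j) : PolyFun fun a => cnotStep (st a) (i a) (j a) := by
  unfold CatPrep.cnotStep
  fun_prop

@[fun_prop]
theorem measZStep {st : α → SymState} {q : α → ℕ} (hst : PolyFun st) (hq : PolyFun q) :
    PolyFun fun a => measZStep (st a) (q a) := by
  unfold CatPrep.measZStep
  have h1 : PolyFun fun a => (CatPrep.delAt (st a).1 (q a)).map fun l =>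
      (l.1, Form.pivot (CatPrep.getAt (st a).1 (q a)).2 l.2) := map (by fun_prop) (by fun_prop)
  have h2 : PolyFun fun a => (st a).2.1.map fun e =>
      (e.1, Form.pivot (CatPrep.getAt (st a).1 (q a)).2 e.2) := map (by fun_prop) (by fun_prop)
  fun_prop

theorem opStep {st : α → SymState} {op : α → Op} (hst : PolyFun st) (hop : PolyFun op) :
    PolyFun fun a => opStep (st a) (op a) := by
  have h (k : ℕ) : PolyFun fun a => decide ((op a).1 = k) := decide_eq (by fun_prop) (by fun_prop)
  unfold CatPrep.opStep
  exact ite (h 0) (by fun_prop) (ite (h 1) (by fun_prop) (ite (h 2) (by fun_prop)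
    (ite (h 3) (by fun_prop) (ite (h 4) (by fun_prop) hst))))

theorem symRun : PolyFun symRun := by
  refine foldr_of_size (opStep (by fun_prop) (by fun_prop)) (by fun_prop) PolyFun.id
    (7 * X * (8 * X + 26) + 4 * X + 10) fun ops ops' h => ?_
  have h1 := (Small.symRun ops').esize_le
  have h2 : ops'.length ≤ esize ops := h.length_le.trans (length_lt_esize _).le
  simp only [eval_add, eval_mul, eval_X, eval_ofNat]
  refine h1.trans ?_
  gcongr

/-! ### The running time of the elimination -/

theorem nbrs {v : α → Vtx} {es : α → List (Vtx × Vtx)} (hv : PolyFun v) (hes : PolyFun es) :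
    PolyFun fun a => nbrs (v a) (es a) := by
  unfold CatPrep.nbrs
  have h1 : PolyFun fun x : α × (Vtx × Vtx) => decide (x.2.1 = v x.1) :=
    decide_eq_vtx (by fun_prop) (by fun_prop)
  have h2 : PolyFun fun x : α × (Vtx × Vtx) => decide (x.2.2 = v x.1) :=
    decide_eq_vtx (by fun_prop) (by fun_prop)
  exact flatMap (ite h1 (ite h2 (by fun_prop) (by fun_prop)) (ite h2 (by fun_prop) (by fun_prop)))
    hes

theorem away {v : α → Vtx} {es : α → List (Vtx × Vtx)} (hv : PolyFun v) (hes : PolyFun es) :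
    PolyFun fun a => away (v a) (es a) := by
  unfold CatPrep.away
  have h1 : PolyFun fun x : α × (Vtx × Vtx) => decide (x.2.1 = v x.1) :=
    decide_eq_vtx (by fun_prop) (by fun_prop)
  have h2 : PolyFun fun x : α × (Vtx × Vtx) => decide (x.2.2 = v x.1) :=
    decide_eq_vtx (by fun_prop) (by fun_prop)
  exact filter (h1.or h2).not hes

attribute [fun_prop] nbrs away

theorem elim {v : α → Vtx} {es : α → List (Vtx × Vtx)} (hv : PolyFun v) (hes : PolyFun es) :
    PolyFun fun a => elim (v a) (es a) := by
  unfold CatPrep.elim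
  exact ite (decide_eq (by fun_prop) (by fun_prop)) (by fun_prop) (by fun_prop)

theorem deg {v : α → Vtx} {es : α → List (Vtx × Vtx)} (hv : PolyFun v) (hes : PolyFun es) :
    PolyFun fun a => deg (v a) (es a) := by
  have h1 : PolyFun fun x : α × (Vtx × Vtx) => decide (x.2.1 = v x.1) :=
    decide_eq_vtx (by fun_prop) (by fun_prop)
  have h2 : PolyFun fun x : α × (Vtx × Vtx) => decide (x.2.2 = v x.1) :=
    decide_eq_vtx (by fun_prop) (by fun_prop)
  have : PolyFun fun a => ((es a).flatMap fun e =>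
      (if e.1 = v a then [false] else []) ++ if e.2 = v a then [false] else []).length :=
    length (flatMap (append (ite h1 (by fun_prop) (by fun_prop))
      (ite h2 (by fun_prop) (by fun_prop))) hes)
  convert this using 2 with a
  rw [CatPrep.deg, edgeSum, List.length_flatMap]
  congr 1
  refine List.map_congr_left fun e _ => ?_
  split_ifs <;> simp

attribute [fun_prop] elim deg

theorem elimStep {st : α → List Vtx × List (Vtx × Vtx)} (hst : PolyFun st) :
    PolyFun fun a => elimStep (st a) := by
  have h1 : PolyFun fun a => (st a).1.filter fun v => decide (CatPrep.deg v (st a).2 ≤ 2) :=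
    filter (decide_le (by fun_prop) (by fun_prop)) (by fun_prop)
  have h2 : PolyFun fun a => (st a).1.filter fun v => !decide (v =
      ((st a).1.filter fun v => decide (CatPrep.deg v (st a).2 ≤ 2)).headD (0, 0)) :=
    filter (not (decide_eq_vtx (by fun_prop) ((h1.headD (0, 0)).comp fst'))) (by fun_prop)
  unfold CatPrep.elimStep
  exact ite (decide_bool (by fun_prop)) (by fun_prop) (by fun_prop)

end PolyFun

theorem length_nbrs_add_away_le (v : Vtx) (es : List (Vtx × Vtx)) :
    (nbrs v es).length + (away v es).length ≤ es.length := by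
  induction es with
  | nil => simp [nbrs, away]
  | cons e es ih =>
    have h3 : nbrs v (e :: es) = (if e.1 = v then (if e.2 = v then [] else [e.2]) else
      if e.2 = v then [e.1] else []) ++ nbrs v es := List.flatMap_cons
    have h4 : away v (e :: es) = if e.1 = v ∨ e.2 = v then away v es else e :: away v es := by
      rw [away, List.filter_cons, ← away]
      by_cases h1 : e.1 = v <;> by_cases h2 : e.2 = v <;> simp [h1, h2]
    rw [h3, h4, List.length_append, List.length_cons]
    by_cases h1 : e.1 = v <;> by_cases h2 : e.2 = v <;> simp [h1, h2] <;> omega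

/-- The elimination does not increase the numbers of vertices and edges, and creates no vertices. -/
theorem elimStep_bounds {P : Vtx → Prop} {N M : ℕ} {st : List Vtx × List (Vtx × Vtx)}
    (h : (st.1.length ≤ N ∧ ∀ v ∈ st.1, P v) ∧ st.2.length ≤ M ∧ ∀ e ∈ st.2, P e.1 ∧ P e.2) :
    ((elimStep st).1.length ≤ N ∧ ∀ v ∈ (elimStep st).1, P v) ∧
      (elimStep st).2.length ≤ M ∧ ∀ e ∈ (elimStep st).2, P e.1 ∧ P e.2 := by
  rcases elimStep_cases st with ⟨h1, -⟩ | ⟨v, hv, -, h1⟩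
  · rwa [h1]
  · rw [h1]
    obtain ⟨⟨h2, h3⟩, h4, h5⟩ := h
    have hlen := length_nbrs_add_away_le v st.2
    refine ⟨⟨(List.length_filter_le _ _).trans h2, fun w hw => h3 w (List.mem_filter.1 hw).1⟩, ?_⟩
    rcases elim_eq v st.2 with ⟨-, h6⟩ | ⟨a, b, h6, h7⟩
    · simp only [h6]
      exact ⟨by omega, fun e he => h5 e (mem_away.1 he).1⟩
    · simp only [h7]
      rw [h6] at hlen
      simp only [List.length_cons, List.length_nil] at hlen
      have hnb : ∀ c ∈ nbrs v st.2, P c := by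
        intro c hc
        rcases (mem_nbrs.1 hc).2 with h | h
        · exact (h5 _ h).2
        · exact (h5 _ h).1
      refine ⟨by simp only [List.length_cons]; omega, fun e he => ?_⟩
      rcases List.mem_cons.1 he with rfl | he
      · exact ⟨hnb _ (by simp [h6]), hnb _ (by simp [h6])⟩
      · exact h5 e (mem_away.1 he).1

namespace PolyFun

open Polynomial

theorem reduce : PolyFun reduce := by
  refine foldl_of_size (elimStep (by fun_prop)) PolyFun.id (by fun_prop)
    (X * (X + 1) + X * (2 * X + 2) + 3) fun st l' _ => ?_
  have key : ∀ (l' : List Vtx) (s : List Vtx × List (Vtx × Vtx)),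
      ((s.1.length ≤ esize st ∧ ∀ v ∈ s.1, esize v ≤ esize st) ∧ s.2.length ≤ esize st ∧
        ∀ e ∈ s.2, esize e.1 ≤ esize st ∧ esize e.2 ≤ esize st) →
      esize (l'.foldl (fun s _ => CatPrep.elimStep s) s) ≤
        esize st * (esize st + 1) + esize st * (2 * esize st + 2) + 3 := by
    intro l'
    induction l' with
    | nil =>
      intro s ⟨⟨h1, h2⟩, h3, h4⟩
      have h5 := (esize_le_of_forall_mem h2).trans
        (Nat.add_le_add_right (Nat.mul_le_mul_right _ h1) _)
      have h6 : esize s.2 ≤ esize st * (2 * esize st + 2) + 1 := by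
        refine (esize_le_of_forall_mem (B := 2 * esize st + 1) fun e he => ?_).trans
          (Nat.add_le_add_right (Nat.mul_le_mul_right _ h3) _)
        have := h4 e he
        obtain ⟨a, b⟩ := e
        simp only [esize_pair a b] at *
        omega
      obtain ⟨s1, s2⟩ := s
      rw [List.foldl_nil, esize_pair]
      simp only at h5 h6
      omega
    | cons v l' ih => intro s hs; exact ih _ (elimStep_bounds hs)
  have h1 : esize st.1 ≤ esize st := by obtain ⟨a, b⟩ := st; simp only [esize_pair a b]; omega
  have h2 : esize st.2 ≤ esize st := by obtain ⟨a, b⟩ := st; simp only [esize_pair a b]; omega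
  simp only [eval_add, eval_mul, eval_X, eval_ofNat, eval_one]
  refine key l' st ⟨⟨(length_lt_esize _).le.trans h1, fun v hv => (esize_le_of_mem hv).trans h1⟩,
    (length_lt_esize _).le.trans h2, fun e he => ?_⟩
  have h3 := (esize_le_of_mem he).trans h2
  obtain ⟨a, b⟩ := e
  simp only [esize_pair a b] at *
  omega

theorem graphEdges : PolyFun graphEdges := by
  have h1 : PolyFun fun st : SymState => (List.range st.1.length).map fun i =>
      ((CatPrep.getAt st.1 i).1, ((1, i) : Vtx)) := map (by fun_prop) (by fun_prop)
  have h2 : PolyFun fun st : SymState => (st.2.1.filter fun e =>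
      Form.coef (CatPrep.getAt st.1 0).2 e.2).map fun e => e.1 :=
    map (by fun_prop) (filter (by fun_prop) (by fun_prop))
  have := h1.append h2
  convert this using 2 with st
  rw [CatPrep.graphEdges]
  congr 1
  apply List.ext_getElem
  · simp
  · intro k h1 h2
    have hk : k < st.1.length := by simpa using h1
    simp [CatPrep.getAt, List.getElem?_eq_getElem hk]

end PolyFun

/-! ### The algorithm -/

/-- The vertices and edges of the graph that is computed from a list of operations. -/
def finalGraph (ops : List Op) : List Vtx × List (Vtx × Vtx) :=
  reduce ((symRun ops).2.2.1, graphEdges (symRun ops))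

/-- The code of an end of an edge of the resulting diagram: an output, or a spider by its position
in the list of the vertices. -/
def endLabel (vs : List Vtx) (a : Vtx) : ℕ × ℕ := if a.1 = 1 then a else (0, vs.idxOf a)

/-- The resulting diagram as a list of colours and a list of edges. -/
def outputLists (g : List Vtx × List (Vtx × Vtx)) : List ℕ × List ((ℕ × ℕ) × (ℕ × ℕ)) :=
  (g.1.map fun _ => 0, g.2.map fun e => (endLabel g.1 e.1, endLabel g.1 e.2))

namespace PolyFun

theorem finalGraph : PolyFun finalGraph :=
  PolyFun.reduce.comp (symRun.snd.snd.fst.prodMk (graphEdges.comp symRun))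

theorem endLabel {α : Type} [Enc α] {vs : α → List Vtx} {v : α → Vtx} (hvs : PolyFun vs)
    (hv : PolyFun v) : PolyFun fun a => endLabel (vs a) (v a) :=
  ite (decide_eq (by fun_prop) (by fun_prop)) hv (by fun_prop)

theorem outputLists : PolyFun outputLists :=
  prodMk (map (by fun_prop) (by fun_prop))
    (map (prodMk (endLabel (by fun_prop) (by fun_prop)) (endLabel (by fun_prop) (by fun_prop)))
      (by fun_prop))

end PolyFun

/-! ### The diagram of a multigraph -/

/-- The vertex at an end of an edge. -/
def halfEnd (es : List (Vtx × Vtx)) (h : Fin es.length × Bool) : Vtx :=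
  if h.2 then es[h.1].2 else es[h.1].1

theorem edgeSum_eq_sum (g : Vtx → Vtx → ℕ) (es : List (Vtx × Vtx)) :
    edgeSum g es = ∑ e : Fin es.length, g (halfEnd es (e, false)) (halfEnd es (e, true)) := by
  rw [edgeSum, ← Fin.sum_univ_fun_getElem]
  rfl

theorem deg_eq_card (v : Vtx) (es : List (Vtx × Vtx)) :
    deg v es = (Finset.univ.filter fun h => halfEnd es h = v).card := by
  rw [deg, edgeSum_eq_sum, Finset.card_filter, Fintype.sum_prod_type]
  refine Finset.sum_congr rfl fun e _ => ?_
  rw [Fintype.sum_bool, add_comm]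

/-- The vertices `vs` as spiders and the pairs `(1, i)` as outputs. -/
def toEnd (n : ℕ) (vs : List Vtx) (a : Vtx) (h : a ∈ vs ∨ a.1 = 1 ∧ a.2 < n) :
    Fin vs.length ⊕ Fin n :=
  if h' : a.1 = 1 ∧ a.2 < n then Sum.inr ⟨a.2, h'.2⟩
  else Sum.inl ⟨vs.idxOf a, List.idxOf_lt_length_of_mem (h.resolve_right h')⟩

theorem toEnd_eq_inr {n : ℕ} {vs : List Vtx} {a : Vtx} (h : a ∈ vs ∨ a.1 = 1 ∧ a.2 < n)
    (i : Fin n) : toEnd n vs a h = Sum.inr i ↔ a = (1, (i : ℕ)) := by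
  unfold toEnd
  split_ifs with h'
  · simp [Fin.ext_iff, Prod.ext_iff, h'.1]
  · refine ⟨fun h => by simp at h, fun h => absurd ?_ h'⟩
    subst h
    exact ⟨rfl, i.2⟩

theorem toEnd_eq_inl {n : ℕ} {vs : List Vtx} (htag : ∀ v ∈ vs, v.1 ≠ 1) (hnd : vs.Nodup) {a : Vtx}
    (h : a ∈ vs ∨ a.1 = 1 ∧ a.2 < n) (v : Fin vs.length) :
    toEnd n vs a h = Sum.inl v ↔ a = vs[v] := by
  unfold toEnd
  split_ifs with h'
  · refine ⟨fun h => by simp at h, fun h => absurd h'.1 ?_⟩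
    subst h
    exact htag _ (List.getElem_mem _)
  · have ha := h.resolve_right h'
    rw [Sum.inl.injEq, Fin.ext_iff]
    constructor
    · intro hv
      simp only at hv
      simp [← hv]
    · rintro rfl
      exact hnd.idxOf_getElem _ _

namespace Good

variable {n k t : ℕ} {D : ZXDiagram n} {vs : List Vtx} {es : List (Vtx × Vtx)}

theorem halfEnd_mem (h : Good D k vs es) (e : Fin es.length × Bool) :
    halfEnd es e ∈ vs ∨ (halfEnd es e).1 = 1 ∧ (halfEnd es e).2 < n := by
  have := h.ends es[e.1] (List.getElem_mem _)
  unfold halfEnd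
  split_ifs
  · exact this.2
  · exact this.1

/-- The multigraph as a ZX-diagram with `Z`-spiders only. -/
def toDiagram (h : Good D k vs es) : ZXDiagram n where
  V := Fin vs.length
  E := Fin es.length
  color _ := Color.Z
  endpt e s := toEnd n vs (halfEnd es (e, s)) (h.halfEnd_mem (e, s))
  output_degree_one i := by
    have h1 := h.out i i.2
    rw [deg_eq_card, Finset.card_eq_one] at h1
    obtain ⟨x, hx⟩ := h1
    simp only [Finset.ext_iff, Finset.mem_filter, Finset.mem_univ, true_and,
      Finset.mem_singleton] at hx
    refine ⟨x, (toEnd_eq_inr _ _).2 ((hx x).2 rfl), fun y hy => ?_⟩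
    exact (hx y).1 ((toEnd_eq_inr (h.halfEnd_mem y) _).1 hy)

theorem mem_legs_inl (h : Good D k vs es) (v : Fin vs.length) (e : Fin es.length × Bool) :
    e ∈ h.toDiagram.legs (Sum.inl v) ↔ halfEnd es e = vs[v] :=
  (ZXDiagram.mem_legs _ _ _).trans (toEnd_eq_inl h.tag h.nodup (h.halfEnd_mem e) v)

theorem mem_legs_inr (h : Good D k vs es) (i : Fin n) (e : Fin es.length × Bool) :
    e ∈ h.toDiagram.legs (Sum.inr i) ↔ halfEnd es e = (1, (i : ℕ)) :=
  (ZXDiagram.mem_legs _ _ _).trans (toEnd_eq_inr (h.halfEnd_mem e) i)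

theorem card_legs (h : Good D k vs es) (v : Fin vs.length) :
    (h.toDiagram.legs (Sum.inl v)).card = deg vs[v] es := by
  rw [deg_eq_card]
  have : ∀ s s' : Finset (Fin es.length × Bool), (∀ e, e ∈ s ↔ e ∈ s') → s.card = s'.card :=
    fun s s' h => congrArg Finset.card (Finset.ext h)
  refine this _ _ fun e => (h.mem_legs_inl v e).trans ?_
  rw [Finset.mem_filter, and_iff_right (Finset.mem_univ _)]

theorem isZGraph (h : Good D k vs es) (h3 : ∀ v ∈ vs, deg v es = 3) : h.toDiagram.IsZGraph :=
  fun v => ⟨rfl, (h.card_legs v).trans (h3 _ (List.get_mem _ _))⟩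

theorem reach_of_toDiagram (h : Good D k vs es) {w : ℕ} {b : Fin n → ZMod 2}
    (hr : h.toDiagram.Reach w b) : D.Reach w b := by
  classical
  obtain ⟨x, hx, hm⟩ := hr
  let x' : Fin es.length × Bool → ZMod 2 := x
  have hx1 : ∀ (v : Fin vs.length) (e e' : Fin es.length × Bool), halfEnd es e = vs[v] →
      halfEnd es e' = vs[v] → x' e = x' e' := fun v e e' he he' =>
    hx.1 v e ((h.mem_legs_inl v e).2 he) e' ((h.mem_legs_inl v e').2 he')
  have hx2 : ∀ (i : Fin n) (e : Fin es.length × Bool), halfEnd es e = (1, (i : ℕ)) →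
      x' e = b i := fun i e he => hx.2 i e ((h.mem_legs_inr i e).2 he)
  have hconst : ∀ e e', halfEnd es e = halfEnd es e' → x' e = x' e' := by
    intro e e' hee
    rcases h.halfEnd_mem e with hv | ⟨h1, h2⟩
    · obtain ⟨v, hv, he⟩ := List.getElem_of_mem hv
      exact hx1 ⟨v, hv⟩ e e' he.symm (hee.symm.trans he.symm)
    · have he : halfEnd es e = (1, ((⟨_, h2⟩ : Fin n) : ℕ)) := Prod.ext h1 rfl
      rw [hx2 _ e he, hx2 _ e' (hee.symm.trans he)]
  let y : Vtx → ZMod 2 := fun a => if ha : ∃ e, halfEnd es e = a then x' ha.choose else 0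
  have hy : ∀ e, y (halfEnd es e) = x' e := by
    intro e
    have ha : ∃ e', halfEnd es e' = halfEnd es e := ⟨e, rfl⟩
    simp only [y, dif_pos ha]
    exact hconst _ _ ha.choose_spec
  have h1 := h.reach y
  have h2 : (fun q : Fin n => y (1, (q : ℕ))) = b := by
    funext i
    have hd := h.out i i.2
    rw [deg_eq_card, Finset.card_eq_one] at hd
    obtain ⟨e, he⟩ := hd
    have he : halfEnd es e = (1, (i : ℕ)) := by
      have : e ∈ Finset.univ.filter fun e => halfEnd es e = (1, (i : ℕ)) := by rw [he]; simp
      simpa using this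
    rw [← he, hy, hx2 i e he]
  rw [h2] at h1
  refine h1.mono (le_trans (le_of_eq ?_) hm)
  rw [cutSize, edgeSum_eq_sum]
  refine Finset.sum_congr rfl fun e _ => ?_
  rw [hy, hy]
  change _ = if x' (e, true) = x' (e, false) then 0 else 1
  simp only [eq_comm]

theorem catFlips_toDiagram (h : Good D k vs es) (hD : D.CatFlips t) : h.toDiagram.CatFlips t :=
  ⟨⟨fun _ => 1, ⟨fun _ _ _ _ _ => rfl, fun _ _ _ => rfl⟩, by simp [ZXDiagram.mism]⟩,
    fun w hw b hb => hD.2 w hw b (h.reach_of_toDiagram hb)⟩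

theorem code_toDiagram (h : Good D k vs es) :
    h.toDiagram.code (Equiv.refl (Fin vs.length)) (Equiv.refl (Fin es.length)) =
      Enc.enc (outputLists (vs, es)) := by
  have hinl : ∀ (a : Vtx) (ha : a ∈ vs ∨ a.1 = 1 ∧ a.2 < n) (v : Fin vs.length),
      toEnd n vs a ha = Sum.inl v →
        Data.node (Data.ofNat 0) (Data.ofNat v) = Enc.enc (endLabel vs a) := by
    intro a ha v hv
    rw [toEnd_eq_inl h.tag h.nodup] at hv
    have htag : vs[v].1 ≠ 1 := h.tag _ (List.getElem_mem _)
    subst hv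
    rw [endLabel, if_neg htag]
    refine congrArg (fun i => Data.node (Data.ofNat 0) (Data.ofNat i)) ?_
    exact (h.nodup.idxOf_getElem _ _).symm
  have hinr : ∀ (a : Vtx) (ha : a ∈ vs ∨ a.1 = 1 ∧ a.2 < n) (i : Fin n),
      toEnd n vs a ha = Sum.inr i →
        Data.node (Data.ofNat 1) (Data.ofNat i) = Enc.enc (endLabel vs a) := by
    intro a ha i hi
    rw [toEnd_eq_inr] at hi
    subst hi
    rfl
  refine congrArg₂ Data.node (congrArg Data.ofList ?_) (congrArg Data.ofList ?_)
  · apply List.ext_getElem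
    · simp [outputLists]
    · intro i h1 h2
      simp [outputLists]
      rfl
  · apply List.ext_getElem
    · simp [outputLists]
    · intro i h1 h2
      simp only [outputLists, List.getElem_ofFn, List.getElem_map]
      have hi : i < es.length := by simpa [outputLists] using h2
      refine congrArg₂ Data.node ?_ ?_
      · have h3 := h.halfEnd_mem (⟨i, hi⟩, false)
        split
        · next v hv => exact hinl _ h3 v hv
        · next q hq => exact hinr _ h3 q hq
      · have h3 := h.halfEnd_mem (⟨i, hi⟩, true)
        split
        · next v hv => exact hinl _ h3 v hv
        · next q hq => exact hinr _ h3 q hq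

end Good

theorem Circ.code_eq_enc_ops {m : ℕ} (c : Circ m) : c.code = Enc.enc c.ops := by
  induction c with
  | empty => rfl
  | prepZero c ih => exact congrArg (Data.node _) ih
  | prepPlus c ih => exact congrArg (Data.node _) ih
  | cnot c i j hne ih => exact congrArg (Data.node _) ih
  | measZ c q ih => exact congrArg (Data.node _) ih
  | measX c q ih => exact congrArg (Data.node _) ih
  | corrX c q cond hcond ih => exact congrArg (Data.node _) ih
  | corrZ c q cond hcond ih => exact congrArg (Data.node _) ih

end CatPrep

theorem mainTheorem2 :
    ∃ (P : CatPrep.Prog) (p : Polynomial ℕ),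
      ∀ (n t k : ℕ) (C : CatPrep.GenCNOTCircuit n),
        1 < n → C.circ.cnotCount = k → C.FTPreparesCAT t →
          ∃ (S : CatPrep.ZXDiagram n) (v e : ℕ) (spiders : Fin v ≃ S.V) (edges : Fin e ≃ S.E)
            (T : ℕ),
            P.Runs C.circ.code (S.code spiders edges) T ∧
            T ≤ p.eval C.circ.code.size ∧
            S.IsZGraph ∧
            v + 1 ≤ k ∧
            S.FTPreparesCAT t := by
  obtain ⟨P, p, hP⟩ := CatPrep.PolyFun.comp CatPrep.PolyFun.outputLists CatPrep.PolyFun.finalGraph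
  refine ⟨P, p, fun n t k C hn hk hC => ?_⟩
  have hD : C.circ.diagram.CatFlips t := CatPrep.ZXDiagram.FTPreparesCAT.catFlips hC
  obtain ⟨hk0, hG⟩ := CatPrep.good_graphEdges hn hD
  have hR := hG.reduce (st := ((CatPrep.symRun C.circ.ops).2.2.1,
    CatPrep.graphEdges (CatPrep.symRun C.circ.ops))) hn hD
  obtain ⟨T, hT, hTp⟩ := hP C.circ.ops
  refine ⟨hR.toDiagram, _, _, Equiv.refl _, Equiv.refl _, T, ?_, ?_,
    hR.isZGraph fun v hv => hG.deg_eq_three hn hD hv,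
    hk ▸ hG.length_lt (st := (_, _)) hn hD hk0,
    (hR.catFlips_toDiagram hD).ftPreparesCAT (by omega)⟩
  · rw [CatPrep.Circ.code_eq_enc_ops]
    exact hR.code_toDiagram ▸ hT
  · rw [CatPrep.Circ.code_eq_enc_ops]
    exact hTp
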